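/- Let $n\ge 2$ and let $\mathbb{H}^n$ be hyperbolic space with a fixed origin $O$; write its metric in geodesic polar coordinates around $O$ as $dr^2+\lambda(r)^2 g_{\mathbb{S}^{n-1}}$ with $\lambda(r)=\sinh r$. Let $B(r)$ and $S(r)=\partial B(r)$ be the geodesic ball and the geodesic sphere of radius $r$ centered at $O$, and put $$g(r)=\frac{|B(r)|}{|S(r)|}=\frac{1}{\lambda(r)^{n-1}}\int_0^r\lambda(s)^{n-1}\,ds .$$ Let $h:(0,\infty)\to(0,\infty)$ be the function determined by $$h\Big(\int_{B(r)}\frac{\lambda' g}{\lambda}\,dv\Big)=\frac{1}{|S(r)|}\qquad(r>0).$$ Let $0<T\le\infty$ and let $X:\mathbb{S}^{n-1}\times[0,T)\to\mathbb{H}^n$ be a smooth solution of the inverse mean curvature flow $$\frac{\partial X}{\partial t}=\frac{1}{H}\,\nu ,$$ where for each $t$ the map $X(\cdot,t)$ is a smooth embedding whose image $\Sigma_t$ is the boundary of a bounded domain $\Omega_t$, $\nu$ is the outward unit normal of $\Sigma_t$, and $H$ is its mean curvature (the sum of the principal curvatures), which is nowhere zero. Suppose that the initial hypersurface $\Sigma_0$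 is star-shaped with respect to $O$ (a smooth radial graph $\{r=\rho(\theta)\}$, $\rho>0$, over $\mathbb{S}^{n-1}$) and mean convex ($H>0$). Then the quantity $$A(t)=|\Sigma_t|^{-1}\,\frac{\int_{\Sigma_t} g\,d\mu_t}{|\Omega_t|\;h\big(\int_{\Omega_t}\frac{\lambda' g}{\lambda}\,dv_t\big)}$$ is non-increasing on $[0,T)$. Moreover $A$ is differentiable on $[0,T)$ (from the right at $t=0$), $A'(t)\le 0$ for every $t\in[0,T)$, and $A'(t)=0$ if and only if $\Sigma_t$ is a geodesic sphere centered at $O$. -/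

import Mathlib

open scoped Manifold ContDiff Topology

namespace HypFlow

noncomputable section

/-! Throughout, `m = n - 1`: the ambient space is hyperbolic space of dimension `n = m + 1` and
hypersurfaces are parametrised by the unit sphere of dimension `m`. -/

/-- Euclidean space of dimension `n = m + 1`. -/
abbrev Euc (m : ℕ) : Type := EuclideanSpace ℝ (Fin (m + 1))

/-- The standard unit sphere of dimension `m = n - 1`. -/
abbrev Sph (m : ℕ) : Type := Metric.sphere (0 : Euc m) 1

/-- The vector space underlying Minkowski space; the first component is the time component. -/
abbrev Mink (m : ℕ) : Type := ℝ × Euc m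

variable {m : ℕ}

/-- The Lorentzian form of Minkowski space. -/
def lorentz (p q : Mink m) : ℝ := inner ℝ p.2 q.2 - p.1 * q.1

/-- Hyperbolic space as the upper sheet of the unit hyperboloid in Minkowski space. Its Riemannian
metric is the restriction of `lorentz` to tangent spaces. The origin is `(1, 0)`. -/
abbrev Hyp (m : ℕ) : Type := {p : Mink m // lorentz p p = -1 ∧ 0 < p.1}

/-- Geodesic polar coordinates around the origin; in them the metric is the warped product
`dr ^ 2 + (sinh r) ^ 2 g_S`. -/
def polar (r : ℝ) (θ : Sph m) : Hyp m :=
  ⟨(Real.cosh r, Real.sinh r • (θ : Euc m)), by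
    have h : ‖(θ : Euc m)‖ = 1 := norm_eq_of_mem_sphere θ
    have h2 := Real.cosh_sq r
    simp only [lorentz, inner_smul_left, inner_smul_right, real_inner_self_eq_norm_sq, h]
    refine ⟨?_, Real.cosh_pos r⟩
    simp
    nlinarith⟩

/-- The geodesic distance to the origin: the point `polar r θ` with `0 ≤ r` has radius `r`. -/
def radius (p : Hyp m) : ℝ := Real.arsinh ‖(p : Mink m).2‖

/-- The surface measure of the unit sphere. -/
def sphMeasure (m : ℕ) : MeasureTheory.Measure (Sph m) :=
  (MeasureTheory.volume : MeasureTheory.Measure (Euc m)).toSphere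

/-- The Riemannian volume of hyperbolic space, `(sinh r) ^ (n - 1) dr dθ` in polar coordinates. -/
def hypVol (m : ℕ) : MeasureTheory.Measure (Hyp m) :=
  MeasureTheory.Measure.map (fun q : ℝ × Sph m => polar q.1 q.2)
    (((MeasureTheory.volume.restrict (Set.Ioi (0 : ℝ))).withDensity
      fun r => ENNReal.ofReal (Real.sinh r ^ m)).prod (sphMeasure m))

/-- The geodesic ball of radius `r` centred at the origin. -/
def ball (m : ℕ) (r : ℝ) : Set (Hyp m) := {p | radius p ≤ r}

/-- The geodesic sphere of radius `r` centred at the origin. -/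
def geodesicSphere (m : ℕ) (r : ℝ) : Set (Hyp m) := {p | radius p = r}

/-- The area of the geodesic sphere of radius `r`. -/
def sphereArea (m : ℕ) (r : ℝ) : ℝ := (sphMeasure m).real Set.univ * Real.sinh r ^ m

/-- The volume-area ratio of geodesic balls,
`g r = (sinh r) ^ (1 - n) * ∫ t in 0..r, (sinh t) ^ (n - 1)`. -/
def g (m : ℕ) (r : ℝ) : ℝ := (∫ t in (0 : ℝ)..r, Real.sinh t ^ m) / Real.sinh r ^ m

/-- The weight `λ' g / λ`, where `λ = sinh`, as a function of the radius. -/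
def weight (m : ℕ) (r : ℝ) : ℝ := Real.cosh r * g m r / Real.sinh r

/-- The integral of the weight over the geodesic ball of radius `r` centred at the origin. -/
def ballWeight (m : ℕ) (r : ℝ) : ℝ := ∫ p in ball m r, weight m (radius p) ∂(hypVol m)

/-- The function `h` on `(0, ∞)` with `h (ballWeight m r) = 1 / sphereArea m r` for `r > 0`:
`ballWeight m` is a strictly increasing bijection of `(0, ∞)` onto itself, and `h` is the reciprocal
of the sphere area composed with its inverse. -/
def h (m : ℕ) (s : ℝ) : ℝ :=
  1 / sphereArea m (Function.invFunOn (ballWeight m) (Set.Ioi 0) s)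

/-- The differential at `θ` of a map from the sphere to Minkowski space. -/
def diff (F : Sph m → Mink m) (θ : Sph m) : EuclideanSpace ℝ (Fin m) →L[ℝ] Mink m :=
  mfderiv (𝓡 m) 𝓘(ℝ, Mink m) F θ

/-- A map into hyperbolic space, seen as a map into Minkowski space. -/
def toMink (F : Sph m → Hyp m) : Sph m → Mink m := fun θ => (F θ : Mink m)

/-- The matrix of the metric induced by `F`, in the coordinate frame of the sphere at `θ`. -/
def gram (F : Sph m → Hyp m) (θ : Sph m) : Matrix (Fin m) (Fin m) ℝ :=
  Matrix.of fun i j => lorentz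
    (diff (toMink F) θ (EuclideanSpace.single i 1)) (diff (toMink F) θ (EuclideanSpace.single j 1))

/-- The matrix of the round metric of the sphere, in the same frame. -/
def roundGram (θ : Sph m) : Matrix (Fin m) (Fin m) ℝ :=
  Matrix.of fun i j =>
    let dι : EuclideanSpace ℝ (Fin m) →L[ℝ] Euc m :=
      mfderiv (𝓡 m) 𝓘(ℝ, Euc m) (fun ξ : Sph m => (ξ : Euc m)) θ
    inner ℝ (dι (EuclideanSpace.single i 1)) (dι (EuclideanSpace.single j 1))

/-- The area element of the hypersurface parametrised by `F`, relative to the surface measure of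
the unit sphere. -/
def areaDensity (F : Sph m → Hyp m) (θ : Sph m) : ℝ :=
  √(gram F θ).det / √(roundGram θ).det

/-- The integral `∫ f dμ` over the hypersurface parametrised by `F`. -/
def surfaceIntegral (F : Sph m → Hyp m) (f : Hyp m → ℝ) : ℝ :=
  ∫ θ, f (F θ) * areaDensity F θ ∂(sphMeasure m)

/-- The area of the hypersurface parametrised by `F`. -/
def area (F : Sph m → Hyp m) : ℝ := surfaceIntegral F fun _ => 1

/-- The matrix of the second fundamental form `II(u, v) = ⟨∇_u N, v⟩` of the hypersurface
parametrised by `F`, for a unit normal `N`. The Levi-Civita connection of the hyperboloid is the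
tangential part of the flat derivative of Minkowski space. -/
def secondForm (F : Sph m → Hyp m) (N : Sph m → Mink m) (θ : Sph m) :
    Matrix (Fin m) (Fin m) ℝ :=
  Matrix.of fun i j => lorentz
    (diff N θ (EuclideanSpace.single i 1)) (diff (toMink F) θ (EuclideanSpace.single j 1))

/-- The mean curvature (sum of the principal curvatures); it is positive on geodesic spheres when
`N` is the outward normal. -/
def meanCurvature (F : Sph m → Hyp m) (N : Sph m → Mink m) (θ : Sph m) : ℝ :=
  ((gram F θ)⁻¹ * secondForm F N θ).trace

/-- `F` is a smooth embedding of the sphere: a smooth injective immersion (the sphere being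
compact). -/
structure IsEmbedding (F : Sph m → Hyp m) : Prop where
  smooth : ContMDiff (𝓡 m) 𝓘(ℝ, Mink m) ∞ (toMink F)
  injective : Function.Injective F
  immersion : ∀ θ, Function.Injective (diff (toMink F) θ)

/-- `Ω` is a bounded domain whose boundary is `S`. -/
structure IsBoundedDomain (Ω S : Set (Hyp m)) : Prop where
  isOpen : IsOpen Ω
  connected : IsConnected Ω
  bounded : IsCompact (closure Ω)
  boundary : frontier Ω = S

/-- `N` is the outward unit normal along `F`, where the image of `F` bounds `Ω`: it is tangent to
the hyperboloid, of length one, orthogonal to the hypersurface, and the geodesic issuing from a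
point of the hypersurface with velocity `N` leaves the closure of `Ω`. -/
structure IsOutwardUnitNormal (F : Sph m → Hyp m) (Ω : Set (Hyp m)) (N : Sph m → Mink m) :
    Prop where
  smooth : ContMDiff (𝓡 m) 𝓘(ℝ, Mink m) ∞ N
  tangent : ∀ θ, lorentz (N θ) (F θ) = 0
  unit : ∀ θ, lorentz (N θ) (N θ) = 1
  normal : ∀ θ v, lorentz (N θ) (diff (toMink F) θ v) = 0
  outward : ∀ θ, ∀ᶠ s in 𝓝[>] (0 : ℝ),
    Real.cosh s • (F θ : Mink m) + Real.sinh s • N θ ∉ (Subtype.val '' closure Ω : Set (Mink m))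

/-- `S` is star-shaped with respect to the origin: a smooth radial graph over the unit sphere. -/
def IsStarShaped (S : Set (Hyp m)) : Prop :=
  ∃ ρ : Sph m → ℝ, ContMDiff (𝓡 m) 𝓘(ℝ, ℝ) ∞ ρ ∧ (∀ θ, 0 < ρ θ) ∧
    S = Set.range fun θ => polar (ρ θ) θ

/-- The hypersurface parametrised by `F` is mean convex with respect to the outward normal `N`. -/
def IsMeanConvex (F : Sph m → Hyp m) (N : Sph m → Mink m) : Prop :=
  ∀ θ, 0 < meanCurvature F N θ

/-- The time interval `[0, T)`, where `T` may be `∞`. -/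
def timeInterval (T : EReal) : Set ℝ := {t | 0 ≤ t ∧ (t : EReal) < T}

/-- A smooth solution `X` on `[0, T)` of the inverse mean curvature flow `∂X/∂t = ν / H`, where
`X t` parametrises the boundary of the bounded domain `Ω t` and `ν t` is its outward unit normal.
-/
structure IsIMCF (T : EReal) (X : ℝ → Sph m → Hyp m) (ν : ℝ → Sph m → Mink m)
    (Ω : ℝ → Set (Hyp m)) : Prop where
  smooth : ContMDiffOn ((𝓡 m).prod 𝓘(ℝ, ℝ)) 𝓘(ℝ, Mink m) ∞
    (fun q : Sph m × ℝ => (X q.2 q.1 : Mink m)) (Set.univ ×ˢ timeInterval T)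
  smooth_normal : ContMDiffOn ((𝓡 m).prod 𝓘(ℝ, ℝ)) 𝓘(ℝ, Mink m) ∞
    (fun q : Sph m × ℝ => ν q.2 q.1) (Set.univ ×ˢ timeInterval T)
  embedding : ∀ t ∈ timeInterval T, IsEmbedding (X t)
  domain : ∀ t ∈ timeInterval T, IsBoundedDomain (Ω t) (Set.range (X t))
  normal : ∀ t ∈ timeInterval T, IsOutwardUnitNormal (X t) (Ω t) (ν t)
  curvature_ne_zero : ∀ t ∈ timeInterval T, ∀ θ, meanCurvature (X t) (ν t) θ ≠ 0
  evolution : ∀ t ∈ timeInterval T, ∀ θ,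
    HasDerivWithinAt (fun s => (X s θ : Mink m))
      ((1 / meanCurvature (X t) (ν t) θ) • ν t θ) (timeInterval T) t

/-- The quantity `|Σ|⁻¹ ∫_Σ g dμ / (|Ω| h(∫_Ω λ' g / λ dv))` of the hypersurface `Σ` parametrised
by `F`, which bounds the domain `Ω`. -/
def quantityA (F : Sph m → Hyp m) (Ω : Set (Hyp m)) : ℝ :=
  (area F)⁻¹ * ((surfaceIntegral F fun p => g m (radius p)) /
    ((hypVol m).real Ω * h m (∫ p in Ω, weight m (radius p) ∂(hypVol m))))

end

end HypFlow

/-! Write `w = λ' g / λ`, `G = ∫ g dμ`, `V = |Ω|`, and let `B` be the volume of the centred geodesic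
ball of radius `R` having the same integral of `w` as `Ω`. Along the flow the area element grows
like `exp t`, the volume grows at rate `a = ∫ 1/H`, and the weighted volume at rate `b/m` with `b =
m ∫ w/H`. Since `g' = 1 - m w`, the derivative of `G` is `G + K` with `K = ∫ (1 - m w) ⟨∂_r, ν⟩ /
H`. The weight is exactly the one for which `h'/h = -m/B` (`hasDerivAt_h`). The growth of the area
cancels the term `G`, and `A'` is a positive multiple of `K - (G/V) a + (G/B) b`.

Three inequalities finish the argument. First, `K ≤ a - b` and `a - b > 0`, because `⟨∂_r, ν⟩ ≤ 1`
and `m w < 1` (`mul_weight_lt_one`). Second, `V ≤ B`: as `w` is nondecreasing in `r`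
(`monotoneOn_weight`), the ball has the largest volume for a given weight
(`IsBoundedDomain.hypVol_le_ball`). Third, `V ≤ G`. Together they bound the expression by `(a - b)(1
- G/V) ≤ 0`, and vanishing forces `G = V`.

The third one is the cone inequality `hypVol_le_cone`. The cone over `Σ` with apex at the origin
covers `Ω` up to the origin, and its volume counted with multiplicity is `∫ g |⟨∂_r, ν⟩| dμ ≤ G`. If
`G = V`, the normal is radial everywhere, so the radius is constant on `Σ`. Star-shapedness at
positive times is never needed: the initial hypothesis only places the origin in `Ω 0`, and the
growth of the domains keeps it inside.

For the analysis, the hyperboloid is projected to its spatial part. Volume then has density `1 / √(1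
+ ‖x‖²)`, and area elements become determinants of linear maps of Euclidean space. Rates of change
of domain integrals come from `exists_lintegral_domain`: near each time the track of the flow is an
injective local diffeomorphism from an annulus, a connectedness argument identifies `Ω t₁` with `Ω
t₀` plus the swept shell, and the change of variables formula applies. -/

open scoped Manifold ContDiff Topology

/-! ### Calculus of the radial functions `ballProfile`, `g` and `weight`. -/

namespace HypFlow

/-- The volume of a geodesic ball, up to the area of the unit sphere. -/
noncomputable def ballProfile (m : ℕ) (r : ℝ) : ℝ := ∫ t in (0 : ℝ)..r, Real.sinh t ^ m

lemma hasDerivAt_ballProfile (m : ℕ) (r : ℝ) :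
    HasDerivAt (ballProfile m) (Real.sinh r ^ m) r := by
  have hc : Continuous fun t => Real.sinh t ^ m := Real.continuous_sinh.pow m
  exact intervalIntegral.integral_hasDerivAt_right (hc.intervalIntegrable _ _)
    (hc.stronglyMeasurableAtFilter _ _) hc.continuousAt

lemma ballProfile_zero (m : ℕ) : ballProfile m 0 = 0 := by simp [ballProfile]

lemma ballProfile_pos (m : ℕ) {r : ℝ} (hr : 0 < r) : 0 < ballProfile m r := by
  apply intervalIntegral.intervalIntegral_pos_of_pos_on
  · exact (Real.continuous_sinh.pow m).intervalIntegrable _ _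
  · intro x hx
    exact pow_pos (Real.sinh_pos_iff.2 hx.1) m
  · exact hr

/-- A function vanishing at `0` whose derivative is dominated on `(0, ∞)`. -/
lemma lt_of_deriv_lt {f f' : ℝ → ℝ} (h0 : f 0 = 0) (hf : ∀ r, 0 ≤ r → HasDerivAt f (f' r) r)
    (h' : ∀ r, 0 < r → 0 < f' r) {r : ℝ} (hr : 0 < r) : 0 < f r := by
  have : StrictMonoOn f (Set.Ici 0) := by
    apply strictMonoOn_of_deriv_pos (convex_Ici 0)
    · exact fun x hx => (hf x hx).continuousAt.continuousWithinAt
    · intro x hx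
      rw [interior_Ici] at hx
      rw [(hf x (le_of_lt hx)).deriv]
      exact h' x hx
  rw [← h0]
  exact this (by simp) hr.le hr

lemma nonneg_of_deriv_nonneg {f f' : ℝ → ℝ} (h0 : f 0 = 0)
    (hf : ∀ r, 0 ≤ r → HasDerivAt f (f' r) r)
    (h' : ∀ r, 0 < r → 0 ≤ f' r) {r : ℝ} (hr : 0 < r) : 0 ≤ f r := by
  have : MonotoneOn f (Set.Ici 0) := by
    apply monotoneOn_of_deriv_nonneg (convex_Ici 0)
    · exact fun x hx => (hf x hx).continuousAt.continuousWithinAt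
    · exact fun x hx => (hf x (interior_subset hx)).differentiableAt.differentiableWithinAt
    · intro x hx
      rw [interior_Ici] at hx
      rw [(hf x (le_of_lt hx)).deriv]
      exact h' x hx
  rw [← h0]
  exact this (by simp) hr.le hr.le

/-- By `cosh ^ 2 - sinh ^ 2 = 1`, the difference of the two sides has derivative `k * sinh ^ (k -
1)`. It serves as the derivative estimate in `mul_ballProfile_lt`. -/
lemma succ_mul_ballProfile_lt (k : ℕ) {r : ℝ} (hr : 0 < r) :
    (k + 1) * ballProfile (k + 1) r < Real.sinh r ^ k * Real.cosh r := by
  have hd : ∀ r : ℝ, HasDerivAt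
      (fun r => Real.sinh r ^ k * Real.cosh r - (k + 1) * ballProfile (k + 1) r)
      ((k * Real.sinh r ^ (k - 1) * Real.cosh r) * Real.cosh r
        + Real.sinh r ^ k * Real.sinh r - (k + 1) * Real.sinh r ^ (k + 1)) r := fun r =>
    (((Real.hasDerivAt_sinh r).pow k).mul (Real.hasDerivAt_cosh r)).sub
      ((hasDerivAt_ballProfile (k + 1) r).const_mul _)
  rcases k with _ | k
  -- For `k = 0` the difference is identically `1`; subtracting this constant leaves a function that
  -- starts at zero and has zero derivative.
  · have := nonneg_of_deriv_nonneg (f := fun r => Real.sinh r ^ 0 * Real.cosh r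
      - ((0 : ℕ) + 1) * ballProfile (0 + 1) r - 1) (by simp [ballProfile_zero])
      (fun r _ => (hd r).sub_const 1) (fun r _ => by simp) hr
    linarith
  · have := lt_of_deriv_lt (by simp [ballProfile_zero]) (fun r _ => hd r) (fun r hr => ?_) hr
    · linarith
    · have hs := Real.sinh_pos_iff.2 hr
      have : (0 : ℝ) < (k + 1) * Real.sinh r ^ k := by positivity
      have h2 := Real.cosh_sq r
      simp only [Nat.add_sub_cancel]
      push_cast
      linear_combination this - (k + 1 : ℝ) * Real.sinh r ^ k * h2

/-- The difference of the two sides has derivative `sinh` times the gap in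
`succ_mul_ballProfile_lt`. In terms of the weight this is `m w < 1`, that is `g' > 0`. -/
lemma mul_ballProfile_lt (m : ℕ) (hm : 1 ≤ m) {r : ℝ} (hr : 0 < r) :
    m * (Real.cosh r * ballProfile m r) < Real.sinh r ^ (m + 1) := by
  obtain ⟨k, rfl⟩ : ∃ k, m = k + 1 := ⟨m - 1, by omega⟩
  have := lt_of_deriv_lt (f := fun r => Real.sinh r ^ (k + 1 + 1)
      - (k + 1) * (Real.cosh r * ballProfile (k + 1) r))
    (f' := fun r => ((k + 1 + 1 : ℕ) * Real.sinh r ^ (k + 1) * Real.cosh r)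
      - (k + 1) * (Real.sinh r * ballProfile (k + 1) r + Real.cosh r * Real.sinh r ^ (k + 1)))
    (by simp [ballProfile_zero])
    (fun r _ => (((Real.hasDerivAt_sinh r).pow (k + 1 + 1))).sub
        (((Real.hasDerivAt_cosh r).mul (hasDerivAt_ballProfile (k + 1) r)).const_mul _)) ?_ hr
  · push_cast; linarith
  · intro r hr
    have h2 := mul_pos (Real.sinh_pos_iff.2 hr) (sub_pos.2 (succ_mul_ballProfile_lt k hr))
    push_cast
    linear_combination h2

/-- This is the sign of the derivative of `weight`. Dividing by `m cosh² + 1` isolates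
`ballProfile`, whose derivative is `sinh ^ m`; the derivatives then differ by `2 sinh ^ (m + 2) / (m
cosh² + 1)²`. -/
lemma mul_cosh_sq_add_one_mul_ballProfile_le (m : ℕ) {r : ℝ} (hr : 0 < r) :
    (m * Real.cosh r ^ 2 + 1) * ballProfile m r ≤ Real.sinh r ^ (m + 1) * Real.cosh r := by
  have hpos : ∀ r : ℝ, 0 < m * Real.cosh r ^ 2 + 1 := fun r => by positivity
  have := nonneg_of_deriv_nonneg
    (f := fun r => (Real.sinh r ^ (m + 1) * Real.cosh r) / (m * Real.cosh r ^ 2 + 1)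
      - ballProfile m r)
    (by simp [ballProfile_zero])
    (fun r _ => (((((Real.hasDerivAt_sinh r).pow (m + 1)).mul (Real.hasDerivAt_cosh r)).div
      ((((Real.hasDerivAt_cosh r).pow 2).const_mul (m : ℝ)).add_const 1) (hpos r).ne').sub
      (hasDerivAt_ballProfile m r))) (fun r hr => ?_) hr
  · rw [sub_nonneg, le_div_iff₀ (hpos r)] at this
    linarith
  · have hs := Real.sinh_pos_iff.2 hr
    rw [sub_nonneg]
    simp only [Pi.pow_apply, Pi.mul_apply]
    rw [le_div_iff₀ (by have := hpos r; positivity)]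
    have h2 := Real.cosh_sq r
    have h3 : 0 ≤ Real.sinh r ^ m * (2 * Real.sinh r ^ 2) := by positivity
    simp only [Nat.add_sub_cancel]
    push_cast
    have h4 : Real.sinh r ^ 2 = Real.cosh r ^ 2 - 1 := by linarith
    have : (((m : ℝ) + 1) * Real.sinh r ^ m * Real.cosh r * Real.cosh r
        + Real.sinh r ^ (m + 1) * Real.sinh r) * (m * Real.cosh r ^ 2 + 1)
        - Real.sinh r ^ (m + 1) * Real.cosh r * (m * (2 * Real.cosh r ^ (2 - 1) * Real.sinh r))
        - Real.sinh r ^ m * (m * Real.cosh r ^ 2 + 1) ^ 2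
        = Real.sinh r ^ m * (2 * Real.sinh r ^ 2) := by
      have : ∀ s c : ℝ, s ^ 2 = c ^ 2 - 1 → (((m : ℝ) + 1) * s ^ m * c * c
        + s ^ (m + 1) * s) * (m * c ^ 2 + 1)
        - s ^ (m + 1) * c * (m * (2 * c ^ (2 - 1) * s))
        - s ^ m * (m * c ^ 2 + 1) ^ 2
        = s ^ m * (2 * s ^ 2) := by
        intro s c h
        have e : s ^ (m + 1) * s = s ^ m * (c ^ 2 - 1) := by rw [← h]; ring
        have e2 : s ^ (m + 1) * c * (m * (2 * c ^ (2 - 1) * s))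
          = s ^ m * (c ^ 2 - 1) * (2 * m * c ^ 2) := by rw [← h]; ring
        rw [e, e2, h]; ring
      exact this _ _ h4
    norm_num at this ⊢
    linarith

lemma g_eq (m : ℕ) (r : ℝ) : g m r = ballProfile m r / Real.sinh r ^ m := rfl

lemma weight_eq (m : ℕ) (r : ℝ) :
    weight m r = Real.cosh r * ballProfile m r / Real.sinh r ^ (m + 1) := by
  rw [weight, g_eq, pow_succ]; field_simp

lemma g_pos (m : ℕ) {r : ℝ} (hr : 0 < r) : 0 < g m r :=
  div_pos (ballProfile_pos m hr) (pow_pos (Real.sinh_pos_iff.2 hr) m)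

lemma weight_pos (m : ℕ) {r : ℝ} (hr : 0 < r) : 0 < weight m r :=
  div_pos (mul_pos (Real.cosh_pos r) (g_pos m hr)) (Real.sinh_pos_iff.2 hr)

lemma mul_weight_lt_one (m : ℕ) (hm : 1 ≤ m) {r : ℝ} (hr : 0 < r) : m * weight m r < 1 := by
  have hs := Real.sinh_pos_iff.2 hr
  rw [weight_eq, ← mul_div_assoc, div_lt_one (by positivity)]
  exact mul_ballProfile_lt m hm hr

lemma weight_le_one (m : ℕ) (hm : 1 ≤ m) {r : ℝ} (hr : 0 < r) : weight m r ≤ 1 := by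
  have h1 := mul_weight_lt_one m hm hr
  have h2 := weight_pos m hr
  have : (1 : ℝ) ≤ m := by exact_mod_cast hm
  nlinarith

lemma hasDerivAt_g (m : ℕ) {r : ℝ} (hr : 0 < r) : HasDerivAt (g m) (1 - m * weight m r) r := by
  have hs := (Real.sinh_pos_iff.2 hr).ne'
  have := (hasDerivAt_ballProfile m r).div ((Real.hasDerivAt_sinh r).pow m) (pow_ne_zero m hs)
  refine this.congr_deriv ?_
  rw [weight_eq]
  simp only [Pi.pow_apply]
  rcases m with _ | m
  · simp
  · simp only [Nat.add_sub_cancel]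
    field_simp
    ring

lemma hasDerivAt_weight (m : ℕ) {r : ℝ} (hr : 0 < r) :
    HasDerivAt (weight m) ((Real.sinh r ^ (m + 1) * Real.cosh r
      - (m * Real.cosh r ^ 2 + 1) * ballProfile m r) / Real.sinh r ^ (m + 2)) r := by
  have hs := (Real.sinh_pos_iff.2 hr).ne'
  have := ((Real.hasDerivAt_cosh r).mul (hasDerivAt_ballProfile m r)).div
    ((Real.hasDerivAt_sinh r).pow (m + 1)) (pow_ne_zero (m + 1) hs)
  have e : weight m = fun r => Real.cosh r * ballProfile m r / Real.sinh r ^ (m + 1) :=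
    funext (weight_eq m)
  rw [e]
  refine this.congr_deriv ?_
  simp only [Pi.pow_apply, Pi.mul_apply, Nat.add_sub_cancel]
  have h2 : Real.cosh r ^ 2 = Real.sinh r ^ 2 + 1 := Real.cosh_sq r
  field_simp
  push_cast
  rw [h2]
  ring

lemma monotoneOn_weight (m : ℕ) : MonotoneOn (weight m) (Set.Ioi 0) := by
  apply monotoneOn_of_deriv_nonneg (convex_Ioi 0)
  · exact fun x hx => (hasDerivAt_weight m hx).continuousAt.continuousWithinAt
  · exact fun x hx =>
      (hasDerivAt_weight m (interior_subset hx)).differentiableAt.differentiableWithinAt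
  · intro x hx
    rw [interior_Ioi] at hx
    have hs := Real.sinh_pos_iff.2 hx
    rw [(hasDerivAt_weight m hx).deriv]
    exact div_nonneg (sub_nonneg.2 (mul_cosh_sq_add_one_mul_ballProfile_le m hx)) (by positivity)

lemma continuousOn_weight (m : ℕ) : ContinuousOn (weight m) (Set.Ioi 0) :=
  fun _ hx => (hasDerivAt_weight m hx).continuousAt.continuousWithinAt

lemma continuousOn_g (m : ℕ) : ContinuousOn (g m) (Set.Ioi 0) :=
  fun _ hx => (hasDerivAt_g m hx).continuousAt.continuousWithinAt

end HypFlow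

/-! ### Hyperbolic volume in polar and in spatial coordinates. -/

namespace HypFlow

open MeasureTheory Set

variable {m : ℕ}

lemma lintegral_polar {F : Euc m → ENNReal} (hF : Measurable F) :
    ∫⁻ x, F x = ∫⁻ θ : Sph m, ∫⁻ s in Ioi (0 : ℝ),
      ENNReal.ofReal (s ^ m) * F (s • (θ : Euc m)) ∂volume ∂(sphMeasure m) := by
  have hmp := (volume : Measure (Euc m)).measurePreserving_homeomorphUnitSphereProd
  have hd : Module.finrank ℝ (Euc m) - 1 = m := by simp
  rw [hd] at hmp
  have h1 : ∫⁻ x, F x = ∫⁻ x : ({0}ᶜ : Set (Euc m)), F x ∂((volume : Measure (Euc m)).comap (↑)) := by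
    rw [lintegral_subtype_comap (measurableSet_singleton _).compl, restrict_compl_singleton]
  have h2 : ∀ x : ({0}ᶜ : Set (Euc m)), F x = (fun q : Sph m × Ioi (0 : ℝ) => F (q.2.1 • (q.1 : Euc m)))
      (homeomorphUnitSphereProd (Euc m) x) := by
    intro x
    have : (x : Euc m) ≠ 0 := x.2
    simp [smul_smul, norm_ne_zero_iff.2 this]
  have hm1 : Measurable (fun q : Sph m × Ioi (0 : ℝ) => F (q.2.1 • (q.1 : Euc m))) := by
    apply hF.comp
    fun_prop
  rw [h1]
  simp_rw [h2]
  rw [hmp.lintegral_comp hm1, lintegral_prod _ hm1.aemeasurable]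
  refine lintegral_congr fun θ => ?_
  have hd1 : Measurable fun r : Ioi (0 : ℝ) => ENNReal.ofReal (r.1 ^ m) := by fun_prop
  have hm2 : Measurable fun r : Ioi (0 : ℝ) => F (r.1 • (θ : Euc m)) :=
    hm1.comp measurable_prodMk_left
  rw [Measure.volumeIoiPow, lintegral_withDensity_eq_lintegral_mul _ hd1 hm2, ← lintegral_subtype_comap measurableSet_Ioi]
  rfl

/-- The point of hyperbolic space with a given spatial part. -/
noncomputable def ofSpatial (x : Euc m) : Hyp m :=
  ⟨(√(1 + ‖x‖ ^ 2), x), by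
    have : 0 ≤ 1 + ‖x‖ ^ 2 := by positivity
    refine ⟨?_, Real.sqrt_pos.2 (by positivity)⟩
    rw [lorentz, real_inner_self_eq_norm_sq, Real.mul_self_sqrt this]
    ring⟩

lemma Hyp.time_sq (p : Hyp m) : p.1.1 ^ 2 = 1 + ‖p.1.2‖ ^ 2 := by
  have := p.2.1
  rw [lorentz, real_inner_self_eq_norm_sq] at this
  linarith [sq p.1.1]

lemma Hyp.time_eq (p : Hyp m) : p.1.1 = √(1 + ‖p.1.2‖ ^ 2) := by
  rw [← p.time_sq, Real.sqrt_sq p.2.2.le]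

lemma ofSpatial_spatial (p : Hyp m) : ofSpatial p.1.2 = p := by
  apply Subtype.ext
  exact Prod.ext p.time_eq.symm rfl

/-- Hyperbolic space is homeomorphic to Euclidean space through the spatial part. -/
noncomputable def spatialHomeo (m : ℕ) : Hyp m ≃ₜ Euc m where
  toFun p := p.1.2
  invFun := ofSpatial
  left_inv := ofSpatial_spatial
  right_inv _ := rfl
  continuous_toFun := by fun_prop
  continuous_invFun := by unfold ofSpatial; fun_prop

lemma continuous_ofSpatial : Continuous (ofSpatial : Euc m → Hyp m) :=
  (spatialHomeo m).symm.continuous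

lemma polar_eq_ofSpatial (r : ℝ) (θ : Sph m) :
    polar r θ = ofSpatial (Real.sinh r • (θ : Euc m)) :=
  (ofSpatial_spatial (polar r θ)).symm

lemma continuous_polar : Continuous fun q : ℝ × Sph m => polar q.1 q.2 := by
  unfold polar; fun_prop

instance : IsFiniteMeasure (sphMeasure m) := by unfold sphMeasure; infer_instance

lemma lintegral_hypVol_polar {f : Hyp m → ENNReal} (hf : Measurable f) :
    ∫⁻ p, f p ∂(hypVol m) = ∫⁻ θ : Sph m, ∫⁻ r in Ioi (0 : ℝ),
      ENNReal.ofReal (Real.sinh r ^ m) * f (polar r θ) ∂volume ∂(sphMeasure m) := by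
  have hp := continuous_polar (m := m)
  have hfp : Measurable fun q : ℝ × Sph m => f (polar q.1 q.2) := hf.comp hp.measurable
  rw [hypVol, lintegral_map hf hp.measurable, lintegral_prod_symm' _ hfp]
  refine lintegral_congr fun θ => ?_
  have hft : Measurable fun r => f (polar r θ) :=
    hf.comp (hp.measurable.comp measurable_prodMk_right)
  have hsm : Measurable fun r => ENNReal.ofReal (Real.sinh r ^ m) := by fun_prop
  rw [lintegral_withDensity_eq_lintegral_mul _ hsm hft]
  rfl

/-- In the projection to the spatial part, hyperbolic volume is Lebesgue measure divided by the time
component. Every later change of variables can thus be done in Euclidean space. -/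
lemma lintegral_hypVol {f : Hyp m → ENNReal} (hf : Measurable f) :
    ∫⁻ p, f p ∂(hypVol m) =
      ∫⁻ x : Euc m, ENNReal.ofReal (1 / √(1 + ‖x‖ ^ 2)) * f (ofSpatial x) := by
  have hfs : Measurable fun x : Euc m =>
      ENNReal.ofReal (1 / √(1 + ‖x‖ ^ 2)) * f (ofSpatial x) :=
    Measurable.mul (by fun_prop) (hf.comp continuous_ofSpatial.measurable)
  rw [lintegral_hypVol_polar hf, lintegral_polar hfs]
  refine lintegral_congr fun θ => ?_
  -- The substitution `s = sinh r` turns the Euclidean radial element `s ^ m ds / √(1 + s ^ 2)` into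
  -- `sinh r ^ m dr`.
  have himg : Real.sinh '' Ioi 0 = Ioi 0 := by
    ext y
    constructor
    · rintro ⟨x, hx, rfl⟩; exact Real.sinh_pos_iff.2 hx
    · intro hy; exact ⟨Real.arsinh y, Real.arsinh_pos_iff.2 hy, Real.sinh_arsinh y⟩
  conv_rhs => rw [← himg]
  rw [lintegral_image_eq_lintegral_abs_deriv_mul measurableSet_Ioi
    (fun x _ => (Real.hasDerivAt_sinh x).hasDerivWithinAt) Real.sinh_injective.injOn]
  refine setLIntegral_congr_fun measurableSet_Ioi fun r hr => ?_
  have hs := Real.sinh_pos_iff.2 hr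
  have hn : ‖(θ : Euc m)‖ = 1 := norm_eq_of_mem_sphere θ
  have hc : √(1 + ‖Real.sinh r • (θ : Euc m)‖ ^ 2) = Real.cosh r := by
    rw [norm_smul, hn, mul_one, Real.norm_eq_abs, sq_abs, add_comm, ← Real.cosh_sq,
      Real.sqrt_sq (Real.cosh_pos r).le]
  rw [← polar_eq_ofSpatial, hc, abs_of_pos (Real.cosh_pos r), ← mul_assoc, ← mul_assoc,
    ← ENNReal.ofReal_mul (Real.cosh_pos r).le, ← ENNReal.ofReal_mul (by positivity)]
  congr 2
  have := (Real.cosh_pos r).ne'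
  field_simp

/-- The volume density in the spatial coordinates. -/
noncomputable def volDensity (x : Euc m) : ENNReal := ENNReal.ofReal (1 / √(1 + ‖x‖ ^ 2))

lemma measurable_volDensity : Measurable (volDensity (m := m)) := by
  unfold volDensity; fun_prop

lemma hypVol_eq_map :
    hypVol m = Measure.map ofSpatial ((volume : Measure (Euc m)).withDensity volDensity) := by
  refine Measure.ext_of_lintegral _ fun f hf => ?_
  have hc := (continuous_ofSpatial (m := m)).measurable
  have hfc : Measurable fun x => f (ofSpatial x) := hf.comp hc
  rw [lintegral_hypVol hf, lintegral_map hf hc,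
    lintegral_withDensity_eq_lintegral_mul _ measurable_volDensity hfc]
  rfl

lemma setLIntegral_hypVol {f : Hyp m → ENNReal} (hf : Measurable f) {s : Set (Hyp m)}
    (hs : MeasurableSet s) :
    ∫⁻ p in s, f p ∂(hypVol m) =
      ∫⁻ x in ofSpatial ⁻¹' s, volDensity x * f (ofSpatial x) := by
  have hc := (continuous_ofSpatial (m := m)).measurable
  have hfc : Measurable fun x => f (ofSpatial x) := hf.comp hc
  rw [hypVol_eq_map, Measure.restrict_map hc hs, lintegral_map hf hc,
    restrict_withDensity (hc hs), lintegral_withDensity_eq_lintegral_mul _ measurable_volDensity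
    hfc]
  rfl

end HypFlow

/-! ### Determinants: Jacobi's formula and Gram determinants. -/

namespace HypFlow

open Matrix

section Jacobi

/-- In the permutation expansion at the identity matrix only the identity permutation contributes:
any other one moves at least two indices, so an off-diagonal zero survives the differentiation of a
single factor. -/
lemma hasDerivWithinAt_det_of_eq_one {n : Type*} [Fintype n] [DecidableEq n]
    {P : ℝ → Matrix n n ℝ} {P' : Matrix n n ℝ} {s : Set ℝ} {t : ℝ} (hP1 : P t = 1)
    (hP : ∀ i j, HasDerivWithinAt (fun u => P u i j) (P' i j) s t) :
    HasDerivWithinAt (fun u => (P u).det) P'.trace s t := by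
  simp_rw [det_apply]
  have h : ∀ σ : Equiv.Perm n, HasDerivWithinAt
      (fun u => Equiv.Perm.sign σ • ∏ i, P u (σ i) i) (if σ = 1 then P'.trace else 0) s t := by
    intro σ
    have h1 := (HasDerivWithinAt.fun_finsetProd (u := Finset.univ)
      (fun i _ => hP (σ i) i)).const_smul (Equiv.Perm.sign σ : ℤ)
    refine h1.congr_deriv ?_
    split_ifs with hσ
    · subst hσ
      simp [hP1, Matrix.trace]
    · convert smul_zero _
      refine Finset.sum_eq_zero fun i _ => ?_
      obtain ⟨j, hji, hj⟩ : ∃ j, j ≠ i ∧ σ j ≠ j := by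
        by_contra! hcon
        apply hσ
        have hi : σ i = i := by
          by_contra hi
          have := hcon (σ i) hi
          exact hi (σ.injective this)
        ext k
        by_cases hk : k = i
        · simp [hk, hi]
        · simp [hcon k hk]
      rw [Finset.prod_eq_zero (i := j) (by simp [hji]) (by simp [hP1, hj]), zero_smul]
  have := HasDerivWithinAt.fun_sum (u := Finset.univ) fun σ _ => h σ
  simpa using this

/-- Jacobi's formula for the derivative of a determinant. -/
lemma hasDerivWithinAt_det {n : Type*} [Fintype n] [DecidableEq n]
    {P : ℝ → Matrix n n ℝ} {P' : Matrix n n ℝ} {s : Set ℝ} {t : ℝ} (hdet : (P t).det ≠ 0)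
    (hP : ∀ i j, HasDerivWithinAt (fun u => P u i j) (P' i j) s t) :
    HasDerivWithinAt (fun u => (P u).det) ((P t).det * ((P t)⁻¹ * P').trace) s t := by
  have hu : IsUnit (P t).det := isUnit_iff_ne_zero.2 hdet
  -- Multiplying by the constant matrix `(P t)⁻¹` reduces to a curve through the identity.
  have h1 := hasDerivWithinAt_det_of_eq_one (P := fun u => (P t)⁻¹ * P u) (P' := (P t)⁻¹ * P')
    (s := s) (t := t) (nonsing_inv_mul _ hu) (fun i j => by
      simp only [mul_apply]
      exact HasDerivWithinAt.fun_sum fun k _ => (hP k j).const_mul _)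
  refine (h1.const_mul (P t).det).congr_of_eventuallyEq (.of_forall fun u => ?_) ?_
  · simp only [det_mul]
    rw [← mul_assoc, ← det_mul, mul_nonsing_inv _ hu, det_one, one_mul]
  · simp only [det_mul]
    rw [← mul_assoc, ← det_mul, mul_nonsing_inv _ hu, det_one, one_mul]

end Jacobi

variable {m : ℕ}

lemma det_one_sub_outer {n : Type*} [Fintype n] [DecidableEq n] (c : ℝ) (y : n → ℝ) :
    (1 - Matrix.of fun i j => c * y i * y j : Matrix n n ℝ).det = 1 - c * ∑ i, y i * y i := by
  have := det_one_add_replicateCol_mul_replicateRow (ι := Unit) (fun i => -c * y i) y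
  have e : (1 - Matrix.of fun i j => c * y i * y j : Matrix n n ℝ) =
      1 + replicateCol Unit (fun i => -c * y i) * replicateRow Unit y := by
    ext i j
    simp [Matrix.mul_apply]
    ring
  rw [e, this, dotProduct, sub_eq_add_neg, ← neg_mul, Finset.mul_sum]
  congr 1
  exact Finset.sum_congr rfl fun i _ => by ring

/-- A determinant with respect to a vector orthogonal to all the others. -/
lemma det_cons_of_orthogonal {k : ℕ} (G : Matrix (Fin k) (Fin k) ℝ)
    (G' : Matrix (Fin (k + 1)) (Fin (k + 1)) ℝ) (h00 : G' 0 0 = 1) (h0 : ∀ j, G' 0 (Fin.succ j) = 0)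
    (hs : ∀ i j, G' (Fin.succ i) (Fin.succ j) = G i j) : G'.det = G.det := by
  rw [det_succ_row_zero, Fin.sum_univ_succ]
  simp only [h0, h00]
  have : G'.submatrix Fin.succ Fin.succ = G := by
    ext i j; simp [hs]
  simp [this]

/-- The Gram determinant of the images of a family of vectors. -/
lemma det_bilin_comp (A : Euc m →ₗ[ℝ] Euc m) (u : Fin (m + 1) → Euc m)
    (S : Matrix (Fin (m + 1)) (Fin (m + 1)) ℝ) :
    (Matrix.of fun i j => (A (u i)).ofLp ⬝ᵥ S *ᵥ (A (u j)).ofLp).det =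
      LinearMap.det A ^ 2 * (Matrix.of fun i j => inner ℝ (u i) (u j)).det * S.det := by
  set b := (EuclideanSpace.basisFun (Fin (m + 1)) ℝ).toBasis
  set M := LinearMap.toMatrix b b A
  set U : Matrix (Fin (m + 1)) (Fin (m + 1)) ℝ := Matrix.of fun k j => u j k
  have hM : M.det = LinearMap.det A := LinearMap.det_toMatrix b A
  have hA : ∀ x : Euc m, (A x).ofLp = M *ᵥ x.ofLp := by
    intro x
    have hr : ∀ x : Euc m, ⇑(b.repr x) = x.ofLp := by intro x; ext i; simp [b]
    rw [← hr x, ← hr (A x)]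
    exact (LinearMap.toMatrix_mulVec_repr b b A x).symm
  have h1 : (Matrix.of fun i j => (A (u i)).ofLp ⬝ᵥ S *ᵥ (A (u j)).ofLp) =
      (M * U)ᵀ * S * (M * U) := by
    ext i j
    have e : ∀ j, (A (u j)).ofLp = fun k => (M * U) k j := by
      intro j; rw [hA]; rfl
    simp only [Matrix.of_apply, e]
    rw [mul_assoc]
    rfl
  have h2 : (Matrix.of fun i j => inner ℝ (u i) (u j)) = Uᵀ * U := by
    ext i j
    simp [U, Matrix.mul_apply, PiLp.inner_apply, mul_comm]
  rw [h1, h2]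
  simp only [det_mul, det_transpose, hM]
  ring


/-! ### Lorentzian algebra and the metric on spatial parts. -/

lemma lorentz_comm (p q : Mink m) : lorentz p q = lorentz q p := by
  rw [lorentz, lorentz, real_inner_comm, mul_comm]

lemma lorentz_add_left (p q r : Mink m) : lorentz (p + q) r = lorentz p r + lorentz q r := by
  simp only [lorentz, Prod.snd_add, Prod.fst_add, inner_add_left]; ring

lemma lorentz_smul_left (c : ℝ) (p q : Mink m) : lorentz (c • p) q = c * lorentz p q := by
  change inner ℝ (c • p.2) q.2 - c * p.1 * q.1 = c * (inner ℝ p.2 q.2 - p.1 * q.1)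
  rw [real_inner_smul_left]; ring

lemma lorentz_add_right (p q r : Mink m) : lorentz p (q + r) = lorentz p q + lorentz p r := by
  rw [lorentz_comm, lorentz_add_left, lorentz_comm q, lorentz_comm r]

lemma lorentz_smul_right (c : ℝ) (p q : Mink m) : lorentz p (c • q) = c * lorentz p q := by
  rw [lorentz_comm, lorentz_smul_left, lorentz_comm]

/-- The metric of the hyperboloid at `X`, on the spatial parts of tangent vectors. -/
noncomputable def spatialForm (X : Mink m) (a b : Euc m) : ℝ :=
  inner ℝ a b - inner ℝ a X.2 * inner ℝ b X.2 / X.1 ^ 2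

lemma spatialForm_add_left (X : Mink m) (a b c : Euc m) :
    spatialForm X (a + b) c = spatialForm X a c + spatialForm X b c := by
  simp only [spatialForm, inner_add_left]; ring

lemma spatialForm_smul_left (X : Mink m) (r : ℝ) (a c : Euc m) :
    spatialForm X (r • a) c = r * spatialForm X a c := by
  simp only [spatialForm, inner_smul_left]; simp; ring

/-- Orthogonality to `X` determines the time component of a tangent vector as `⟪u.2, X.2⟫ / X.1`, so
spatial parts carry the whole metric. -/
lemma spatialForm_eq_lorentz {X u v : Mink m} (hX : X.1 ≠ 0) (hu : lorentz u X = 0)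
    (hv : lorentz v X = 0) : spatialForm X u.2 v.2 = lorentz u v := by
  simp only [lorentz, spatialForm] at *
  have h1 : inner ℝ u.2 X.2 = u.1 * X.1 := by linarith
  have h2 : inner ℝ v.2 X.2 = v.1 * X.1 := by linarith
  rw [h1, h2]
  field_simp

lemma spatialForm_self_left {X N : Mink m} (hX : lorentz X X = -1) (hX1 : X.1 ≠ 0)
    (hN : lorentz N X = 0) : spatialForm X X.2 N.2 = N.1 / X.1 := by
  simp only [lorentz, spatialForm] at *
  have h1 : inner ℝ X.2 X.2 = X.1 * X.1 - 1 := by linarith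
  have h2 : inner ℝ N.2 X.2 = N.1 * X.1 := by linarith
  rw [real_inner_comm, h1, h2]
  field_simp
  ring

/-- The spatial metric as a matrix. -/
noncomputable def spatialMatrix (X : Mink m) : Matrix (Fin (m + 1)) (Fin (m + 1)) ℝ :=
  1 - Matrix.of fun i j => 1 / X.1 ^ 2 * X.2 i * X.2 j

lemma dotProduct_spatialMatrix (X : Mink m) (a b : Euc m) :
    a.ofLp ⬝ᵥ spatialMatrix X *ᵥ b.ofLp = spatialForm X a b := by
  have hi : ∀ a b : Euc m, inner ℝ a b = ∑ i, a i * b i := fun a b => by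
    simp [PiLp.inner_apply, mul_comm]
  have e : (Matrix.of fun i j => 1 / X.1 ^ 2 * X.2 i * X.2 j :
      Matrix (Fin (m + 1)) (Fin (m + 1)) ℝ) *ᵥ b.ofLp =
      fun i => 1 / X.1 ^ 2 * X.2 i * ∑ j, b j * X.2 j := by
    ext i
    simp only [Matrix.mulVec, dotProduct, Matrix.of_apply, Finset.mul_sum]
    exact Finset.sum_congr rfl fun j _ => by ring
  rw [spatialMatrix, sub_mulVec, one_mulVec, dotProduct_sub, e, spatialForm, hi, hi, hi]
  congr 1
  simp only [dotProduct]
  rw [mul_div_right_comm, Finset.sum_div, Finset.sum_mul]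
  refine Finset.sum_congr rfl fun i _ => ?_
  ring

lemma det_spatialMatrix {X : Mink m} (hX : lorentz X X = -1) (hX1 : X.1 ≠ 0) :
    (spatialMatrix X).det = 1 / X.1 ^ 2 := by
  rw [spatialMatrix, det_one_sub_outer]
  have : ∑ i, X.2 i * X.2 i = X.1 ^ 2 - 1 := by
    simp only [lorentz, PiLp.inner_apply, RCLike.inner_apply, conj_trivial] at hX
    linarith [sq X.1]
  rw [this]
  field_simp
  ring

/-- The linear map extending the spatial part of `L` by sending `θ` to the spatial part of `Z`,
when `L θ = 0`. -/
noncomputable def tilt (L : Euc m →L[ℝ] Mink m) (θ : Euc m) (z : Euc m) : Euc m →L[ℝ] Euc m :=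
  (ContinuousLinearMap.snd ℝ ℝ (Euc m)).comp L + (innerSL ℝ θ).smulRight z

lemma tilt_apply (L : Euc m →L[ℝ] Mink m) (θ z v : Euc m) :
    tilt L θ z v = (L v).2 + inner ℝ θ v • z := rfl

/-- Both sides come from the Gram determinant, in the hyperbolic metric, of the images of `θ, b 0, b
1, …`. The image `N` of `θ` is a unit vector orthogonal to the others, so it drops out, as `θ` does
on the Euclidean side. The factor `X.1 ^ 2` is the reciprocal of the determinant of the spatial
metric. -/
lemma det_tilt_normal_sq {X N : Mink m} {L : Euc m →L[ℝ] Mink m} {θ : Euc m} (hθ : ‖θ‖ = 1)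
    (hX : lorentz X X = -1) (hX1 : 0 < X.1) (hL : L θ = 0) (hLX : ∀ v, lorentz (L v) X = 0)
    (hNX : lorentz N X = 0) (hN : lorentz N N = 1) (hNL : ∀ v, lorentz N (L v) = 0)
    (b : Fin m → Euc m) (hb : ∀ i, inner ℝ θ (b i) = 0) :
    (tilt L θ N.2).det ^ 2 * (Matrix.of fun i j => inner ℝ (b i) (b j)).det =
      X.1 ^ 2 * (Matrix.of fun i j => lorentz (L (b i)) (L (b j))).det := by
  have hθ2 : inner ℝ θ θ = (1 : ℝ) := by rw [real_inner_self_eq_norm_sq, hθ]; norm_num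
  have key := det_bilin_comp (tilt L θ N.2 : Euc m →ₗ[ℝ] Euc m)
    (Fin.cons θ b : Fin (m + 1) → Euc m) (spatialMatrix X)
  rw [det_spatialMatrix hX hX1.ne'] at key
  simp only [dotProduct_spatialMatrix] at key
  have e0 : tilt L θ N.2 θ = N.2 := by rw [tilt_apply, hL, hθ2]; simp
  have es : ∀ i, tilt L θ N.2 (b i) = (L (b i)).2 := fun i => by simp [tilt_apply, hb]
  rw [det_cons_of_orthogonal (Matrix.of fun i j => lorentz (L (b i)) (L (b j)))] at key
  · rw [det_cons_of_orthogonal (Matrix.of fun i j => inner ℝ (b i) (b j))] at key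
    · rw [key]
      simp only [ContinuousLinearMap.det]
      field_simp
    · simp [hθ]
    · simp [hb]
    · simp
  · simp [e0, spatialForm_eq_lorentz hX1.ne' hNX hNX, hN]
  · intro j
    simp [e0, es, spatialForm_eq_lorentz hX1.ne' hNX (hLX _), hNL]
  · intro i j
    simp [es, spatialForm_eq_lorentz hX1.ne' (hLX _) (hLX _)]

/-- If `w` is the preimage of `X.2` under the tilt by `N.2`, then tilting by `X.2` instead amounts
to precomposing with a transvection of determinant `⟪θ, w⟫`. Pairing with `N` in the spatial metric
evaluates this as `N.1 / X.1`. This converts the Jacobian of a cone into an area element. -/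
lemma det_tilt_self {X N : Mink m} {L : Euc m →L[ℝ] Mink m} {θ : Euc m} (hθ : ‖θ‖ = 1)
    (hX : lorentz X X = -1) (hX1 : 0 < X.1) (hL : L θ = 0) (hLX : ∀ v, lorentz (L v) X = 0)
    (hNX : lorentz N X = 0) (hN : lorentz N N = 1) (hNL : ∀ v, lorentz N (L v) = 0)
    (hdet : (tilt L θ N.2).det ≠ 0) :
    (tilt L θ X.2).det = N.1 / X.1 * (tilt L θ N.2).det := by
  have hθ2 : inner ℝ θ θ = (1 : ℝ) := by rw [real_inner_self_eq_norm_sq, hθ]; norm_num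
  obtain ⟨w, hw⟩ : ∃ w, tilt L θ N.2 w = X.2 := by
    exact (LinearMap.equivOfDetNeZero _ hdet).surjective X.2
  have h1 : inner ℝ θ w = N.1 / X.1 := by
    have := spatialForm_self_left hX hX1.ne' hNX
    rw [← hw, tilt_apply, spatialForm_add_left, spatialForm_smul_left,
      spatialForm_eq_lorentz hX1.ne' (hLX _) hNX, spatialForm_eq_lorentz hX1.ne' hNX hNX,
      lorentz_comm, hNL, hN] at this
    linarith
  have h2 : (tilt L θ X.2 : Euc m →ₗ[ℝ] Euc m) = (tilt L θ N.2 : Euc m →ₗ[ℝ] Euc m) ∘ₗ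
      LinearMap.transvection (innerSL ℝ θ : Euc m →ₗ[ℝ] ℝ) (w - θ) := by
    ext1 v
    simp only [LinearMap.coe_comp, Function.comp_apply, LinearMap.transvection.apply,
      ContinuousLinearMap.coe_coe, map_add, map_smul, map_sub, hw, innerSL_apply_apply]
    simp only [tilt_apply, hL, hθ2]
    simp only [Prod.snd_zero, zero_add, one_smul]
    module
  simp only [ContinuousLinearMap.det]
  rw [h2, LinearMap.det_comp, LinearMap.transvection.det]
  simp only [ContinuousLinearMap.coe_coe, innerSL_apply_apply, inner_sub_right, hθ2, h1]
  ring

end HypFlow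

/-! ### Radial lifts to punctured Euclidean space and frames of hypersurfaces. -/

namespace HypFlow

variable {m : ℕ}

instance finrank_euc_fact : Fact (Module.finrank ℝ (Euc m) = m + 1) := ⟨finrank_euclideanSpace_fin⟩

/-- The radial projection to the unit sphere (with a junk value at the origin). -/
noncomputable def nrm (x : Euc m) : Sph m :=
  if hx : x = 0 then ⟨EuclideanSpace.single 0 1, by simp⟩
  else ⟨‖x‖⁻¹ • x, by simp [norm_smul, norm_ne_zero_iff.2 hx]⟩

lemma coe_nrm {x : Euc m} (hx : x ≠ 0) : (nrm x : Euc m) = ‖x‖⁻¹ • x := by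
  rw [nrm, dif_neg hx]

lemma Sph.norm_coe (θ : Sph m) : ‖(θ : Euc m)‖ = 1 := norm_eq_of_mem_sphere θ

lemma Sph.coe_ne_zero (θ : Sph m) : (θ : Euc m) ≠ 0 := by
  rw [← norm_ne_zero_iff, θ.norm_coe]; norm_num

lemma nrm_smul {s : ℝ} (hs : 0 < s) (θ : Sph m) : nrm (s • (θ : Euc m)) = θ := by
  apply Subtype.ext
  rw [coe_nrm (smul_ne_zero hs.ne' θ.coe_ne_zero), norm_smul, θ.norm_coe, smul_smul]
  simp [abs_of_pos hs, hs.ne']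

lemma nrm_coe (θ : Sph m) : nrm (θ : Euc m) = θ := by
  simpa using nrm_smul one_pos θ

lemma norm_smul_nrm (x : Euc m) : ‖x‖ • (nrm x : Euc m) = x := by
  by_cases hx : x = 0
  · simp [hx]
  · rw [coe_nrm hx, smul_smul, mul_inv_cancel₀ (norm_ne_zero_iff.2 hx), one_smul]

lemma contDiffAt_inv_norm_smul {x : Euc m} (hx : x ≠ 0) :
    ContDiffAt ℝ ∞ (fun x : Euc m => ‖x‖⁻¹ • x) x :=
  ((contDiffAt_norm ℝ hx).inv (norm_ne_zero_iff.2 hx)).smul contDiffAt_id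

lemma continuousAt_nrm {x : Euc m} (hx : x ≠ 0) : ContinuousAt (nrm : Euc m → Sph m) x := by
  rw [Topology.IsInducing.subtypeVal.continuousAt_iff]
  refine (contDiffAt_inv_norm_smul hx).continuousAt.congr ?_
  filter_upwards [isOpen_ne.mem_nhds hx] with y hy
  exact (coe_nrm hy).symm

lemma contMDiffAt_nrm {x : Euc m} (hx : x ≠ 0) :
    ContMDiffAt 𝓘(ℝ, Euc m) (𝓡 m) ∞ (nrm : Euc m → Sph m) x := by
  rw [contMDiffAt_iff_target]
  refine ⟨continuousAt_nrm hx, ?_⟩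
  rw [contMDiffAt_iff_contDiffAt]
  set v : Sph m := nrm x
  -- The chart of the sphere at `v` is stereographic projection from `-v` followed by this isometry.
  let U : _ ≃ₗᵢ[ℝ] _ :=
    (OrthonormalBasis.fromOrthogonalSpanSingleton (𝕜 := ℝ) m (ne_zero_of_mem_unit_sphere (-v))).repr
  have h1 : ContDiffAt ℝ ∞ (fun y : Euc m => U (stereoToFun (-v : Euc m) (‖y‖⁻¹ • y))) x := by
    refine U.contDiff.contDiffAt.comp x ?_
    refine ContDiffAt.comp (𝕜 := ℝ) x (g := stereoToFun (-v : Euc m)) ?_ (contDiffAt_inv_norm_smul hx)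
    refine contDiffOn_stereoToFun.contDiffAt (IsOpen.mem_nhds ?_ ?_)
    · exact isOpen_ne.preimage (innerSL ℝ (-v : Euc m)).continuous
    · rw [← coe_nrm hx]
      simp only [Set.mem_ofPred_eq, innerSL_apply_apply, inner_neg_left]
      rw [real_inner_self_eq_norm_sq, Sph.norm_coe]
      norm_num
  refine h1.congr_of_eventuallyEq ?_
  filter_upwards [isOpen_ne.mem_nhds hx] with y hy
  rw [← coe_nrm hy]
  rfl

lemma contMDiffOn_nrm : ContMDiffOn 𝓘(ℝ, Euc m) (𝓡 m) ∞ (nrm : Euc m → Sph m) {0}ᶜ :=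
  fun _ hx => (contMDiffAt_nrm hx).contMDiffWithinAt

/-- The differential of the inclusion of the sphere. -/
noncomputable def dincl (θ : Sph m) : EuclideanSpace ℝ (Fin m) →L[ℝ] Euc m :=
  mfderiv (𝓡 m) 𝓘(ℝ, Euc m) (fun ξ : Sph m => (ξ : Euc m)) θ

lemma dincl_injective (θ : Sph m) : Function.Injective (dincl θ) :=
  injective_mvfderiv_subtypeVal_sphere θ

lemma inner_dincl (θ : Sph m) (v : EuclideanSpace ℝ (Fin m)) :
    inner ℝ (θ : Euc m) (dincl θ v) = 0 := by
  have h := range_mvfderiv_subtypeVal (n := m) θ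
  have : dincl θ v ∈ (ℝ ∙ (θ : Euc m))ᗮ := by
    rw [← h]; exact ⟨v, rfl⟩
  exact Submodule.mem_orthogonal_singleton_iff_inner_right.1 this

lemma exists_dincl_eq (θ : Sph m) {v : Euc m} (hv : inner ℝ (θ : Euc m) v = 0) :
    ∃ u, dincl θ u = v := by
  have h := range_mvfderiv_subtypeVal (n := m) θ
  have : v ∈ (ℝ ∙ (θ : Euc m))ᗮ := Submodule.mem_orthogonal_singleton_iff_inner_right.2 hv
  rw [← h] at this
  exact this

/-- Since `nrm` is the identity on the sphere, `F` is the restriction of its radial lift `F ∘ nrm`;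
this trades manifold derivatives for ordinary ones. -/
lemma diff_eq_fderiv {F : Sph m → Mink m} (hF : ContMDiff (𝓡 m) 𝓘(ℝ, Mink m) ∞ F) (θ : Sph m) :
    diff F θ = (fderiv ℝ (F ∘ nrm) θ).comp (dincl θ) := by
  have hd : DifferentiableAt ℝ (F ∘ nrm) (θ : Euc m) := by
    rw [← mdifferentiableAt_iff_differentiableAt]
    refine MDifferentiableAt.comp (I' := 𝓡 m) _ ?_ ?_
    · exact (hF _).mdifferentiableAt (by simp)
    · exact (contMDiffAt_nrm θ.coe_ne_zero).mdifferentiableAt (by simp)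
  have hc : MDifferentiableAt (𝓡 m) 𝓘(ℝ, Euc m) (fun ξ : Sph m => (ξ : Euc m)) θ :=
    (contMDiff_coe_sphere (n := m) (m := ∞) θ).mdifferentiableAt (by simp)
  have e : F = (F ∘ nrm) ∘ (fun ξ : Sph m => (ξ : Euc m)) := by
    funext ξ; simp [nrm_coe]
  have := mfderiv_comp θ (I' := 𝓘(ℝ, Euc m)) hd.mdifferentiableAt hc
  rw [← e, mfderiv_eq_fderiv] at this
  exact this


/-- The first order data at a point of a hypersurface of hyperbolic space: the position `X`, the
unit normal `N` and the differential `L` of the parametrisation, extended radially. -/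
structure IsFrame (X N : Mink m) (L : Euc m →L[ℝ] Mink m) (θ : Euc m) : Prop where
  unit : ‖θ‖ = 1
  hyp : lorentz X X = -1
  time_pos : 0 < X.1
  radial : L θ = 0
  tangent : ∀ v, lorentz (L v) X = 0
  normal_tangent : lorentz N X = 0
  normal_unit : lorentz N N = 1
  normal : ∀ v, lorentz N (L v) = 0
  injective : ∀ v, inner ℝ θ v = 0 → L v = 0 → v = 0

namespace IsFrame

variable {X N : Mink m} {L : Euc m →L[ℝ] Mink m} {θ : Euc m}

/-- Pairing a kernel vector with `N` kills its component along `θ`. Its image under `L` then has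
zero spatial part, tangency removes the time component, and injectivity on the tangent space
concludes. -/
lemma det_tilt_ne_zero (h : IsFrame X N L θ) : (tilt L θ N.2).det ≠ 0 := by
  intro hdet
  refine LinearMap.det_eq_zero_iff_ker_ne_bot.1 hdet (LinearMap.ker_eq_bot'.2 fun v hv => ?_)
  change tilt L θ N.2 v = 0 at hv
  have hX := h.time_pos.ne'
  have h0 : spatialForm X (tilt L θ N.2 v) N.2 = 0 := by rw [hv]; simp [spatialForm]
  rw [tilt_apply, spatialForm_add_left, spatialForm_smul_left,
    spatialForm_eq_lorentz hX (h.tangent v) h.normal_tangent,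
    spatialForm_eq_lorentz hX h.normal_tangent h.normal_tangent, lorentz_comm, h.normal,
    h.normal_unit, zero_add, mul_one] at h0
  rw [tilt_apply, h0, zero_smul, add_zero] at hv
  refine h.injective v h0 (Prod.ext ?_ hv)
  have h1 := h.tangent v
  rw [lorentz, hv, inner_zero_left, zero_sub, neg_eq_zero] at h1
  exact (mul_eq_zero.1 h1).resolve_right hX

lemma det_tilt_self (h : IsFrame X N L θ) :
    (tilt L θ X.2).det = N.1 / X.1 * (tilt L θ N.2).det :=
  HypFlow.det_tilt_self h.unit h.hyp h.time_pos h.radial h.tangent h.normal_tangent h.normal_unit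
    h.normal h.det_tilt_ne_zero

end IsFrame

lemma roundGram_eq (θ : Sph m) : roundGram θ = Matrix.gram ℝ
    (fun i => dincl θ (EuclideanSpace.single i 1)) := rfl

lemma det_roundGram_pos (θ : Sph m) : 0 < (roundGram θ).det := by
  rw [roundGram_eq]
  apply Matrix.PosDef.det_pos
  apply Matrix.posDef_gram_of_linearIndependent
  have h1 : LinearIndependent ℝ (fun i : Fin m => EuclideanSpace.single i (1 : ℝ)) := by
    convert! (EuclideanSpace.basisFun (Fin m) ℝ).toBasis.linearIndependent using 1
    ext1 i
    simp
  exact h1.map' (dincl θ : EuclideanSpace ℝ (Fin m) →ₗ[ℝ] Euc m)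
    (LinearMap.ker_eq_bot.2 (dincl_injective θ))

lemma hasFDerivAt_lift {F : Sph m → Mink m} (hF : ContMDiff (𝓡 m) 𝓘(ℝ, Mink m) ∞ F) {x : Euc m}
    (hx : x ≠ 0) : HasFDerivAt (F ∘ nrm) (fderiv ℝ (F ∘ nrm) x) x := by
  apply DifferentiableAt.hasFDerivAt
  rw [← mdifferentiableAt_iff_differentiableAt]
  refine MDifferentiableAt.comp (I' := 𝓡 m) _ ?_ ?_
  · exact (hF _).mdifferentiableAt (by simp)
  · exact (contMDiffAt_nrm hx).mdifferentiableAt (by simp)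

lemma fderiv_lift_radial {V : Type*} [NormedAddCommGroup V] [NormedSpace ℝ V] {F : Sph m → V}
    {θ : Sph m} {L : Euc m →L[ℝ] V}
    (hL : HasFDerivAt (F ∘ nrm) L (θ : Euc m)) : L (θ : Euc m) = 0 := by
  have h1 : HasDerivAt (fun s : ℝ => s • (θ : Euc m)) (θ : Euc m) 1 := by
    simpa using (hasDerivAt_id (1 : ℝ)).smul_const (θ : Euc m)
  have h2 := HasFDerivAt.comp_hasDerivAt (1 : ℝ) (by simpa using hL) h1
  have h3 : HasDerivAt ((F ∘ nrm) ∘ fun s : ℝ => s • (θ : Euc m)) 0 1 := by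
    refine (hasDerivAt_const (1 : ℝ) (F θ)).congr_of_eventuallyEq ?_
    filter_upwards [lt_mem_nhds one_pos] with s hs
    simp [nrm_smul hs]
  exact h2.unique h3

lemma isBoundedBilinearMap_lorentz :
    IsBoundedBilinearMap ℝ fun p : Mink m × Mink m => lorentz p.1 p.2 where
  add_left _ _ _ := lorentz_add_left ..
  smul_left _ _ _ := lorentz_smul_left ..
  add_right _ _ _ := lorentz_add_right ..
  smul_right _ _ _ := lorentz_smul_right ..
  bound := by
    refine ⟨2, two_pos, fun x y => ?_⟩
    have h1 := abs_real_inner_le_norm x.2 y.2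
    have h2 : ‖x.2‖ * ‖y.2‖ ≤ ‖x‖ * ‖y‖ := by gcongr <;> exact norm_snd_le _
    have h3 : ‖x.1‖ * ‖y.1‖ ≤ ‖x‖ * ‖y‖ := by gcongr <;> exact norm_fst_le _
    have h4 : |x.1 * y.1| = ‖x.1‖ * ‖y.1‖ := by rw [abs_mul]; rfl
    rw [lorentz, Real.norm_eq_abs]
    linarith [abs_sub (inner ℝ x.2 y.2) (x.1 * y.1)]

lemma hasFDerivAt_lorentz {V : Type*} [NormedAddCommGroup V] [NormedSpace ℝ V] {f g : V → Mink m}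
    {f' g' : V →L[ℝ] Mink m} {x : V} (hf : HasFDerivAt f f' x) (hg : HasFDerivAt g g' x) (v : V) :
    fderiv ℝ (fun y => lorentz (f y) (g y)) x v = lorentz (f x) (g' v) + lorentz (f' v) (g x) := by
  have h1 := (isBoundedBilinearMap_lorentz.hasFDerivAt (f x, g x)).comp x (hf.prodMk hg)
  rw [show (fun y => lorentz (f y) (g y)) =
    (fun p : Mink m × Mink m => lorentz p.1 p.2) ∘ fun y => (f y, g y) from rfl, h1.fderiv]
  rfl

lemma hasDerivWithinAt_lorentz {f g : ℝ → Mink m} {f' g' : Mink m} {s : Set ℝ} {t : ℝ}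
    (hf : HasDerivWithinAt f f' s t) (hg : HasDerivWithinAt g g' s t) :
    HasDerivWithinAt (fun u => lorentz (f u) (g u)) (lorentz (f t) g' + lorentz f' (g t)) s t := by
  exact (isBoundedBilinearMap_lorentz.hasFDerivAt (f t, g t)).comp_hasDerivWithinAt t
    (hf.prodMk hg)

lemma IsEmbedding.isFrame {F : Sph m → Hyp m} {N : Sph m → Mink m} {Ω : Set (Hyp m)}
    (hF : IsEmbedding F) (hN : IsOutwardUnitNormal F Ω N) (θ : Sph m) :
    IsFrame (F θ) (N θ) (fderiv ℝ (toMink F ∘ nrm) θ) θ := by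
  have hd := hasFDerivAt_lift hF.smooth θ.coe_ne_zero
  have hrad := fderiv_lift_radial hd
  -- The lift is constant along rays, so subtracting the radial part of `v` does not change the
  -- derivative.
  have hsplit : ∀ v : Euc m, ∃ u, fderiv ℝ (toMink F ∘ nrm) (θ : Euc m) v = diff (toMink F) θ u := by
    intro v
    obtain ⟨u, hu⟩ := exists_dincl_eq θ (v := v - (inner ℝ (θ : Euc m) v) • (θ : Euc m)) (by
      rw [inner_sub_right, inner_smul_right, real_inner_self_eq_norm_sq, θ.norm_coe]; ring)
    refine ⟨u, ?_⟩
    rw [diff_eq_fderiv hF.smooth, ContinuousLinearMap.comp_apply, hu, map_sub, map_smul, hrad]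
    simp
  refine ⟨θ.norm_coe, (F θ).2.1, (F θ).2.2, hrad, fun v => ?_, hN.tangent θ, hN.unit θ,
    fun v => ?_, fun v hv hv0 => ?_⟩
  · have h1 := hasFDerivAt_lorentz hd hd v
    have h2 : (fun y => lorentz ((toMink F ∘ nrm) y) ((toMink F ∘ nrm) y)) = fun _ : Euc m => -1 :=
      funext fun y => (F (nrm y)).2.1
    rw [h2] at h1
    rw [lorentz_comm ((toMink F ∘ nrm) _)] at h1
    rw [fderiv_fun_const] at h1
    simp only [Function.comp_apply, nrm_coe] at h1
    have h3 : (0 : ℝ) = 2 * lorentz (fderiv ℝ (toMink F ∘ nrm) (θ : Euc m) v) (F θ) := by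
      rw [two_mul]; exact h1
    linarith
  · obtain ⟨u, hu⟩ := hsplit v
    rw [hu]; exact hN.normal θ u
  · obtain ⟨u, hu⟩ := exists_dincl_eq θ hv
    have : diff (toMink F) θ u = 0 := by
      rw [diff_eq_fderiv hF.smooth, ContinuousLinearMap.comp_apply, hu, hv0]
    have hu0 : u = 0 := hF.immersion θ (by rw [this, map_zero])
    rw [← hu, hu0, map_zero]

lemma gram_eq {F : Sph m → Hyp m} (hF : ContMDiff (𝓡 m) 𝓘(ℝ, Mink m) ∞ (toMink F)) (θ : Sph m) :
    gram F θ = Matrix.of fun i j => lorentz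
      (fderiv ℝ (toMink F ∘ nrm) θ (dincl θ (EuclideanSpace.single i 1)))
      (fderiv ℝ (toMink F ∘ nrm) θ (dincl θ (EuclideanSpace.single j 1))) := by
  rw [gram, diff_eq_fderiv hF]; rfl

lemma det_gram_eq {F : Sph m → Hyp m} (hF : ContMDiff (𝓡 m) 𝓘(ℝ, Mink m) ∞ (toMink F))
    {N : Mink m} {θ : Sph m} (h : IsFrame (F θ) N (fderiv ℝ (toMink F ∘ nrm) θ) θ) :
    (tilt (fderiv ℝ (toMink F ∘ nrm) θ) θ N.2).det ^ 2 * (roundGram θ).det =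
      (F θ).1.1 ^ 2 * (gram F θ).det := by
  rw [gram_eq hF]
  exact det_tilt_normal_sq h.unit h.hyp h.time_pos h.radial h.tangent h.normal_tangent
    h.normal_unit h.normal (fun i => dincl θ (EuclideanSpace.single i 1)) (fun i => inner_dincl θ _)

lemma det_gram_pos {F : Sph m → Hyp m} (hF : ContMDiff (𝓡 m) 𝓘(ℝ, Mink m) ∞ (toMink F))
    {N : Mink m} {θ : Sph m} (h : IsFrame (F θ) N (fderiv ℝ (toMink F ∘ nrm) θ) θ) :
    0 < (gram F θ).det := by
  have h1 := det_gram_eq hF h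
  have h2 := h.det_tilt_ne_zero
  have h3 := det_roundGram_pos θ
  have h4 : 0 < (F θ).1.1 ^ 2 * (gram F θ).det := by rw [← h1]; positivity
  exact pos_of_mul_pos_right h4 (sq_nonneg _)

/-- The square root of `det_gram_eq`. The Gram matrices depend on a choice of frame at each point;
the right-hand side does not, is visibly continuous in `θ`, and can be compared with Jacobians of
Euclidean maps. -/
lemma areaDensity_eq {F : Sph m → Hyp m} (hF : ContMDiff (𝓡 m) 𝓘(ℝ, Mink m) ∞ (toMink F))
    {N : Mink m} {θ : Sph m} (h : IsFrame (F θ) N (fderiv ℝ (toMink F ∘ nrm) θ) θ) :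
    areaDensity F θ = |(tilt (fderiv ℝ (toMink F ∘ nrm) θ) θ N.2).det| / (F θ).1.1 := by
  have h1 := det_gram_eq hF h
  have h3 := det_roundGram_pos θ
  have h4 := h.time_pos
  rw [areaDensity, ← Real.sqrt_div (det_gram_pos hF h).le, ← Real.sqrt_sq_eq_abs,
    eq_div_iff h4.ne', ← Real.sqrt_sq h4.le, ← Real.sqrt_mul (by
      have := det_gram_pos hF h; positivity)]
  congr 1
  field_simp
  linarith

end HypFlow

/-! ### The time interval and mixed derivatives of radial lifts. -/

namespace HypFlow

variable {m : ℕ}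

section TimeInterval

variable {T : EReal}

lemma exists_Icc_subset_timeInterval {t : ℝ} (ht : t ∈ timeInterval T) :
    ∃ δ > 0, Set.Icc 0 (t + δ) ⊆ timeInterval T := by
  obtain ⟨u, hu1, hu2⟩ := EReal.lt_iff_exists_real_btwn.1 ht.2
  have htu : t < u := by exact_mod_cast hu1
  refine ⟨u - t, by linarith, fun s hs => ⟨hs.1, lt_of_le_of_lt ?_ hu2⟩⟩
  have : s ≤ u := by linarith [hs.2]
  exact_mod_cast this

lemma convex_timeInterval (T : EReal) : Convex ℝ (timeInterval T) := by
  apply Set.OrdConnected.convex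
  refine ⟨fun x hx y hy z hz => ⟨hx.1.trans hz.1, lt_of_le_of_lt ?_ hy.2⟩⟩
  exact_mod_cast hz.2

lemma zero_mem_timeInterval {t : ℝ} (ht : t ∈ timeInterval T) : (0 : ℝ) ∈ timeInterval T := by
  obtain ⟨δ, hδ, h⟩ := exists_Icc_subset_timeInterval ht
  exact h ⟨le_rfl, by linarith [ht.1]⟩

lemma interior_timeInterval_nonempty {t : ℝ} (ht : t ∈ timeInterval T) :
    (interior (timeInterval T)).Nonempty := by
  obtain ⟨δ, hδ, h⟩ := exists_Icc_subset_timeInterval ht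
  refine ⟨t + δ / 2, interior_mono h ?_⟩
  rw [interior_Icc]
  constructor <;> linarith [ht.1]

lemma uniqueDiffOn_timeInterval (T : EReal) : UniqueDiffOn ℝ (timeInterval T) := by
  intro t ht
  exact uniqueDiffOn_convex (convex_timeInterval T) (interior_timeInterval_nonempty ht) t ht

lemma timeInterval_subset_closure_interior (T : EReal) :
    timeInterval T ⊆ closure (interior (timeInterval T)) := by
  intro t ht
  rw [(convex_timeInterval T).closure_interior_eq_closure_of_nonempty_interior
    (interior_timeInterval_nonempty ht)]
  exact subset_closure ht

end TimeInterval

/-- The domain of the radial lift of a flow. -/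
def liftDomain (m : ℕ) (T : EReal) : Set (Euc m × ℝ) := {0}ᶜ ×ˢ timeInterval T

lemma uniqueDiffOn_liftDomain (m : ℕ) (T : EReal) : UniqueDiffOn ℝ (liftDomain m T) :=
  isOpen_compl_singleton.uniqueDiffOn.prod (uniqueDiffOn_timeInterval T)

/-- Needed for the symmetry of second derivatives within the domain at its boundary points, namely
at time `0`. -/
lemma liftDomain_subset_closure_interior (m : ℕ) (T : EReal) :
    liftDomain m T ⊆ closure (interior (liftDomain m T)) := by
  rw [liftDomain, interior_prod_eq, closure_prod_eq]
  refine Set.prod_mono ?_ (timeInterval_subset_closure_interior T)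
  rw [isOpen_compl_singleton.interior_eq]
  exact subset_closure

section Slices

variable {V : Type*} [NormedAddCommGroup V] [NormedSpace ℝ V] {T : EReal}
  {f : Euc m × ℝ → V} {x : Euc m} {t : ℝ}

/-- The spatial partial derivative. -/
noncomputable def spaceDeriv (T : EReal) (f : Euc m × ℝ → V) (q : Euc m × ℝ) : Euc m →L[ℝ] V :=
  (fderivWithin ℝ f (liftDomain m T) q).comp (ContinuousLinearMap.inl ℝ (Euc m) ℝ)

/-- The time derivative. -/
noncomputable def timeDeriv (T : EReal) (f : Euc m × ℝ → V) (q : Euc m × ℝ) : V :=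
  fderivWithin ℝ f (liftDomain m T) q (0, 1)

lemma contDiffOn_fderivWithin_liftDomain (hf : ContDiffOn ℝ ∞ f (liftDomain m T)) :
    ContDiffOn ℝ ∞ (fderivWithin ℝ f (liftDomain m T)) (liftDomain m T) :=
  hf.fderivWithin (uniqueDiffOn_liftDomain m T) (by simp)

lemma contDiffOn_timeDeriv (hf : ContDiffOn ℝ ∞ f (liftDomain m T)) :
    ContDiffOn ℝ ∞ (timeDeriv T f) (liftDomain m T) :=
  (contDiffOn_fderivWithin_liftDomain hf).clm_apply contDiffOn_const

lemma continuousOn_spaceDeriv (hf : ContDiffOn ℝ ∞ f (liftDomain m T)) :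
    ContinuousOn (spaceDeriv T f) (liftDomain m T) :=
  (contDiffOn_fderivWithin_liftDomain hf).continuousOn.clm_comp continuousOn_const

lemma hasFDerivWithinAt_liftDomain (hf : ContDiffOn ℝ ∞ f (liftDomain m T)) {q : Euc m × ℝ}
    (hq : q ∈ liftDomain m T) :
    HasFDerivWithinAt f (fderivWithin ℝ f (liftDomain m T) q) (liftDomain m T) q :=
  ((hf q hq).differentiableWithinAt (by simp)).hasFDerivWithinAt

lemma hasFDerivAt_slice (hf : ContDiffOn ℝ ∞ f (liftDomain m T)) (hx : x ≠ 0)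
    (ht : t ∈ timeInterval T) :
    HasFDerivAt (fun y => f (y, t)) (spaceDeriv T f (x, t)) x := by
  have h1 : HasFDerivWithinAt (fun y : Euc m => (y, t)) (ContinuousLinearMap.inl ℝ (Euc m) ℝ)
      {0}ᶜ x := (hasFDerivAt_prodMk_left x t).hasFDerivWithinAt
  have hmaps : Set.MapsTo (fun y : Euc m => (y, t)) {0}ᶜ (liftDomain m T) := fun y hy => ⟨hy, ht⟩
  have h2 := (hasFDerivWithinAt_liftDomain hf (q := (x, t)) ⟨hx, ht⟩).comp x h1 hmaps
  exact h2.hasFDerivAt (isOpen_compl_singleton.mem_nhds hx)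

lemma hasDerivWithinAt_slice (hf : ContDiffOn ℝ ∞ f (liftDomain m T)) (hx : x ≠ 0)
    (ht : t ∈ timeInterval T) :
    HasDerivWithinAt (fun s => f (x, s)) (timeDeriv T f (x, t)) (timeInterval T) t := by
  have h1 : HasDerivWithinAt (fun s : ℝ => (x, s)) ((0 : Euc m), (1 : ℝ)) (timeInterval T) t :=
    (hasDerivWithinAt_const t _ x).prodMk (hasDerivWithinAt_id t _)
  exact (hasFDerivWithinAt_liftDomain hf (q := (x, t)) ⟨hx, ht⟩).comp_hasDerivWithinAt t h1
    (fun s hs => ⟨hx, hs⟩)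

/-- Equality of mixed second derivatives, valid up to and including the initial time. -/
lemma hasDerivWithinAt_spaceDeriv (hf : ContDiffOn ℝ ∞ f (liftDomain m T)) (hx : x ≠ 0)
    (ht : t ∈ timeInterval T) (v : Euc m) :
    HasDerivWithinAt (fun s => spaceDeriv T f (x, s) v) (spaceDeriv T (timeDeriv T f) (x, t) v)
      (timeInterval T) t := by
  have hq : (x, t) ∈ liftDomain m T := ⟨hx, ht⟩
  have hf2 := contDiffOn_fderivWithin_liftDomain hf
  have hsymm : IsSymmSndFDerivWithinAt ℝ f (liftDomain m T) (x, t) :=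
    (hf (x, t) hq).isSymmSndFDerivWithinAt (by simp; exact ENat.LEInfty.out) (uniqueDiffOn_liftDomain m T)
      (liftDomain_subset_closure_interior m T hq) hq
  have h1 := (hasDerivWithinAt_slice hf2 hx ht).clm_apply
    (hasDerivWithinAt_const t (timeInterval T) ((v, 0) : Euc m × ℝ))
  refine h1.congr_deriv ?_
  have h2 : fderivWithin ℝ (timeDeriv T f) (liftDomain m T) (x, t) (v, 0) =
      fderivWithin ℝ (fderivWithin ℝ f (liftDomain m T)) (liftDomain m T) (x, t) (v, 0) (0, 1) := by
    have := ((hasFDerivWithinAt_liftDomain hf2 hq).clm_apply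
      (hasFDerivWithinAt_const ((0, 1) : Euc m × ℝ) (x, t) (liftDomain m T))).fderivWithin
      (uniqueDiffOn_liftDomain m T (x, t) hq)
    unfold timeDeriv
    rw [this]
    simp
  simp only [map_zero, add_zero]
  rw [spaceDeriv, ContinuousLinearMap.comp_apply, ContinuousLinearMap.inl_apply, h2, ← hsymm]
  rfl

end Slices


/-! ### Evolution of the induced metric and of the area element. -/

section Flow

variable {T : EReal} {X : ℝ → Sph m → Hyp m} {ν : ℝ → Sph m → Mink m} {Ω : ℝ → Set (Hyp m)}

/-- The radial lift of a time-dependent map on the sphere. -/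
noncomputable def lift (F : ℝ → Sph m → Mink m) (q : Euc m × ℝ) : Mink m := F q.2 (nrm q.1)

/-- The radial lift of the flow. -/
noncomputable abbrev posLift (X : ℝ → Sph m → Hyp m) : Euc m × ℝ → Mink m :=
  lift fun t => toMink (X t)

lemma contDiffOn_lift {F : ℝ → Sph m → Mink m}
    (hF : ContMDiffOn ((𝓡 m).prod 𝓘(ℝ, ℝ)) 𝓘(ℝ, Mink m) ∞
      (fun q : Sph m × ℝ => F q.2 q.1) (Set.univ ×ˢ timeInterval T)) :
    ContDiffOn ℝ ∞ (lift F) (liftDomain m T) := by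
  rw [← contMDiffOn_iff_contDiffOn]
  have h1 : ContMDiffOn 𝓘(ℝ, Euc m × ℝ) (𝓡 m) ∞ (fun q : Euc m × ℝ => nrm q.1)
      (liftDomain m T) :=
    contMDiffOn_nrm.comp contDiff_fst.contMDiff.contMDiffOn (fun q hq => hq.1)
  have h2 : ContMDiffOn 𝓘(ℝ, Euc m × ℝ) 𝓘(ℝ, ℝ) ∞ (fun q : Euc m × ℝ => q.2) (liftDomain m T) :=
    contDiff_snd.contMDiff.contMDiffOn
  exact hF.comp (h1.prodMk h2) (fun q hq => ⟨trivial, hq.2⟩)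

namespace IsIMCF

variable (h : IsIMCF T X ν Ω)

include h

lemma contDiffOn_pos : ContDiffOn ℝ ∞ (posLift X) (liftDomain m T) := contDiffOn_lift h.smooth

lemma contDiffOn_nor : ContDiffOn ℝ ∞ (lift ν) (liftDomain m T) := contDiffOn_lift h.smooth_normal

lemma spaceDeriv_pos {x : Euc m} {t : ℝ} (hx : x ≠ 0) (ht : t ∈ timeInterval T) :
    spaceDeriv T (posLift X) (x, t) = fderiv ℝ (toMink (X t) ∘ nrm) x :=
  (hasFDerivAt_slice h.contDiffOn_pos hx ht).fderiv.symm

lemma isFrame {t : ℝ} (ht : t ∈ timeInterval T) (θ : Sph m) :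
    IsFrame (X t θ) (ν t θ) (spaceDeriv T (posLift X) (θ, t)) θ := by
  rw [h.spaceDeriv_pos θ.coe_ne_zero ht]
  exact (h.embedding t ht).isFrame (h.normal t ht) θ

lemma timeDeriv_pos {x : Euc m} {t : ℝ} (hx : x ≠ 0) (ht : t ∈ timeInterval T) :
    timeDeriv T (posLift X) (x, t) =
      (1 / meanCurvature (X t) (ν t) (nrm x)) • ν t (nrm x) :=
  (uniqueDiffOn_timeInterval T t ht).eq_deriv _ (hasDerivWithinAt_slice h.contDiffOn_pos hx ht)
    (h.evolution t ht (nrm x))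

omit h in
/-- The speed of a flow, as a function on its radial lift. -/
noncomputable def speed (T : EReal) (X : ℝ → Sph m → Hyp m) (ν : ℝ → Sph m → Mink m)
    (q : Euc m × ℝ) : ℝ := lorentz (timeDeriv T (posLift X) q) (lift ν q)

/-- Smoothness of `1 / H` is read off from the flow equation: the speed is the pairing of the
velocity with the normal, both smooth, so the regularity of the curvature itself need not be
studied. -/
lemma contDiffOn_speed : ContDiffOn ℝ ∞ (speed T X ν) (liftDomain m T) :=
  isBoundedBilinearMap_lorentz.contDiff.comp_contDiffOn
    ((contDiffOn_timeDeriv h.contDiffOn_pos).prodMk h.contDiffOn_nor)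

lemma speed_eq {x : Euc m} {t : ℝ} (hx : x ≠ 0) (ht : t ∈ timeInterval T) :
    speed T X ν (x, t) = 1 / meanCurvature (X t) (ν t) (nrm x) := by
  rw [speed, h.timeDeriv_pos hx ht, lorentz_smul_left, lift, (h.normal t ht).unit, mul_one]

lemma spaceDeriv_timeDeriv_pos {t : ℝ} (ht : t ∈ timeInterval T) (θ : Sph m) (v : Euc m) :
    spaceDeriv T (timeDeriv T (posLift X)) (θ, t) v =
      speed T X ν (θ, t) • spaceDeriv T (lift ν) (θ, t) v +
        spaceDeriv T (speed T X ν) (θ, t) v • ν t θ := by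
  have hθ := θ.coe_ne_zero
  have h1 := (hasFDerivAt_slice h.contDiffOn_speed hθ ht).smul
    (hasFDerivAt_slice h.contDiffOn_nor hθ ht)
  have h2 := hasFDerivAt_slice (contDiffOn_timeDeriv h.contDiffOn_pos) hθ ht
  have h3 := h1.congr_of_eventuallyEq (f₁ := fun y => timeDeriv T (posLift X) (y, t)) (by
    filter_upwards [isOpen_ne.mem_nhds hθ] with y hy
    change _ = speed T X ν (y, t) • lift ν (y, t)
    rw [h.speed_eq hy ht, h.timeDeriv_pos hy ht]; rfl)
  rw [h2.unique h3]
  simp [lift, nrm_coe]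

lemma gram_eq {t : ℝ} (ht : t ∈ timeInterval T) (θ : Sph m) (i j : Fin m) :
    gram (X t) θ i j = lorentz
      (spaceDeriv T (posLift X) (θ, t) (dincl θ (EuclideanSpace.single i 1)))
      (spaceDeriv T (posLift X) (θ, t) (dincl θ (EuclideanSpace.single j 1))) := by
  rw [h.spaceDeriv_pos θ.coe_ne_zero ht, HypFlow.gram_eq (h.embedding t ht).smooth]; rfl

lemma secondForm_eq {t : ℝ} (ht : t ∈ timeInterval T) (θ : Sph m) (i j : Fin m) :
    secondForm (X t) (ν t) θ i j = lorentz
      (spaceDeriv T (lift ν) (θ, t) (dincl θ (EuclideanSpace.single i 1)))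
      (spaceDeriv T (posLift X) (θ, t) (dincl θ (EuclideanSpace.single j 1))) := by
  have h1 : spaceDeriv T (lift ν) (θ, t) = fderiv ℝ (ν t ∘ nrm) θ :=
    (hasFDerivAt_slice h.contDiffOn_nor θ.coe_ne_zero ht).fderiv.symm
  rw [h.spaceDeriv_pos θ.coe_ne_zero ht, h1, secondForm, diff_eq_fderiv (h.embedding t ht).smooth,
    diff_eq_fderiv (h.normal t ht).smooth]; rfl

/-- The spatial derivative of the velocity `ν / H` is `dν / H` plus a multiple of `ν`, and the
latter is orthogonal to the hypersurface. The second form is left symmetrised, since only its trace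
matters and its symmetry is not needed. -/
lemma hasDerivWithinAt_gram {t : ℝ} (ht : t ∈ timeInterval T) (θ : Sph m) (i j : Fin m) :
    HasDerivWithinAt (fun s => gram (X s) θ i j)
      ((1 / meanCurvature (X t) (ν t) θ) *
        (secondForm (X t) (ν t) θ i j + secondForm (X t) (ν t) θ j i)) (timeInterval T) t := by
  have h1 := fun v => hasDerivWithinAt_spaceDeriv h.contDiffOn_pos θ.coe_ne_zero ht v
  have h2 := hasDerivWithinAt_lorentz (h1 (dincl θ (EuclideanSpace.single i 1)))
    (h1 (dincl θ (EuclideanSpace.single j 1)))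
  have h3 := h2.congr (fun s hs => h.gram_eq hs θ i j) (h.gram_eq ht θ i j)
  refine h3.congr_deriv ?_
  rw [h.secondForm_eq ht, h.secondForm_eq ht, h.spaceDeriv_timeDeriv_pos ht,
    h.spaceDeriv_timeDeriv_pos ht, h.speed_eq θ.coe_ne_zero ht, nrm_coe]
  simp only [lorentz_add_right, lorentz_add_left, lorentz_smul_left, lorentz_smul_right,
    (h.isFrame ht θ).normal]
  rw [lorentz_comm _ (ν t θ), (h.isFrame ht θ).normal, lorentz_comm (spaceDeriv T (posLift X) _ _)
    (spaceDeriv T (lift ν) _ _)]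
  ring

lemma det_gram_pos {t : ℝ} (ht : t ∈ timeInterval T) (θ : Sph m) : 0 < (gram (X t) θ).det :=
  HypFlow.det_gram_pos (h.embedding t ht).smooth
    ((h.embedding t ht).isFrame (h.normal t ht) θ)

/-- Jacobi's formula: the second form and its transpose each have trace `H` against the symmetric
matrix `gram⁻¹`, and the speed `1 / H` cancels this. -/
lemma hasDerivWithinAt_det_gram {t : ℝ} (ht : t ∈ timeInterval T) (θ : Sph m) :
    HasDerivWithinAt (fun s => (gram (X s) θ).det) (2 * (gram (X t) θ).det) (timeInterval T) t := by
  refine (hasDerivWithinAt_det (P' := (1 / meanCurvature (X t) (ν t) θ) •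
    (secondForm (X t) (ν t) θ + (secondForm (X t) (ν t) θ).transpose)) (h.det_gram_pos ht θ).ne'
    (h.hasDerivWithinAt_gram ht θ)).congr_deriv ?_
  have hs : (gram (X t) θ).transpose = gram (X t) θ := by
    ext i j
    simp only [Matrix.transpose_apply, gram, Matrix.of_apply]
    exact lorentz_comm _ _
  have h1 : ((gram (X t) θ)⁻¹ * (secondForm (X t) (ν t) θ).transpose).trace =
      meanCurvature (X t) (ν t) θ := by
    rw [← Matrix.trace_transpose, Matrix.transpose_mul, Matrix.transpose_transpose,
      Matrix.transpose_nonsing_inv, hs, Matrix.trace_mul_comm]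
    rfl
  have h2 : ((gram (X t) θ)⁻¹ * (secondForm (X t) (ν t) θ)).trace =
      meanCurvature (X t) (ν t) θ := rfl
  rw [Matrix.mul_smul, Matrix.mul_add, Matrix.trace_smul, Matrix.trace_add, h1, h2, smul_eq_mul]
  have := h.curvature_ne_zero t ht θ
  field_simp
  ring

lemma hasDerivWithinAt_areaDensity {t : ℝ} (ht : t ∈ timeInterval T) (θ : Sph m) :
    HasDerivWithinAt (fun s => areaDensity (X s) θ) (areaDensity (X t) θ) (timeInterval T) t := by
  have hp := h.det_gram_pos ht θ
  refine (((h.hasDerivWithinAt_det_gram ht θ).sqrt hp.ne').div_const _).congr_deriv ?_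
  rw [areaDensity]
  congr 1
  have := Real.sqrt_pos.2 hp
  have h2 := Real.mul_self_sqrt hp.le
  field_simp
  linarith

/-- The area element grows exponentially along the inverse mean curvature flow. -/
lemma areaDensity_eq_exp {t : ℝ} (ht : t ∈ timeInterval T) (θ : Sph m) :
    areaDensity (X t) θ = Real.exp t * areaDensity (X 0) θ := by
  have hd : ∀ s ∈ timeInterval T, HasDerivWithinAt
      (fun s => Real.exp (-s) * areaDensity (X s) θ) 0 (timeInterval T) s := by
    intro s hs
    refine (((hasDerivAt_neg s).exp.hasDerivWithinAt).mul
      (h.hasDerivWithinAt_areaDensity hs θ)).congr_deriv ?_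
    ring
  have h1 := (convex_timeInterval T).norm_image_sub_le_of_norm_hasDerivWithin_le (C := 0) hd
    (by simp) (zero_mem_timeInterval ht) ht
  simp only [neg_zero, Real.exp_zero, one_mul, zero_mul, norm_le_zero_iff, sub_eq_zero] at h1
  rw [← h1, ← mul_assoc, ← Real.exp_add]
  simp

end IsIMCF

end Flow

end HypFlow

/-! ### Topology of foliated tubes: consecutive domains differ by a shell. -/

namespace HypFlow

open Set

section Foliation

variable {S Y : Type*} [TopologicalSpace S] [TopologicalSpace Y]

lemma subset_or_subset_compl_closure {C U : Set Y} (hC : IsPreconnected C) (hU : IsOpen U)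
    (hd : Disjoint C (frontier U)) : C ⊆ U ∨ C ⊆ (closure U)ᶜ := by
  refine hC.subset_or_subset hU isClosed_closure.isOpen_compl ?_ ?_
  · exact disjoint_compl_right.mono_left subset_closure
  · intro x hx
    by_cases h : x ∈ closure U
    · left
      by_contra hxU
      exact disjoint_left.1 hd hx ⟨h, by rwa [hU.interior_eq]⟩
    · exact Or.inr h

/-- A family of hypersurfaces that foliates a tube, where each hypersurface is the boundary of an
open set, lying locally on the side of the smaller parameters. -/
structure IsFoliation (Φ : S × ℝ → Y) (a b : ℝ) (I : Set ℝ) (U : ℝ → Set Y) : Prop where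
  continuousOn : ContinuousOn Φ (univ ×ˢ Ioo a b)
  injOn : InjOn Φ (univ ×ˢ Ioo a b)
  isOpen_image : ∀ c d, a ≤ c → d ≤ b → IsOpen (Φ '' (univ ×ˢ Ioo c d))
  isOpen : ∀ t ∈ I, IsOpen (U t)
  preconnected : ∀ t ∈ I, IsPreconnected (U t)
  frontier : ∀ t ∈ I, frontier (U t) = Φ '' (univ ×ˢ {t})
  subset : I ⊆ Ioo a b
  outward : ∀ t ∈ I, ∃ p ∈ Φ '' (univ ×ˢ Ioo t b), p ∉ closure (U t)

namespace IsFoliation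

variable {Φ : S × ℝ → Y} {a b : ℝ} {I : Set ℝ} {U : ℝ → Set Y} (h : IsFoliation Φ a b I U)
  {t t₀ t₁ : ℝ}

include h

lemma mem_frontier (ht : t ∈ I) (θ : S) : Φ (θ, t) ∈ _root_.frontier (U t) := by
  rw [h.frontier t ht]; exact ⟨(θ, t), ⟨trivial, rfl⟩, rfl⟩

lemma notMem (ht : t ∈ I) (θ : S) : Φ (θ, t) ∉ U t := fun hx => by
  have := h.mem_frontier ht θ
  rw [(h.isOpen t ht).frontier_eq] at this
  exact this.2 hx

lemma disjoint_leaf {s : Set ℝ} (hs : s ⊆ Ioo a b) (ht : t ∈ I) (hts : t ∉ s) :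
    Disjoint (Φ '' (univ ×ˢ s)) (_root_.frontier (U t)) := by
  rw [h.frontier t ht, disjoint_left]
  rintro _ ⟨p, hp, rfl⟩ ⟨q, hq, hpq⟩
  have h1 : q = p := h.injOn ⟨trivial, by rw [hq.2]; exact h.subset ht⟩
    ⟨trivial, hs hp.2⟩ hpq
  apply hts
  have h2 : q.2 = t := hq.2
  rw [← h2, h1]
  exact hp.2

lemma isPreconnected_image [PreconnectedSpace S] {c d : ℝ} (hc : a ≤ c) (hd : d ≤ b) :
    IsPreconnected (Φ '' (univ ×ˢ Ioo c d)) :=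
  (isPreconnected_univ.prod isPreconnected_Ioo).image _
    (h.continuousOn.mono (prod_mono le_rfl (Ioo_subset_Ioo hc hd)))

/-- The outer shell is connected and misses the boundary of `U t`, so it lies on one side; the
single exterior point in `outward` decides which. -/
lemma outer_subset [PreconnectedSpace S] (ht : t ∈ I) :
    Φ '' (univ ×ˢ Ioo t b) ⊆ (closure (U t))ᶜ := by
  have hta := (h.subset ht).1.le
  refine (subset_or_subset_compl_closure (h.isPreconnected_image hta le_rfl) (h.isOpen t ht)
    (h.disjoint_leaf (Ioo_subset_Ioo hta le_rfl) ht (by simp))).resolve_left fun hsub => ?_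
  obtain ⟨p, hp, hp2⟩ := h.outward t ht
  exact hp2 (subset_closure (hsub hp))

/-- Were the inner shell outside too, a neighbourhood of a point of the leaf would contain no point
of `U t`, although the leaf is its boundary. -/
lemma inner_subset [PreconnectedSpace S] [Nonempty S] (ht : t ∈ I) :
    Φ '' (univ ×ˢ Ioo a t) ⊆ U t := by
  have htb := (h.subset ht).2.le
  refine (subset_or_subset_compl_closure (h.isPreconnected_image le_rfl htb) (h.isOpen t ht)
    (h.disjoint_leaf (Ioo_subset_Ioo le_rfl htb) ht (by simp))).resolve_right fun hsub => ?_
  obtain ⟨θ⟩ := (inferInstance : Nonempty S)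
  have hx : Φ (θ, t) ∈ closure (U t) := frontier_subset_closure (h.mem_frontier ht θ)
  obtain ⟨y, ⟨⟨ξ, s⟩, hs, rfl⟩, hy2⟩ := mem_closure_iff.1 hx _ (h.isOpen_image a b le_rfl le_rfl)
    ⟨(θ, t), ⟨trivial, h.subset ht⟩, rfl⟩
  rcases lt_trichotomy s t with hst | rfl | hst
  · exact hsub ⟨(ξ, s), ⟨trivial, hs.2.1, hst⟩, rfl⟩ (subset_closure hy2)
  · exact h.notMem ht ξ hy2
  · exact h.outer_subset ht ⟨(ξ, s), ⟨trivial, hst, hs.2.2⟩, rfl⟩ (subset_closure hy2)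

lemma leaf_subset [PreconnectedSpace S] [Nonempty S] (h0 : t₀ ∈ I) (h1 : t₁ ∈ I) (h01 : t₀ < t₁) :
    _root_.frontier (U t₀) ⊆ U t₁ := by
  rw [h.frontier _ h0]
  rintro _ ⟨⟨ξ, s⟩, ⟨-, rfl⟩, rfl⟩
  exact h.inner_subset h1 ⟨(ξ, s), ⟨trivial, (h.subset h0).1, h01⟩, rfl⟩

lemma frontier_nonempty [Nonempty S] (h0 : t₀ ∈ I) : (_root_.frontier (U t₀)).Nonempty := by
  obtain ⟨θ⟩ := (inferInstance : Nonempty S)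
  exact ⟨_, h.mem_frontier h0 θ⟩

lemma closure_subset [PreconnectedSpace S] [Nonempty S] (h0 : t₀ ∈ I) (h1 : t₁ ∈ I)
    (h01 : t₀ < t₁) : closure (U t₀) ⊆ U t₁ := by
  refine (subset_or_subset_compl_closure (h.preconnected t₀ h0).closure (h.isOpen t₁ h1)
    ?_).resolve_right fun hsub => ?_
  · rw [h.frontier t₁ h1, disjoint_right]
    rintro _ ⟨⟨ξ, s⟩, ⟨-, rfl⟩, rfl⟩
    exact h.outer_subset h0 ⟨(ξ, s), ⟨trivial, h01, (h.subset h1).2⟩, rfl⟩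
  · obtain ⟨p, hp⟩ := h.frontier_nonempty h0
    exact hsub (frontier_subset_closure hp) (subset_closure (h.leaf_subset h0 h1 h01 hp))

/-- Inside `U t₁`, the closed set `closure (U t₀) ∪ Φ '' (univ ×ˢ Icc t₀ t₁)` coincides with the
open set `U t₀ ∪ Φ '' (univ ×ˢ Ioo a t₁)`. As `U t₁` is connected and contains the leaf of `t₀`, it
is contained in this set. Compactness of `S` makes the shell closed. -/
lemma eq_union [CompactSpace S] [PreconnectedSpace S] [Nonempty S] [T2Space Y]
    (h0 : t₀ ∈ I) (h1 : t₁ ∈ I) (h01 : t₀ < t₁) :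
    U t₁ = U t₀ ∪ Φ '' (univ ×ˢ Ico t₀ t₁) := by
  have hlt : Φ '' (univ ×ˢ Ioo a t₁) ⊆ U t₀ ∪ Φ '' (univ ×ˢ Ico t₀ t₁) := by
    rintro _ ⟨⟨ξ, s⟩, ⟨-, hs⟩, rfl⟩
    rcases lt_or_ge s t₀ with hst | hst
    · exact Or.inl (h.inner_subset h0 ⟨(ξ, s), ⟨trivial, hs.1, hst⟩, rfl⟩)
    · exact Or.inr ⟨(ξ, s), ⟨trivial, hst, hs.2⟩, rfl⟩
  have hgt : Φ '' (univ ×ˢ Ico t₀ t₁) ⊆ Φ '' (univ ×ˢ Ioo a t₁) :=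
    image_mono (prod_mono le_rfl fun s hs => ⟨(h.subset h0).1.trans_le hs.1, hs.2⟩)
  apply Subset.antisymm
  · refine Subset.trans ?_ (union_subset subset_union_left hlt)
    have hclosed : IsClosed (closure (U t₀) ∪ Φ '' (univ ×ˢ Icc t₀ t₁)) := by
      refine isClosed_closure.union (IsCompact.isClosed ?_)
      refine (isCompact_univ.prod isCompact_Icc).image_of_continuousOn (h.continuousOn.mono ?_)
      exact prod_mono le_rfl fun s hs =>
        ⟨(h.subset h0).1.trans_le hs.1, hs.2.trans_lt (h.subset h1).2⟩
    refine ((h.preconnected t₁ h1).subset_or_subset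
      ((h.isOpen t₀ h0).union (h.isOpen_image a t₁ le_rfl (h.subset h1).2.le))
      hclosed.isOpen_compl ?_ ?_).resolve_right fun hsub => ?_
    · refine disjoint_compl_right.mono_left (union_subset
        (subset_closure.trans subset_union_left) (hlt.trans ?_))
      exact union_subset (subset_closure.trans subset_union_left)
        ((image_mono (prod_mono le_rfl Ico_subset_Icc_self)).trans subset_union_right)
    · intro x hx
      by_cases hx2 : x ∈ closure (U t₀) ∪ Φ '' (univ ×ˢ Icc t₀ t₁)
      · left
        rcases hx2 with hx2 | ⟨⟨ξ, s⟩, ⟨-, hs⟩, rfl⟩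
        · rw [closure_eq_self_union_frontier, h.frontier t₀ h0] at hx2
          refine hx2.imp id fun hx3 => image_mono (prod_mono le_rfl ?_) hx3
          rintro _ rfl
          exact ⟨(h.subset h0).1, h01⟩
        · rcases hs.2.lt_or_eq with hs2 | rfl
          · exact Or.inr ⟨(ξ, s), ⟨trivial, (h.subset h0).1.trans_le hs.1, hs2⟩, rfl⟩
          · exact absurd hx (h.notMem h1 ξ)
      · exact Or.inr hx2
    · obtain ⟨p, hp⟩ := h.frontier_nonempty h0
      exact hsub (h.leaf_subset h0 h1 h01 hp) (Or.inl (frontier_subset_closure hp))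
  · exact union_subset (subset_closure.trans (h.closure_subset h0 h1 h01))
      (hgt.trans (h.inner_subset h1))

lemma disjoint_image [PreconnectedSpace S] (h0 : t₀ ∈ I) (h1 : t₁ ∈ I) :
    Disjoint (U t₀) (Φ '' (univ ×ˢ Ico t₀ t₁)) := by
  rw [disjoint_right]
  rintro _ ⟨⟨ξ, s⟩, ⟨-, hs⟩, rfl⟩ hx
  rcases hs.1.lt_or_eq with hs2 | rfl
  · exact h.outer_subset h0 ⟨(ξ, s), ⟨trivial, hs2, hs.2.trans (h.subset h1).2⟩, rfl⟩
      (subset_closure hx)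
  · exact h.notMem h0 ξ hx

end IsFoliation

end Foliation

end HypFlow

/-! ### Reflection across the initial time. -/

namespace HypFlow

open Set

variable {m : ℕ}

section Glue

variable {P Z : Type*} [TopologicalSpace P] [TopologicalSpace Z]

lemma continuousOn_glue {A B G : P → Z} {W C D : Set P} (hC : IsClosed C) (hD : IsClosed D)
    (hCD : W ⊆ C ∪ D) (hA : ContinuousOn A (W ∩ C)) (hB : ContinuousOn B (W ∩ D))
    (hGA : EqOn G A (W ∩ C)) (hGB : EqOn G B (W ∩ D)) : ContinuousOn G W := by
  intro q hq
  have hW : W = (W ∩ C) ∪ (W ∩ D) := by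
    rw [← inter_union_distrib_left, inter_eq_left.2 hCD]
  rw [hW]
  refine ContinuousWithinAt.union ?_ ?_
  · by_cases h : q ∈ C
    · exact (hA.congr hGA) q ⟨hq, h⟩
    · refine continuousWithinAt_of_notMem_closure fun hcl => h ?_
      exact hC.closure_subset (closure_mono inter_subset_right hcl)
  · by_cases h : q ∈ D
    · exact (hB.congr hGB) q ⟨hq, h⟩
    · refine continuousWithinAt_of_notMem_closure fun hcl => h ?_
      exact hD.closure_subset (closure_mono inter_subset_right hcl)

lemma hasFDerivAt_glue {E V : Type*} [NormedAddCommGroup E] [NormedSpace ℝ E]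
    [NormedAddCommGroup V] [NormedSpace ℝ V] {G : E → V} {G' : E →L[ℝ] V} {W C D : Set E} {q : E}
    (hC : IsClosed C) (hD : IsClosed D) (hCD : W ⊆ C ∪ D) (hW : W ∈ 𝓝 q)
    (hA : q ∈ C → HasFDerivWithinAt G G' (W ∩ C) q)
    (hB : q ∈ D → HasFDerivWithinAt G G' (W ∩ D) q) : HasFDerivAt G G' q := by
  have hW' : W = (W ∩ C) ∪ (W ∩ D) := by
    rw [← inter_union_distrib_left, inter_eq_left.2 hCD]
  refine HasFDerivWithinAt.hasFDerivAt ?_ hW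
  rw [hW']
  refine HasFDerivWithinAt.union ?_ ?_
  · by_cases h : q ∈ C
    · exact hA h
    · refine HasFDerivWithinAt.of_notMem_closure fun hcl => h ?_
      exact hC.closure_subset (closure_mono inter_subset_right hcl)
  · by_cases h : q ∈ D
    · exact hB h
    · refine HasFDerivWithinAt.of_notMem_closure fun hcl => h ?_
      exact hD.closure_subset (closure_mono inter_subset_right hcl)

end Glue

section Extension

variable {V : Type*} [NormedAddCommGroup V] [NormedSpace ℝ V] {T : EReal} {f : Euc m × ℝ → V}

/-- The extension of a function on `liftDomain m T` to negative times. -/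
noncomputable def extend (f : Euc m × ℝ → V) (q : Euc m × ℝ) : V :=
  if 0 ≤ q.2 then f q else (2 : ℝ) • f (q.1, 0) - f (q.1, -q.2)

/-- The differential of the extension to negative times. -/
noncomputable def extendDeriv (T : EReal) (f : Euc m × ℝ → V) (q : Euc m × ℝ) :
    Euc m × ℝ →L[ℝ] V :=
  if 0 ≤ q.2 then fderivWithin ℝ f (liftDomain m T) q else
    (2 : ℝ) • (fderivWithin ℝ f (liftDomain m T) (q.1, 0)).comp
      ((ContinuousLinearMap.fst ℝ (Euc m) ℝ).prod 0) -
    (fderivWithin ℝ f (liftDomain m T) (q.1, -q.2)).comp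
      ((ContinuousLinearMap.fst ℝ (Euc m) ℝ).prod (-ContinuousLinearMap.snd ℝ (Euc m) ℝ))

/-- The domain of the extension to negative times. -/
def extendDomain (m : ℕ) (T : EReal) : Set (Euc m × ℝ) := {q | q.1 ≠ 0 ∧ |q.2| ∈ timeInterval T}

lemma isOpen_abs_mem_timeInterval (T : EReal) : IsOpen {t : ℝ | |t| ∈ timeInterval T} := by
  rw [Metric.isOpen_iff]
  intro t ht
  obtain ⟨δ, hδ, h⟩ := exists_Icc_subset_timeInterval ht
  refine ⟨δ, hδ, fun s hs => h ⟨abs_nonneg s, ?_⟩⟩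
  rw [Metric.mem_ball, Real.dist_eq] at hs
  linarith [abs_sub_abs_le_abs_sub s t]

lemma isOpen_extendDomain (m : ℕ) (T : EReal) : IsOpen (extendDomain m T) :=
  (isOpen_ne.preimage continuous_fst).inter
    ((isOpen_abs_mem_timeInterval T).preimage continuous_snd)

lemma extendDomain_pos : MapsTo id (extendDomain m T ∩ {q | 0 ≤ q.2}) (liftDomain m T) := by
  rintro ⟨x, t⟩ ⟨⟨hx, ht⟩, ht0⟩
  refine ⟨hx, ?_⟩
  simp only [mem_ofPred_eq] at ht ht0
  rwa [abs_of_nonneg ht0] at ht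

lemma extendDomain_neg : MapsTo (fun q : Euc m × ℝ => (q.1, -q.2))
    (extendDomain m T ∩ {q | q.2 ≤ 0}) (liftDomain m T) := by
  rintro ⟨x, t⟩ ⟨⟨hx, ht⟩, ht0⟩
  refine ⟨hx, ?_⟩
  simp only [mem_ofPred_eq] at ht ht0
  rwa [abs_of_nonpos ht0] at ht

lemma extendDomain_zero : MapsTo (fun q : Euc m × ℝ => (q.1, (0 : ℝ)))
    (extendDomain m T) (liftDomain m T) :=
  fun _ hq => ⟨hq.1, zero_mem_timeInterval hq.2⟩

lemma extend_eq_of_nonpos {q : Euc m × ℝ} (hq : q.2 ≤ 0) :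
    extend f q = (2 : ℝ) • f (q.1, 0) - f (q.1, -q.2) := by
  obtain ⟨x, t⟩ := q
  rcases hq.lt_or_eq with h | h
  · rw [extend, if_neg (not_le.2 h)]
  · simp only at h
    subst h
    rw [extend, if_pos le_rfl]
    simp [two_smul]

lemma extendDeriv_eq_of_nonpos {q : Euc m × ℝ} (hq : q.2 ≤ 0) :
    extendDeriv T f q = (2 : ℝ) • (fderivWithin ℝ f (liftDomain m T) (q.1, 0)).comp
      ((ContinuousLinearMap.fst ℝ (Euc m) ℝ).prod 0) -
    (fderivWithin ℝ f (liftDomain m T) (q.1, -q.2)).comp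
      ((ContinuousLinearMap.fst ℝ (Euc m) ℝ).prod (-ContinuousLinearMap.snd ℝ (Euc m) ℝ)) := by
  obtain ⟨x, t⟩ := q
  rcases hq.lt_or_eq with h | h
  · rw [extendDeriv, if_neg (not_le.2 h)]
  · simp only at h
    subst h
    rw [extendDeriv, if_pos le_rfl]
    refine ContinuousLinearMap.ext fun v => ?_
    simp only [sub_apply, smul_apply,
      ContinuousLinearMap.comp_apply, ContinuousLinearMap.prod_apply, neg_zero]
    -- At time `0` both formulas agree because `2 (v, 0) - (v, -s) = (v, s)`.
    rw [← map_smul, ← map_sub]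
    congr 1
    ext <;> simp [two_smul]

lemma continuousOn_extendDeriv (hf : ContDiffOn ℝ ∞ f (liftDomain m T)) :
    ContinuousOn (extendDeriv T f) (extendDomain m T) := by
  have hD := (contDiffOn_fderivWithin_liftDomain hf).continuousOn
  refine continuousOn_glue (C := {q | 0 ≤ q.2}) (D := {q | q.2 ≤ 0})
    (A := fderivWithin ℝ f (liftDomain m T))
    (isClosed_le continuous_const continuous_snd) (isClosed_le continuous_snd continuous_const)
    (fun q _ => le_total 0 q.2) (hD.comp continuousOn_id extendDomain_pos) ?_
    (fun q hq => if_pos hq.2) (fun q hq => extendDeriv_eq_of_nonpos hq.2)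
  refine ContinuousOn.sub (ContinuousOn.fun_const_smul (ContinuousOn.clm_comp ?_ continuousOn_const) _)
    (ContinuousOn.clm_comp ?_ continuousOn_const)
  · exact hD.comp (by fun_prop) (extendDomain_zero.mono_left inter_subset_left)
  · exact hD.comp (by fun_prop) extendDomain_neg

lemma hasFDerivAt_extend (hf : ContDiffOn ℝ ∞ f (liftDomain m T)) {q : Euc m × ℝ}
    (hq : q ∈ extendDomain m T) : HasFDerivAt (extend f) (extendDeriv T f q) q := by
  refine hasFDerivAt_glue (C := {q : Euc m × ℝ | 0 ≤ q.2}) (D := {q : Euc m × ℝ | q.2 ≤ 0})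
    (isClosed_le continuous_const continuous_snd) (isClosed_le continuous_snd continuous_const)
    (fun q _ => le_total 0 q.2) ((isOpen_extendDomain m T).mem_nhds hq) (fun h0 => ?_)
    (fun h0 => ?_)
  · have h1 := (hasFDerivWithinAt_liftDomain hf (extendDomain_pos ⟨hq, h0⟩)).mono
      (show extendDomain m T ∩ {q | 0 ≤ q.2} ⊆ liftDomain m T from extendDomain_pos)
    rw [extendDeriv, if_pos (show 0 ≤ q.2 from h0)]
    exact h1.congr (fun p hp => if_pos hp.2) (if_pos h0)
  · rw [extendDeriv_eq_of_nonpos h0]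
    have e1 : HasFDerivWithinAt (fun q : Euc m × ℝ => (q.1, (0 : ℝ)))
        ((ContinuousLinearMap.fst ℝ (Euc m) ℝ).prod 0) (extendDomain m T ∩ {q | q.2 ≤ 0}) q :=
      hasFDerivWithinAt_fst.prodMk (hasFDerivWithinAt_const _ _ _)
    have e2 : HasFDerivWithinAt (fun q : Euc m × ℝ => (q.1, -q.2))
        ((ContinuousLinearMap.fst ℝ (Euc m) ℝ).prod (-ContinuousLinearMap.snd ℝ (Euc m) ℝ))
        (extendDomain m T ∩ {q | q.2 ≤ 0}) q :=
      hasFDerivWithinAt_fst.prodMk hasFDerivWithinAt_snd.neg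
    have h1 := (hasFDerivWithinAt_liftDomain hf (extendDomain_zero hq)).comp q e1
      (extendDomain_zero.mono_left inter_subset_left)
    have h2 := (hasFDerivWithinAt_liftDomain hf (extendDomain_neg ⟨hq, h0⟩)).comp q e2
      extendDomain_neg
    exact ((h1.const_smul (2 : ℝ)).sub h2).congr (fun p hp => extend_eq_of_nonpos hp.2)
      (extend_eq_of_nonpos h0)

/-- The reflection `2 f (x, 0) - f (x, -t)` matches `f` to first order at `t = 0`, so the extension
is continuously differentiable on an open set. This makes the inverse function theorem available at
the initial time as well. -/
lemma hasStrictFDerivAt_extend (hf : ContDiffOn ℝ ∞ f (liftDomain m T)) {q : Euc m × ℝ}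
    (hq : q ∈ extendDomain m T) : HasStrictFDerivAt (extend f) (extendDeriv T f q) q := by
  have hnhds := (isOpen_extendDomain m T).mem_nhds hq
  refine hasStrictFDerivAt_of_hasFDerivAt_of_continuousAt ?_
    ((continuousOn_extendDeriv hf).continuousAt hnhds)
  filter_upwards [hnhds] with p hp using hasFDerivAt_extend hf hp

end Extension

section Norm

lemma hasStrictFDerivAt_norm {x : Euc m} (hx : x ≠ 0) :
    HasStrictFDerivAt (fun y : Euc m => ‖y‖) (innerSL ℝ (nrm x : Euc m)) x := by
  have h0 : ‖x‖ ≠ 0 := norm_ne_zero_iff.2 hx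
  have h1 := (hasStrictFDerivAt_norm_sq x).sqrt (pow_ne_zero 2 h0)
  have e : (fun y : Euc m => √(‖y‖ ^ 2)) = fun y => ‖y‖ :=
    funext fun y => Real.sqrt_sq (norm_nonneg y)
  rw [e, Real.sqrt_sq (norm_nonneg x)] at h1
  refine h1.congr_fderiv ?_
  rw [coe_nrm hx]
  ext v
  simp
  field_simp

end Norm

end HypFlow

/-! ### The track of the flow as a map on an annulus. -/

namespace HypFlow

open Set

variable {m : ℕ}

/-- The rescaled map factors through `a` times the transvection that multiplies `θ` by `b / a`; that
factor has determinant `a ^ (m + 1) * (b / a)`. -/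
lemma det_tilt_smul {L : Euc m →L[ℝ] Mink m} {θ : Euc m} (hθ : ‖θ‖ = 1) (hL : L θ = 0) {a : ℝ}
    (ha : a ≠ 0) (b : ℝ) (z : Euc m) :
    (tilt (a • L) θ (b • z)).det = a ^ m * b * (tilt L θ z).det := by
  have hθ2 : inner ℝ θ θ = (1 : ℝ) := by rw [real_inner_self_eq_norm_sq, hθ]; norm_num
  have h1 : (tilt (a • L) θ (b • z) : Euc m →ₗ[ℝ] Euc m) = (tilt L θ z : Euc m →ₗ[ℝ] Euc m) ∘ₗ
      (a • LinearMap.transvection (innerSL ℝ θ : Euc m →ₗ[ℝ] ℝ) ((b / a - 1) • θ)) := by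
    ext1 v
    simp only [LinearMap.coe_comp, Function.comp_apply, LinearMap.smul_apply,
      LinearMap.transvection.apply, ContinuousLinearMap.coe_coe, map_add, map_smul,
      innerSL_apply_apply]
    simp only [tilt_apply, hL, hθ2]
    simp only [Prod.snd_zero, zero_add, one_smul, smul_apply, Prod.smul_snd]
    rw [show inner ℝ θ v • b • z = (inner ℝ θ v * b) • z by rw [smul_smul]]
    have : inner ℝ θ v * b = a * (inner ℝ θ v + inner ℝ θ v * (b / a - 1)) := by field_simp; ring
    rw [this]
    module
  simp only [ContinuousLinearMap.det]
  rw [h1, LinearMap.det_comp, LinearMap.det_smul, LinearMap.transvection.det]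
  simp only [ContinuousLinearMap.coe_coe, innerSL_apply_apply, inner_smul_right, hθ2,
    finrank_euclideanSpace_fin]
  field_simp
  ring

lemma nrm_smul' {s : ℝ} (hs : 0 < s) (x : Euc m) : nrm (s • x) = nrm x := by
  by_cases hx : x = 0
  · simp [hx]
  · apply Subtype.ext
    rw [coe_nrm hx, coe_nrm (smul_ne_zero hs.ne' hx), norm_smul, smul_smul, Real.norm_eq_abs,
      abs_of_pos hs]
    field_simp

section Tube

variable {T : EReal} {X : ℝ → Sph m → Hyp m} {ν : ℝ → Sph m → Mink m} {Ω : ℝ → Set (Hyp m)}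

/-- The spatial part of the lift of a flow. -/
noncomputable def spatialLift (X : ℝ → Sph m → Hyp m) (q : Euc m × ℝ) : Euc m := (posLift X q).2

/-- The track of a flow, as a map on an annulus: the point of radius `1 + t` in direction `θ` is
sent to the spatial part of `X t θ`, for nonnegative `t`. -/
noncomputable def tubeMap (X : ℝ → Sph m → Hyp m) (x : Euc m) : Euc m :=
  extend (spatialLift X) (x, ‖x‖ - 1)

/-- The differential of `tubeMap`. -/
noncomputable def tubeDeriv (T : EReal) (X : ℝ → Sph m → Hyp m) (x : Euc m) : Euc m →L[ℝ] Euc m :=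
  (extendDeriv T (spatialLift X) (x, ‖x‖ - 1)).comp
    ((ContinuousLinearMap.id ℝ (Euc m)).prod (innerSL ℝ (nrm x : Euc m)))

/-- The domain of `tubeMap`. -/
def tubeDomain (m : ℕ) (T : EReal) : Set (Euc m) := {x | x ≠ 0 ∧ |‖x‖ - 1| ∈ timeInterval T}

lemma isOpen_tubeDomain : IsOpen (tubeDomain m T) :=
  isOpen_ne.inter ((isOpen_abs_mem_timeInterval T).preimage (by fun_prop))

lemma tubeMap_smul {t : ℝ} (ht : 0 ≤ t) (θ : Sph m) :
    tubeMap X ((1 + t) • (θ : Euc m)) = (X t θ).1.2 := by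
  have hn : ‖(1 + t) • (θ : Euc m)‖ - 1 = t := by
    rw [norm_smul, θ.norm_coe, Real.norm_eq_abs, abs_of_pos (by linarith)]; ring
  rw [tubeMap, hn, extend, if_pos ht]
  simp [spatialLift, lift, nrm_smul (show 0 < 1 + t by linarith), toMink]

namespace IsIMCF

variable (h : IsIMCF T X ν Ω)

include h

lemma contDiffOn_spatialLift : ContDiffOn ℝ ∞ (spatialLift X) (liftDomain m T) :=
  contDiff_snd.comp_contDiffOn h.contDiffOn_pos

lemma hasStrictFDerivAt_tubeMap {x : Euc m} (hx : x ∈ tubeDomain m T) :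
    HasStrictFDerivAt (tubeMap X) (tubeDeriv T X x) x := by
  have h1 : HasStrictFDerivAt (fun y : Euc m => (y, ‖y‖ - 1))
      ((ContinuousLinearMap.id ℝ (Euc m)).prod (innerSL ℝ (nrm x : Euc m))) x :=
    (hasStrictFDerivAt_id x).prodMk ((hasStrictFDerivAt_norm hx.1).sub_const 1)
  have h2 := hasStrictFDerivAt_extend h.contDiffOn_spatialLift (q := (x, ‖x‖ - 1)) hx
  exact h2.comp x h1

lemma continuousOn_tubeDeriv : ContinuousOn (tubeDeriv T X) (tubeDomain m T) := by
  refine ContinuousOn.clm_comp ?_ ?_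
  · exact (continuousOn_extendDeriv h.contDiffOn_spatialLift).comp (by fun_prop)
      (fun x hx => hx)
  · have h1 : ContinuousOn (fun x : Euc m => innerSL ℝ (nrm x : Euc m)) (tubeDomain m T) := by
      refine (innerSL ℝ).continuous.comp_continuousOn (continuous_subtype_val.comp_continuousOn ?_)
      exact fun x hx => (continuousAt_nrm hx.1).continuousWithinAt
    have h2 : ContinuousOn (fun x : Euc m => (ContinuousLinearMap.id ℝ (Euc m),
      innerSL ℝ (nrm x : Euc m))) (tubeDomain m T) := continuousOn_const.prodMk h1
    exact (ContinuousLinearMap.prodₗᵢ ℝ).continuous.comp_continuousOn h2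

/-- The lift is homogeneous of degree `0`, so its derivative is homogeneous of degree `-1`. -/
lemma spaceDeriv_scale {x : Euc m} {t : ℝ} (hx : x ≠ 0) (ht : t ∈ timeInterval T) :
    spaceDeriv T (posLift X) (x, t) = ‖x‖⁻¹ • spaceDeriv T (posLift X) (nrm x, t) := by
  have hn := norm_pos_iff.2 hx
  have h1 := hasFDerivAt_slice h.contDiffOn_pos (nrm x).coe_ne_zero ht
  have e1 : (nrm x : Euc m) = ‖x‖⁻¹ • x := coe_nrm hx
  have h2 : HasFDerivAt (fun y : Euc m => ‖x‖⁻¹ • y) (‖x‖⁻¹ • ContinuousLinearMap.id ℝ (Euc m)) x :=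
    (hasFDerivAt_id x).const_smul ‖x‖⁻¹
  rw [e1] at h1 ⊢
  have h3 := h1.comp x h2
  have e2 : ((fun y => posLift X (y, t)) ∘ fun y => ‖x‖⁻¹ • y) = fun y => posLift X (y, t) := by
    funext y
    simp [posLift, lift, nrm_smul' (inv_pos.2 hn)]
  rw [e2] at h3
  rw [(hasFDerivAt_slice h.contDiffOn_pos hx ht).unique h3]
  ext v <;> simp

/-- Moving radially in the annulus changes only the time, hence moves the image with velocity `ν /
H`; moving tangentially changes only the point of the sphere. -/
lemma tubeDeriv_eq {x : Euc m} {t : ℝ} (hx : x ≠ 0) (ht : t ∈ timeInterval T) (hxt : ‖x‖ = 1 + t) :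
    tubeDeriv T X x = tilt (‖x‖⁻¹ • spaceDeriv T (posLift X) (nrm x, t)) (nrm x)
      (speed T X ν (nrm x, t) • (ν t (nrm x)).2) := by
  have e : ‖x‖ - 1 = t := by linarith
  have hq : (x, t) ∈ liftDomain m T := ⟨hx, ht⟩
  have h1 : fderivWithin ℝ (spatialLift X) (liftDomain m T) (x, t) =
      (ContinuousLinearMap.snd ℝ ℝ (Euc m)).comp
        (fderivWithin ℝ (posLift X) (liftDomain m T) (x, t)) :=
    ((hasFDerivWithinAt_liftDomain h.contDiffOn_pos hq).snd).fderivWithin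
      (uniqueDiffOn_liftDomain m T _ hq)
  rw [tubeDeriv, e, extendDeriv, if_pos (show 0 ≤ (x, t).2 from ht.1), h1,
    ← h.spaceDeriv_scale hx ht]
  refine ContinuousLinearMap.ext fun v => ?_
  have h2 := h.timeDeriv_pos hx ht
  rw [timeDeriv] at h2
  rw [tilt_apply, h.speed_eq (nrm x).coe_ne_zero ht, nrm_coe, spaceDeriv]
  simp only [ContinuousLinearMap.comp_apply, ContinuousLinearMap.prod_apply,
    ContinuousLinearMap.inl_apply, ContinuousLinearMap.id_apply, innerSL_apply_apply]
  have e3 : ((v, inner ℝ (nrm x : Euc m) v) : Euc m × ℝ) =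
      (v, 0) + inner ℝ (nrm x : Euc m) v • (0, 1) := by
    ext <;> simp
  rw [e3, map_add, map_smul, h2]
  rfl

lemma det_tubeDeriv {x : Euc m} {t : ℝ} (hx : x ≠ 0) (ht : t ∈ timeInterval T)
    (hxt : ‖x‖ = 1 + t) :
    (tubeDeriv T X x).det = (‖x‖⁻¹) ^ m * speed T X ν (nrm x, t) *
      (tilt (spaceDeriv T (posLift X) (nrm x, t)) (nrm x) (ν t (nrm x)).2).det := by
  rw [h.tubeDeriv_eq hx ht hxt, det_tilt_smul (nrm x).norm_coe (h.isFrame ht (nrm x)).radial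
    (inv_ne_zero (norm_ne_zero_iff.2 hx))]

lemma areaDensity_eq {t : ℝ} (ht : t ∈ timeInterval T) (θ : Sph m) :
    areaDensity (X t) θ =
      |(tilt (spaceDeriv T (posLift X) (θ, t)) θ (ν t θ).2).det| / (X t θ).1.1 := by
  rw [h.spaceDeriv_pos θ.coe_ne_zero ht]
  exact HypFlow.areaDensity_eq (h.embedding t ht).smooth
    ((h.embedding t ht).isFrame (h.normal t ht) θ)

end IsIMCF

end Tube

end HypFlow

/-! ### Sign of the speed and the local foliation by the flow. -/

namespace HypFlow

open Set

variable {m : ℕ} {T : EReal} {X : ℝ → Sph m → Hyp m} {ν : ℝ → Sph m → Mink m}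
  {Ω : ℝ → Set (Hyp m)}

lemma preconnectedSpace_sph (hm : 1 ≤ m) : PreconnectedSpace (Sph m) := by
  refine Subtype.preconnectedSpace (isPreconnected_sphere ?_ _ _)
  rw [← Module.finrank_eq_rank, finrank_euclideanSpace_fin]
  exact_mod_cast Nat.lt_succ_of_le hm

instance : Nonempty (Sph m) := ⟨nrm 0⟩

lemma eventually_lt_of_hasDerivAt_pos {f : ℝ → ℝ} {f' a : ℝ} (hf : HasDerivAt f f' a)
    (hf' : 0 < f') : ∀ᶠ s in 𝓝[>] a, f a < f s := by
  have h1 := (hasDerivAt_iff_tendsto_slope.1 hf).mono_left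
    (nhdsWithin_mono a (fun s (hs : a < s) => ne_of_gt hs))
  filter_upwards [h1.eventually (lt_mem_nhds hf'), self_mem_nhdsWithin] with s hs has
  have has' : 0 < s - a := sub_pos.2 has
  rw [slope_def_field, div_pos_iff_of_pos_right has'] at hs
  linarith

/-- The point at time `s` on the geodesic issuing from `X` with velocity `N`. -/
noncomputable def geodesicPoint (X N : Mink m) (s : ℝ) : Mink m := Real.cosh s • X + Real.sinh s • N

lemma geodesicPoint_zero (X N : Mink m) : geodesicPoint X N 0 = X := by simp [geodesicPoint]

lemma lorentz_geodesicPoint {X N : Mink m} (hX : lorentz X X = -1) (hN : lorentz N N = 1)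
    (hNX : lorentz N X = 0) (s : ℝ) :
    lorentz (geodesicPoint X N s) (geodesicPoint X N s) = -1 := by
  simp only [geodesicPoint, lorentz_add_left, lorentz_add_right, lorentz_smul_left,
    lorentz_smul_right, hX, hN, hNX, lorentz_comm X N]
  linarith [Real.cosh_sq s]

lemma hasDerivAt_geodesicPoint (X N : Mink m) : HasDerivAt (geodesicPoint X N) N 0 := by
  have := ((Real.hasDerivAt_cosh 0).smul_const X).add ((Real.hasDerivAt_sinh 0).smul_const N)
  refine this.congr_deriv ?_
  simp

namespace IsIMCF

variable (h : IsIMCF T X ν Ω)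

include h

lemma continuousOn_speed (θ : Sph m) :
    ContinuousOn (fun t => speed T X ν (θ, t)) (timeInterval T) :=
  h.contDiffOn_speed.continuousOn.comp (by fun_prop) (fun _ ht => ⟨θ.coe_ne_zero, ht⟩)

lemma speed_coe {t : ℝ} (ht : t ∈ timeInterval T) (θ : Sph m) :
    speed T X ν (θ, t) = 1 / meanCurvature (X t) (ν t) θ := by
  rw [h.speed_eq θ.coe_ne_zero ht, nrm_coe]

/-- The speed `1 / H` is continuous and nowhere zero on a connected time interval, so its sign at
time `0` persists. -/
lemma speed_pos (hconvex : IsMeanConvex (X 0) (ν 0)) {t : ℝ} (ht : t ∈ timeInterval T)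
    (θ : Sph m) : 0 < speed T X ν (θ, t) := by
  by_contra! hcon
  have h0 : 0 ≤ speed T X ν (θ, 0) := by
    rw [h.speed_coe (zero_mem_timeInterval ht)]
    exact (one_div_pos.2 (hconvex θ)).le
  obtain ⟨s, hs, hs0⟩ := (convex_timeInterval T).isPreconnected.intermediate_value ht
    (zero_mem_timeInterval ht) (h.continuousOn_speed θ) ⟨hcon, h0⟩
  simp only at hs0
  rw [h.speed_coe hs] at hs0
  exact one_div_ne_zero (h.curvature_ne_zero s hs θ) hs0

lemma frontier_preimage {t : ℝ} (ht : t ∈ timeInterval T) :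
    frontier (ofSpatial ⁻¹' Ω t) = range fun θ => (X t θ).1.2 := by
  have h1 := (spatialHomeo m).symm.preimage_frontier (Ω t)
  have h2 : ofSpatial ⁻¹' frontier (Ω t) = frontier (ofSpatial ⁻¹' Ω t) := h1
  rw [← h2, (h.domain t ht).boundary]
  ext x
  constructor
  · rintro ⟨θ, hθ⟩
    exact ⟨θ, by simp only; rw [hθ]; rfl⟩
  · rintro ⟨θ, rfl⟩
    exact ⟨θ, (ofSpatial_spatial _).symm⟩

lemma isPreconnected_preimage {t : ℝ} (ht : t ∈ timeInterval T) :
    IsPreconnected (ofSpatial ⁻¹' Ω t) := by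
  have h1 := (spatialHomeo m).symm.isPreconnected_preimage.2 (h.domain t ht).connected.isPreconnected
  exact h1

lemma det_tubeDeriv_ne_zero {x : Euc m} {t : ℝ} (ht : t ∈ timeInterval T) (hxt : ‖x‖ = 1 + t) :
    (tubeDeriv T X x).det ≠ 0 := by
  have hx : x ≠ 0 := norm_ne_zero_iff.1 (by linarith [ht.1])
  rw [h.det_tubeDeriv hx ht hxt]
  refine mul_ne_zero (mul_ne_zero (pow_ne_zero _ (inv_ne_zero (norm_ne_zero_iff.2 hx))) ?_)
    (h.isFrame ht _).det_tilt_ne_zero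
  rw [h.speed_coe ht]
  exact one_div_ne_zero (h.curvature_ne_zero t ht _)

/-- The normal geodesic leaves `closure (Ω t)`. Pulled back by a local inverse of the tube map it
becomes a curve whose norm increases at rate `H > 0`, so its points just after the start belong to
later leaves. -/
lemma exists_outward (hconvex : IsMeanConvex (X 0) (ν 0)) {t b : ℝ} (ht : t ∈ timeInterval T)
    (htb : t < b) : ∃ x : Euc m, 1 + t < ‖x‖ ∧ ‖x‖ < 1 + b ∧
      tubeMap X x ∉ closure (ofSpatial ⁻¹' Ω t) := by
  obtain ⟨θ⟩ := (inferInstance : Nonempty (Sph m))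
  have ht1 : 0 < 1 + t := by linarith [ht.1]
  set x₀ : Euc m := (1 + t) • (θ : Euc m) with hx₀
  have hn : ‖x₀‖ = 1 + t := by
    rw [hx₀, norm_smul, θ.norm_coe, Real.norm_eq_abs, abs_of_pos ht1, mul_one]
  have hx0 : x₀ ≠ 0 := norm_ne_zero_iff.1 (by linarith)
  have hdom : x₀ ∈ tubeDomain m T := ⟨hx0, by rw [hn]; simpa [abs_of_nonneg ht.1] using ht⟩
  have hdet := h.det_tubeDeriv_ne_zero ht hn
  set e := (tubeDeriv T X x₀).toContinuousLinearEquivOfDetNeZero hdet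
  have hs : HasStrictFDerivAt (tubeMap X) (e : Euc m →L[ℝ] Euc m) x₀ :=
    h.hasStrictFDerivAt_tubeMap hdom
  have hmap : tubeMap X x₀ = (X t θ).1.2 := tubeMap_smul ht.1 θ
  set γ := geodesicPoint (X t θ).1 (ν t θ)
  have hγ0 : (γ 0).2 = tubeMap X x₀ := by rw [hmap]; simp [γ, geodesicPoint_zero]
  have hγ : HasDerivAt (fun s => (γ s).2) (ν t θ).2 0 :=
    (hasDerivAt_geodesicPoint _ _).snd
  have hnrm : nrm x₀ = θ := nrm_smul ht1 θ
  have hsp := h.speed_pos hconvex ht θ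
  -- The tube differential sends `θ` to the velocity of the flow, which is the speed times `ν`.
  have hw : e.symm (ν t θ).2 = (speed T X ν (θ, t))⁻¹ • (θ : Euc m) := by
    rw [ContinuousLinearEquiv.symm_apply_eq, map_smul]
    have : e (θ : Euc m) = speed T X ν (θ, t) • (ν t θ).2 := by
      change tubeDeriv T X x₀ θ = _
      rw [h.tubeDeriv_eq hx0 ht hn, hnrm, tilt_apply, real_inner_self_eq_norm_sq, θ.norm_coe,
        smul_apply, (h.isFrame ht θ).radial]
      simp
    rw [this, smul_smul, inv_mul_cancel₀ hsp.ne', one_smul]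
  set y := fun s => hs.localInverse (tubeMap X) e x₀ (γ s).2
  have hy0 : y 0 = x₀ := by
    simp only [y]
    rw [hγ0, hs.localInverse_apply_image]
  have hy : HasDerivAt y ((speed T X ν (θ, t))⁻¹ • (θ : Euc m)) 0 := by
    have h1 := hs.to_localInverse.hasFDerivAt
    rw [← hγ0] at h1
    have h2 := h1.comp_hasDerivAt (0 : ℝ) hγ
    rw [ContinuousLinearEquiv.coe_coe, hw] at h2
    exact h2
  have hyn : HasDerivAt (fun s => ‖y s‖) (speed T X ν (θ, t))⁻¹ 0 := by
    have h1 := (hasStrictFDerivAt_norm hx0).hasFDerivAt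
    rw [← hy0] at h1
    have h2 := h1.comp_hasDerivAt (0 : ℝ) hy
    refine h2.congr_deriv ?_
    rw [hy0, hnrm, innerSL_apply_apply, inner_smul_right, real_inner_self_eq_norm_sq, θ.norm_coe]
    simp
  have ev1 := eventually_lt_of_hasDerivAt_pos hyn (inv_pos.2 hsp)
  have ev2 : ∀ᶠ s in 𝓝[>] (0 : ℝ), ‖y s‖ < 1 + b :=
    (hyn.continuousAt.eventually_lt continuousAt_const (by simp [hy0, hn, htb])).filter_mono
      nhdsWithin_le_nhds
  have ev3 : ∀ᶠ s in 𝓝[>] (0 : ℝ), tubeMap X (y s) = (γ s).2 := by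
    have h1 := hs.eventually_right_inverse
    rw [← hγ0] at h1
    exact (hγ.continuousAt.eventually h1).filter_mono nhdsWithin_le_nhds
  have ev4 : ∀ᶠ s in 𝓝[>] (0 : ℝ), 0 < (γ s).1 :=
    ((hasDerivAt_geodesicPoint _ _).continuousAt.fst.eventually (lt_mem_nhds (by
      simp only [geodesicPoint_zero]; exact (X t θ).2.2))).filter_mono nhdsWithin_le_nhds
  have ev5 := (h.normal t ht).outward θ
  obtain ⟨s, h1, h2, h3, h4, h5⟩ := (ev1.and (ev2.and (ev3.and (ev4.and ev5)))).exists
  refine ⟨y s, ?_, h2, fun hcl => h5 ?_⟩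
  · rwa [hy0, hn] at h1
  · have e1 : ofSpatial ⁻¹' closure (Ω t) = closure (ofSpatial ⁻¹' Ω t) :=
      (spatialHomeo m).symm.preimage_closure (Ω t)
    rw [h3, ← e1] at hcl
    have hfr := h.isFrame ht θ
    have hmem : lorentz (γ s) (γ s) = -1 ∧ 0 < (γ s).1 :=
      ⟨lorentz_geodesicPoint hfr.hyp hfr.normal_unit hfr.normal_tangent s, h4⟩
    refine ⟨⟨γ s, hmem⟩, ?_, rfl⟩
    rw [← ofSpatial_spatial ⟨γ s, hmem⟩]
    exact hcl

/-- Near each time, the hypersurfaces foliate a tube. -/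
lemma exists_isFoliation (hconvex : IsMeanConvex (X 0) (ν 0)) {τ : ℝ} (hτ : τ ∈ timeInterval T) :
    ∃ a b, a < τ ∧ τ < b ∧ -1 < a ∧ (∀ x : Euc m, 1 + a < ‖x‖ → ‖x‖ < 1 + b → x ∈ tubeDomain m T) ∧
      InjOn (tubeMap X) {x : Euc m | 1 + a < ‖x‖ ∧ ‖x‖ < 1 + b} ∧
      IsFoliation (fun q : Sph m × ℝ => tubeMap X ((1 + q.2) • (q.1 : Euc m))) a b
        (timeInterval T ∩ Ioo a b) (fun t => ofSpatial ⁻¹' Ω t) := by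
  set V : Set (Euc m) := {x ∈ tubeDomain m T | (tubeDeriv T X x).det ≠ 0} with hV
  have hVo : IsOpen V := by
    have hc : ContinuousOn (fun x => (tubeDeriv T X x).det) (tubeDomain m T) :=
      ContinuousLinearMap.continuous_det.comp_continuousOn h.continuousOn_tubeDeriv
    exact hc.isOpen_inter_preimage isOpen_tubeDomain isOpen_ne
  have hc1 : 0 < 1 + τ := by linarith [hτ.1]
  have hsphere : ∀ x ∈ Metric.sphere (0 : Euc m) (1 + τ), x ∈ V := by
    intro x hx
    have hn : ‖x‖ = 1 + τ := by simpa using hx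
    refine ⟨⟨norm_ne_zero_iff.1 (by linarith), ?_⟩, h.det_tubeDeriv_ne_zero hτ hn⟩
    rw [hn]; simpa [abs_of_nonneg hτ.1] using hτ
  have hstrict : ∀ x (hx : x ∈ V), HasStrictFDerivAt (tubeMap X)
      ((tubeDeriv T X x).toContinuousLinearEquivOfDetNeZero hx.2 : Euc m →L[ℝ] Euc m) x :=
    fun x hx => h.hasStrictFDerivAt_tubeMap hx.1
  have hinj : InjOn (tubeMap X) (Metric.sphere (0 : Euc m) (1 + τ)) := by
    intro x hx y hy hxy
    have hx' : x = (1 + τ) • (nrm x : Euc m) := by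
      rw [← mem_sphere_zero_iff_norm.1 hx, norm_smul_nrm]
    have hy' : y = (1 + τ) • (nrm y : Euc m) := by
      rw [← mem_sphere_zero_iff_norm.1 hy, norm_smul_nrm]
    rw [hx', hy', tubeMap_smul hτ.1, tubeMap_smul hτ.1] at hxy
    have h1 : X τ (nrm x) = X τ (nrm y) := by
      rw [← ofSpatial_spatial (X τ (nrm x)), hxy, ofSpatial_spatial]
    rw [hx', hy', (h.embedding τ hτ).injective h1]
  -- Injectivity on the compact sphere, together with local injectivity at its points, gives
  -- injectivity on a neighbourhood.
  obtain ⟨W, hWo, hSW, hWinj⟩ := hinj.exists_isOpen_superset (isCompact_sphere _ _)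
    (fun x hx => (hstrict x (hsphere x hx)).hasFDerivAt.continuousAt) (fun x hx => by
      set φ := (hstrict x (hsphere x hx)).toOpenPartialHomeomorph (tubeMap X)
      exact ⟨φ.source, φ.open_source.mem_nhds
        (hstrict x (hsphere x hx)).mem_toOpenPartialHomeomorph_source, φ.injOn⟩)
  obtain ⟨δ, hδ, hthick⟩ := (isCompact_sphere (0 : Euc m) (1 + τ)).exists_thickening_subset_open
    (hVo.inter hWo) (fun x hx => ⟨hsphere x hx, hSW hx⟩)
  -- The bound `1 / 2` keeps the inner radius `1 + τ - ε` positive.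
  set ε := min δ (1 / 2)
  have hε : 0 < ε := lt_min hδ (by norm_num)
  have hann : ∀ x : Euc m, 1 + (τ - ε) < ‖x‖ → ‖x‖ < 1 + (τ + ε) → x ∈ V ∩ W := by
    intro x h1 h2
    apply hthick
    rw [Metric.mem_thickening_iff]
    have hx0 : x ≠ 0 := norm_ne_zero_iff.1 (by
      have : ε ≤ 1 / 2 := min_le_right _ _
      linarith [hτ.1])
    refine ⟨(1 + τ) • (nrm x : Euc m), ?_, ?_⟩
    · simp [norm_smul, abs_of_pos hc1]
    · rw [dist_eq_norm]
      nth_rw 1 [← norm_smul_nrm x]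
      rw [← sub_smul, norm_smul, (nrm x).norm_coe, mul_one, Real.norm_eq_abs]
      refine lt_of_lt_of_le (abs_lt.2 ⟨?_, ?_⟩) (min_le_left δ (1 / 2)) <;> linarith
  have ha : -1 < τ - ε := by
    have : ε ≤ 1 / 2 := min_le_right _ _
    linarith [hτ.1]
  have hnorm : ∀ (θ : Sph m) (s : ℝ), -1 < s → ‖(1 + s) • (θ : Euc m)‖ = 1 + s := by
    intro θ s hs
    rw [norm_smul, θ.norm_coe, mul_one, Real.norm_eq_abs, abs_of_pos (by linarith)]
  have himage : ∀ c d, τ - ε ≤ c →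
      (fun q : Sph m × ℝ => tubeMap X ((1 + q.2) • (q.1 : Euc m))) '' (univ ×ˢ Ioo c d) =
      tubeMap X '' {x : Euc m | 1 + c < ‖x‖ ∧ ‖x‖ < 1 + d} := by
    intro c d hc
    ext y
    constructor
    · rintro ⟨⟨θ, s⟩, ⟨-, hs⟩, rfl⟩
      refine ⟨_, ⟨?_, ?_⟩, rfl⟩ <;> rw [hnorm θ s (by linarith [hs.1])] <;> linarith [hs.1, hs.2]
    · rintro ⟨x, ⟨h1, h2⟩, rfl⟩
      refine ⟨(nrm x, ‖x‖ - 1), ⟨trivial, by constructor <;> linarith⟩, ?_⟩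
      simp [norm_smul_nrm]
  have hinjA : InjOn (tubeMap X) {x : Euc m | 1 + (τ - ε) < ‖x‖ ∧ ‖x‖ < 1 + (τ + ε)} :=
    hWinj.mono fun x hx => (hann x hx.1 hx.2).2
  refine ⟨τ - ε, τ + ε, by linarith, by linarith, ha, fun x h1 h2 => (hann x h1 h2).1.1, hinjA, ?_⟩
  constructor
  · have hc : ContinuousOn (tubeMap X) V :=
      fun x hx => (hstrict x hx).hasFDerivAt.continuousAt.continuousWithinAt
    refine hc.comp (by fun_prop) ?_
    rintro ⟨θ, s⟩ ⟨-, hs⟩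
    refine (hann _ ?_ ?_).1 <;> rw [hnorm θ s (by linarith [hs.1])] <;> linarith [hs.1, hs.2]
  · rintro ⟨θ, s⟩ ⟨-, hs⟩ ⟨ξ, u⟩ ⟨-, hu⟩ heq
    simp only at hs hu heq
    have e1 := hnorm θ s (by linarith [hs.1])
    have e2 := hnorm ξ u (by linarith [hu.1])
    have h1 := hinjA (by constructor <;> rw [e1] <;> linarith [hs.1, hs.2])
      (by constructor <;> rw [e2] <;> linarith [hu.1, hu.2]) heq
    have h2 : θ = ξ := by
      rw [← nrm_smul (show 0 < 1 + s by linarith [hs.1]) θ, h1, nrm_smul (by linarith [hu.1])]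
    have h3 : s = u := by rw [h1, e2] at e1; linarith
    rw [h2, h3]
  · intro c d hc hd
    rw [himage c d hc]
    rw [isOpen_iff_mem_nhds]
    rintro _ ⟨x, ⟨h1, h2⟩, rfl⟩
    have hx : x ∈ V := (hann x (by linarith) (by linarith)).1
    rw [← (hstrict x hx).map_nhds_eq_of_equiv]
    refine Filter.image_mem_map (IsOpen.mem_nhds ?_ ⟨h1, h2⟩)
    exact (isOpen_lt continuous_const continuous_norm).inter
      (isOpen_lt continuous_norm continuous_const)
  · exact fun t ht => (h.domain t ht.1).isOpen.preimage continuous_ofSpatial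
  · exact fun t ht => h.isPreconnected_preimage ht.1
  · intro t ht
    rw [h.frontier_preimage ht.1]
    ext y
    constructor
    · rintro ⟨θ, rfl⟩
      exact ⟨(θ, t), ⟨trivial, rfl⟩, tubeMap_smul ht.1.1 θ⟩
    · rintro ⟨⟨θ, s⟩, ⟨-, hs⟩, rfl⟩
      obtain rfl : s = t := hs
      exact ⟨θ, (tubeMap_smul ht.1.1 θ).symm⟩
  · exact inter_subset_right
  · intro t ht
    obtain ⟨x, h1, h2, h3⟩ := h.exists_outward hconvex ht.1 ht.2.2
    refine ⟨tubeMap X x, ?_, h3⟩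
    rw [himage _ _ ht.2.1.le]
    exact ⟨x, ⟨h1, h2⟩, rfl⟩

end IsIMCF

end HypFlow

/-! ### Differentiation of integrals depending on time. -/

namespace HypFlow

open Set MeasureTheory

variable {m : ℕ} {T : EReal}

section ParametricIntegrals

lemma integrable_of_continuous_sph {f : Sph m → ℝ} (hf : Continuous f) :
    Integrable f (sphMeasure m) := by
  rw [← integrableOn_univ]
  exact hf.continuousOn.integrableOn_compact isCompact_univ

lemma continuous_slice {q : Sph m × ℝ → ℝ} (hq : ContinuousOn q (univ ×ˢ timeInterval T)) {t : ℝ}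
    (ht : t ∈ timeInterval T) : Continuous fun θ => q (θ, t) := by
  rw [← continuousOn_univ]
  exact hq.comp (by fun_prop) (fun θ _ => ⟨trivial, ht⟩)

lemma integrable_slab {q : Sph m × ℝ → ℝ} (hq : ContinuousOn q (univ ×ˢ timeInterval T)) {t₀ t₁ : ℝ}
    (h0 : t₀ ∈ timeInterval T) (h1 : t₁ ∈ timeInterval T) :
    Integrable q ((sphMeasure m).prod (volume.restrict (Icc t₀ t₁))) := by
  have hsub : Icc t₀ t₁ ⊆ timeInterval T := (convex_timeInterval T).ordConnected.out h0 h1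
  have h2 : IntegrableOn q (univ ×ˢ Icc t₀ t₁) ((sphMeasure m).prod volume) :=
    (hq.mono (prod_mono le_rfl hsub)).integrableOn_compact (isCompact_univ.prod isCompact_Icc)
  rwa [IntegrableOn, ← Measure.prod_restrict, Measure.restrict_univ] at h2

/-- At `τ = 0` the left endpoint is `τ` itself, which is why that inequality is not strict and
neighbourhoods are relative. -/
lemma exists_Icc_nhdsWithin {a b τ : ℝ} (hτ : τ ∈ timeInterval T) (ha : a < τ) (hb : τ < b) :
    ∃ c d, c ≤ τ ∧ τ < d ∧ Icc c d ⊆ timeInterval T ∩ Ioo a b ∧ Icc c d ∈ 𝓝[timeInterval T] τ := by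
  obtain ⟨δ, hδ, hsub⟩ := exists_Icc_subset_timeInterval hτ
  have h3 : τ < min (τ + δ) ((τ + b) / 2) := lt_min (by linarith) (by linarith)
  refine ⟨max 0 ((a + τ) / 2), min (τ + δ) ((τ + b) / 2), max_le hτ.1 (by linarith),
    h3, fun s hs => ⟨hsub ⟨?_, ?_⟩, ?_, ?_⟩, ?_⟩
  · exact (le_max_left _ _).trans hs.1
  · exact hs.2.trans (min_le_left _ _)
  · have := (le_max_right 0 ((a + τ) / 2)).trans hs.1
    linarith
  · have := hs.2.trans (min_le_right _ _)
    linarith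
  · have h1 : Ioo ((a + τ) / 2) (min (τ + δ) ((τ + b) / 2)) ∈ 𝓝 τ :=
      Ioo_mem_nhds (by linarith) h3
    filter_upwards [mem_nhdsWithin_of_mem_nhds h1, self_mem_nhdsWithin] with s hs hsT
    exact ⟨max_le hsT.1 hs.1.le, hs.2.le⟩

lemma continuousOn_integral_sph {q : Sph m × ℝ → ℝ}
    (hq : ContinuousOn q (univ ×ˢ timeInterval T)) :
    ContinuousOn (fun t => ∫ θ, q (θ, t) ∂(sphMeasure m)) (timeInterval T) := by
  intro τ hτ
  obtain ⟨c, d, hc, hd, hsub, hnhds⟩ := exists_Icc_nhdsWithin hτ (sub_one_lt τ) (lt_add_one τ)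
  obtain ⟨C, hC⟩ := (isCompact_univ.prod isCompact_Icc).exists_bound_of_continuousOn
    (hq.mono (prod_mono (le_refl (univ : Set (Sph m))) fun s (hs : s ∈ Icc c d) => (hsub hs).1))
  refine continuousWithinAt_of_dominated (bound := fun _ => C) ?_ ?_ (integrable_const C) ?_
  · filter_upwards [self_mem_nhdsWithin] with t ht
    exact (continuous_slice hq ht).aestronglyMeasurable
  · filter_upwards [hnhds] with t ht
    exact .of_forall fun θ => hC (θ, t) ⟨trivial, ht⟩
  · exact .of_forall fun θ => hq.comp (by fun_prop) (fun t ht => ⟨trivial, ht⟩) τ hτ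

lemma hasDerivWithinAt_of_sub_eq_integral {M v : ℝ → ℝ} {a b τ : ℝ} (hτ : τ ∈ timeInterval T)
    (hv : ContinuousOn v (timeInterval T)) (ha : a < τ) (hb : τ < b)
    (hM : ∀ t₀ ∈ timeInterval T ∩ Ioo a b, ∀ t₁ ∈ timeInterval T ∩ Ioo a b, t₀ < t₁ →
      M t₁ - M t₀ = ∫ s in t₀..t₁, v s) :
    HasDerivWithinAt M (v τ) (timeInterval T) τ := by
  obtain ⟨c, d, hc, hd, hsub, hnhds⟩ := exists_Icc_nhdsWithin hτ ha hb
  have hcd : c ≤ d := hc.trans hd.le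
  have hτ' : τ ∈ Icc c d := ⟨hc, hd.le⟩
  have hvc : ContinuousOn v (Icc c d) := hv.mono fun s hs => (hsub hs).1
  -- The constant extension beyond the endpoints is continuous on the whole line, so the two-sided
  -- fundamental theorem applies even when `τ` is an endpoint.
  set w : ℝ → ℝ := IccExtend hcd ((Icc c d).domRestrict v)
  have hw : Continuous w := hvc.domRestrict.Icc_extend'
  have hwv : ∀ s ∈ Icc c d, w s = v s := fun s hs => IccExtend_of_mem hcd _ hs
  have hd1 : HasDerivAt (fun t => M τ + ∫ s in τ..t, w s) (v τ) τ := by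
    rw [← hwv τ hτ']
    exact (intervalIntegral.integral_hasDerivAt_right (hw.intervalIntegrable _ _)
      (hw.stronglyMeasurableAtFilter _ _) hw.continuousAt).const_add _
  have heq : ∀ t ∈ Icc c d, M t = M τ + ∫ s in τ..t, w s := by
    intro t ht
    have h1 : ∫ s in τ..t, w s = ∫ s in τ..t, v s := by
      refine intervalIntegral.integral_congr fun s hs => hwv s ?_
      exact (ordConnected_Icc.uIcc_subset hτ' ht) hs
    rw [h1]
    rcases lt_trichotomy τ t with hlt | rfl | hlt
    · rw [← hM τ (hsub hτ') t (hsub ht) hlt]; ring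
    · simp
    · rw [intervalIntegral.integral_symm, ← hM t (hsub ht) τ (hsub hτ') hlt]; ring
  refine hd1.hasDerivWithinAt.congr_of_eventuallyEq ?_ (heq τ hτ')
  filter_upwards [hnhds] with t ht using heq t ht

/-- Each increment is the time integral of the derivative for fixed `θ`; Fubini exchanges the two
integrals. -/
lemma hasDerivWithinAt_integral_sph {f f' : Sph m × ℝ → ℝ}
    (hf : ContinuousOn f (univ ×ˢ timeInterval T)) (hf' : ContinuousOn f' (univ ×ˢ timeInterval T))
    (hd : ∀ θ, ∀ t ∈ timeInterval T,
      HasDerivWithinAt (fun s => f (θ, s)) (f' (θ, t)) (timeInterval T) t)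
    {τ : ℝ} (hτ : τ ∈ timeInterval T) :
    HasDerivWithinAt (fun t => ∫ θ, f (θ, t) ∂(sphMeasure m)) (∫ θ, f' (θ, τ) ∂(sphMeasure m))
      (timeInterval T) τ := by
  refine hasDerivWithinAt_of_sub_eq_integral
    (v := fun t => ∫ θ, f' (θ, t) ∂(sphMeasure m)) hτ
    (continuousOn_integral_sph hf') (sub_one_lt τ) (lt_add_one τ) ?_
  intro t₀ h0 t₁ h1 h01
  have hsub : Icc t₀ t₁ ⊆ timeInterval T := (convex_timeInterval T).ordConnected.out h0.1 h1.1
  rw [← integral_sub (integrable_of_continuous_sph (continuous_slice hf h1.1))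
    (integrable_of_continuous_sph (continuous_slice hf h0.1)),
    intervalIntegral.integral_of_le h01.le, ← integral_Icc_eq_integral_Ioc,
    integral_integral_swap (f := fun t θ => f' (θ, t))
      ((integrable_slab hf' h0.1 h1.1).swap)]
  refine integral_congr_ae (.of_forall fun θ => ?_)
  simp only
  rw [integral_Icc_eq_integral_Ioc, ← intervalIntegral.integral_of_le h01.le]
  have hcθ : ContinuousOn (fun s => f' (θ, s)) (Icc t₀ t₁) :=
    hf'.comp (by fun_prop) (fun s hs => ⟨trivial, hsub hs⟩)
  symm
  apply intervalIntegral.integral_eq_sub_of_hasDerivAt_of_le h01.le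
    (fun s hs => ((hd θ s (hsub hs)).continuousWithinAt.mono hsub))
  · intro s hs
    exact (hd θ s (hsub (Ioo_subset_Icc_self hs))).hasDerivAt
      (Filter.mem_of_superset (Icc_mem_nhds hs.1 hs.2) hsub)
  · exact (hcθ.mono (by rw [uIcc_of_le h01.le])).intervalIntegrable

end ParametricIntegrals

end HypFlow

/-! ### Change of variables in the swept shell. -/

namespace HypFlow

open Set MeasureTheory

variable {m : ℕ} {T : EReal} {X : ℝ → Sph m → Hyp m} {ν : ℝ → Sph m → Mink m}
  {Ω : ℝ → Set (Hyp m)}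

/-- Integration in polar coordinates over an annulus. -/
lemma setLIntegral_annulus {F : Euc m → ENNReal} {t₀ t₁ : ℝ} (ht : -1 < t₀)
    (hF : Measurable ({x : Euc m | 1 + t₀ ≤ ‖x‖ ∧ ‖x‖ < 1 + t₁}.indicator F)) :
    ∫⁻ x in {x : Euc m | 1 + t₀ ≤ ‖x‖ ∧ ‖x‖ < 1 + t₁}, F x =
      ∫⁻ θ : Sph m, ∫⁻ t in Ico t₀ t₁, ENNReal.ofReal ((1 + t) ^ m) * F ((1 + t) • (θ : Euc m))
        ∂volume ∂(sphMeasure m) := by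
  have hA : MeasurableSet {x : Euc m | 1 + t₀ ≤ ‖x‖ ∧ ‖x‖ < 1 + t₁} :=
    (isClosed_le continuous_const continuous_norm).measurableSet.inter
      (isOpen_lt continuous_norm continuous_const).measurableSet
  rw [← lintegral_indicator hA, lintegral_polar hF]
  refine lintegral_congr fun θ => ?_
  have hmp : MeasurePreserving (fun t : ℝ => 1 + t) volume volume :=
    measurePreserving_add_left volume 1
  rw [← hmp.setLIntegral_comp_preimage_emb (measurableEmbedding_addLeft 1),
    ← lintegral_indicator measurableSet_Ico,
    ← lintegral_indicator (measurableSet_Ioi.preimage hmp.measurable)]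
  refine lintegral_congr fun t => ?_
  by_cases h0 : 0 < 1 + t
  · have hn : ‖(1 + t) • (θ : Euc m)‖ = 1 + t := by
      rw [norm_smul, θ.norm_coe, mul_one, Real.norm_eq_abs, abs_of_pos h0]
    rw [indicator_of_mem (show t ∈ (fun t : ℝ => 1 + t) ⁻¹' Ioi 0 from h0)]
    by_cases h1 : t ∈ Ico t₀ t₁
    · rw [indicator_of_mem h1, indicator_of_mem]
      constructor <;> rw [hn] <;> linarith [h1.1, h1.2]
    · rw [indicator_of_notMem h1, indicator_of_notMem, mul_zero]
      rintro ⟨h2, h3⟩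
      rw [hn] at h2 h3
      exact h1 ⟨by linarith, by linarith⟩
  · rw [indicator_of_notMem (show t ∉ (fun t : ℝ => 1 + t) ⁻¹' Ioi 0 from h0),
      indicator_of_notMem]
    intro h1
    exact h0 (by linarith [h1.1])

lemma measurable_indicator_of_continuousOn {α β : Type*} [TopologicalSpace α] [MeasurableSpace α]
    [OpensMeasurableSpace α] [TopologicalSpace β] [MeasurableSpace β] [BorelSpace β] [Zero β]
    {f : α → β} {A : Set α} (hA : MeasurableSet A) (hf : ContinuousOn f A) :
    Measurable (A.indicator f) := by
  classical
  rw [← piecewise_eq_indicator]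
  exact hf.measurable_piecewise continuousOn_const hA

namespace IsIMCF

variable (h : IsIMCF T X ν Ω)

include h

/-- The polar weight `(1 + t) ^ m` cancels the scaling of the lift's derivative on the sphere of
radius `1 + t`. What remains is speed times area element, up to the time component, which the volume
density will cancel. -/
lemma abs_det_tubeDeriv {θ : Sph m} {t : ℝ} (ht : t ∈ timeInterval T)
    (hs : 0 < speed T X ν (θ, t)) :
    (1 + t) ^ m * |(tubeDeriv T X ((1 + t) • (θ : Euc m))).det| =
      (X t θ).1.1 * (speed T X ν (θ, t) * areaDensity (X t) θ) := by
  have h0 : 0 < 1 + t := by linarith [ht.1]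
  have hn : ‖(1 + t) • (θ : Euc m)‖ = 1 + t := by
    rw [norm_smul, θ.norm_coe, mul_one, Real.norm_eq_abs, abs_of_pos h0]
  have hX := (X t θ).2.2
  rw [h.det_tubeDeriv (norm_ne_zero_iff.1 (by linarith)) ht hn, nrm_smul h0, hn,
    h.areaDensity_eq ht, abs_mul, abs_mul, abs_of_pos hs,
    abs_of_pos (by positivity : 0 < (1 + t)⁻¹ ^ m), inv_pow]
  field_simp

/-- The tube map is injective on the annulus, its image is the shell between the two domains, and
its Jacobian in polar coordinates is speed times area element. The restriction to `(a, b)` comes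
from the foliation being local in time. -/
lemma exists_lintegral_domain (hm : 1 ≤ m) (hconvex : IsMeanConvex (X 0) (ν 0)) {τ : ℝ}
    (hτ : τ ∈ timeInterval T) : ∃ a b, a < τ ∧ τ < b ∧ ∀ t₀ ∈ timeInterval T ∩ Ioo a b,
      ∀ t₁ ∈ timeInterval T ∩ Ioo a b, t₀ < t₁ → closure (Ω t₀) ⊆ Ω t₁ ∧
        ∀ f : Hyp m → ENNReal, Measurable f →
          ∫⁻ p in Ω t₁, f p ∂(hypVol m) = ∫⁻ p in Ω t₀, f p ∂(hypVol m) +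
            ∫⁻ θ, ∫⁻ s in Ico t₀ t₁, f (X s θ) *
              ENNReal.ofReal (speed T X ν (θ, s) * areaDensity (X s) θ) ∂volume ∂(sphMeasure m) := by
  obtain ⟨a, b, ha, hb, ha1, hdom, hinj, hfol⟩ := h.exists_isFoliation hconvex hτ
  refine ⟨a, b, ha, hb, fun t₀ h0 t₁ h1 h01 => ?_⟩
  have := preconnectedSpace_sph hm
  have hI : ∀ s ∈ Ico t₀ t₁, s ∈ timeInterval T := fun s hs =>
    (convex_timeInterval T).ordConnected.out h0.1 h1.1 (Ico_subset_Icc_self hs)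
  constructor
  · have h2 := hfol.closure_subset h0 h1 h01
    have e1 : ofSpatial ⁻¹' closure (Ω t₀) = closure (ofSpatial ⁻¹' Ω t₀) :=
      (spatialHomeo m).symm.preimage_closure (Ω t₀)
    rw [← e1] at h2
    intro p hp
    have := h2 (show p.1.2 ∈ ofSpatial ⁻¹' closure (Ω t₀) by
      rw [mem_preimage, ofSpatial_spatial]; exact hp)
    rwa [mem_preimage, ofSpatial_spatial] at this
  intro f hf
  set A : Set (Euc m) := {x : Euc m | 1 + t₀ ≤ ‖x‖ ∧ ‖x‖ < 1 + t₁} with hA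
  have hAm : MeasurableSet A :=
    (isClosed_le continuous_const continuous_norm).measurableSet.inter
      (isOpen_lt continuous_norm continuous_const).measurableSet
  have hAsub : A ⊆ {x : Euc m | 1 + a < ‖x‖ ∧ ‖x‖ < 1 + b} := fun x hx =>
    ⟨by linarith [hx.1, h0.2.1], by linarith [hx.2, h1.2.2]⟩
  have hAdom : A ⊆ tubeDomain m T := fun x hx => hdom x (hAsub hx).1 (hAsub hx).2
  have himage : (fun q : Sph m × ℝ => tubeMap X ((1 + q.2) • (q.1 : Euc m))) ''
      (univ ×ˢ Ico t₀ t₁) = tubeMap X '' A := by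
    ext y
    constructor
    · rintro ⟨⟨θ, s⟩, ⟨-, hs⟩, rfl⟩
      have hn : ‖(1 + s) • (θ : Euc m)‖ = 1 + s := by
        rw [norm_smul, θ.norm_coe, mul_one, Real.norm_eq_abs,
          abs_of_pos (by linarith [hs.1, h0.1.1])]
      refine ⟨_, ⟨?_, ?_⟩, rfl⟩ <;> rw [hn] <;> linarith [hs.1, hs.2]
    · rintro ⟨x, ⟨h1, h2⟩, rfl⟩
      refine ⟨(nrm x, ‖x‖ - 1), ⟨trivial, by constructor <;> linarith⟩, ?_⟩
      simp [norm_smul_nrm]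
  have hm0 : MeasurableSet (Ω t₀) := (h.domain t₀ h0.1).isOpen.measurableSet
  have hm1 : MeasurableSet (Ω t₁) := (h.domain t₁ h1.1).isOpen.measurableSet
  have hunion := hfol.eq_union h0 h1 h01
  have hdisj := hfol.disjoint_image h0 h1
  rw [himage] at hunion hdisj
  have hd : ∀ x ∈ A, HasFDerivWithinAt (tubeMap X) (tubeDeriv T X x) A x := fun x hx =>
    (h.hasStrictFDerivAt_tubeMap (hAdom hx)).hasFDerivAt.hasFDerivWithinAt
  have hinjA : InjOn (tubeMap X) A := hinj.mono hAsub
  have himm : MeasurableSet (tubeMap X '' A) := measurable_image_of_fderivWithin hAm hd hinjA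
  rw [setLIntegral_hypVol hf hm1, setLIntegral_hypVol hf hm0, hunion,
    lintegral_union himm hdisj, lintegral_image_eq_lintegral_abs_det_fderiv_mul volume hAm hd hinjA]
  congr 1
  have htube : ContinuousOn (tubeMap X) A := fun x hx => (hd x hx).continuousWithinAt
  -- The tube map and its derivative are only controlled on `A`, so each is first replaced by its
  -- indicator.
  have hmeas : Measurable (A.indicator fun x => ENNReal.ofReal |(tubeDeriv T X x).det| *
      (volDensity (tubeMap X x) * f (ofSpatial (tubeMap X x)))) := by
    have m1 : Measurable (A.indicator fun x => |(tubeDeriv T X x).det|) :=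
      measurable_indicator_of_continuousOn hAm
        (ContinuousLinearMap.continuous_det.comp_continuousOn
          (h.continuousOn_tubeDeriv.mono hAdom)).abs
    have m2 : Measurable (A.indicator (tubeMap X)) := measurable_indicator_of_continuousOn hAm htube
    have m3 : Measurable fun x => ENNReal.ofReal (A.indicator (fun x => |(tubeDeriv T X x).det|) x) *
        (volDensity (A.indicator (tubeMap X) x) * f (ofSpatial (A.indicator (tubeMap X) x))) :=
      m1.ennreal_ofReal.mul ((measurable_volDensity.comp m2).mul
        (hf.comp (continuous_ofSpatial.measurable.comp m2)))
    convert m3.indicator hAm using 1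
    ext x
    by_cases hx : x ∈ A
    · simp [indicator_of_mem hx]
    · simp [indicator_of_notMem hx]
  rw [setLIntegral_annulus (by linarith [h0.1.1]) hmeas]
  refine lintegral_congr fun θ => setLIntegral_congr_fun measurableSet_Ico fun s hs => ?_
  have hs' := hI s hs
  have hsp := h.speed_pos hconvex hs' θ
  have hX := (X s θ).2.2
  rw [tubeMap_smul hs'.1, ofSpatial_spatial, volDensity, ← (X s θ).time_eq, ← mul_assoc, ← mul_assoc,
    ← ENNReal.ofReal_mul (pow_nonneg (by linarith [hs'.1]) m), h.abs_det_tubeDeriv hs' hsp, mul_comm,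
    mul_comm (ENNReal.ofReal _) (ENNReal.ofReal _), ← ENNReal.ofReal_mul (by positivity)]
  congr 2
  field_simp

end IsIMCF

end HypFlow

/-! ### The radius function, finiteness of volume, and the origin inside the domains. -/

namespace HypFlow

open Set MeasureTheory

variable {m : ℕ} {T : EReal} {X : ℝ → Sph m → Hyp m} {ν : ℝ → Sph m → Mink m}
  {Ω : ℝ → Set (Hyp m)}

section Radius

lemma continuous_radius : Continuous (radius : Hyp m → ℝ) := by
  unfold radius
  exact Real.continuous_arsinh.comp (by fun_prop)

lemma radius_nonneg (p : Hyp m) : 0 ≤ radius p := Real.arsinh_nonneg_iff.2 (norm_nonneg _)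

lemma radius_pos_iff {p : Hyp m} : 0 < radius p ↔ p.1.2 ≠ 0 := by
  rw [radius, Real.arsinh_pos_iff, norm_pos_iff]

lemma sinh_radius (p : Hyp m) : Real.sinh (radius p) = ‖p.1.2‖ := Real.sinh_arsinh _

lemma cosh_radius (p : Hyp m) : Real.cosh (radius p) = p.1.1 := by
  rw [p.time_eq, radius, Real.cosh_arsinh]

lemma radius_ofSpatial (x : Euc m) : radius (ofSpatial x) = Real.arsinh ‖x‖ := rfl

lemma radius_polar {r : ℝ} (hr : 0 ≤ r) (θ : Sph m) : radius (polar r θ) = r := by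
  have : ‖Real.sinh r • (θ : Euc m)‖ = Real.sinh r := by
    rw [norm_smul, θ.norm_coe, mul_one, Real.norm_eq_abs, abs_of_nonneg (Real.sinh_nonneg_iff.2 hr)]
  rw [radius, polar]
  simp only
  rw [this, Real.arsinh_sinh]

lemma continuous_ballProfile (m : ℕ) : Continuous (ballProfile m) :=
  continuous_iff_continuousAt.2 fun r => (hasDerivAt_ballProfile m r).continuousAt

lemma measurable_g (m : ℕ) : Measurable (g m) := by
  have e : g m = fun r => ballProfile m r / Real.sinh r ^ m := funext (g_eq m)
  rw [e]
  exact (continuous_ballProfile m).measurable.div (by fun_prop)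

lemma measurable_weight (m : ℕ) : Measurable (weight m) := by
  unfold weight
  exact (Measurable.mul (by fun_prop) (measurable_g m)).div (by fun_prop)

lemma weight_zero (m : ℕ) : weight m 0 = 0 := by simp [weight]

lemma weight_nonneg (m : ℕ) {r : ℝ} (hr : 0 ≤ r) : 0 ≤ weight m r := by
  rcases hr.eq_or_lt with rfl | hr
  · exact (weight_zero m).ge
  · exact (weight_pos m hr).le

lemma weight_le_one' (m : ℕ) (hm : 1 ≤ m) {r : ℝ} (hr : 0 ≤ r) : weight m r ≤ 1 := by
  rcases hr.eq_or_lt with rfl | hr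
  · rw [weight_zero]; exact zero_le_one
  · exact weight_le_one m hm hr

end Radius

section FiniteVolume

lemma hypVol_lt_top_of_isCompact {K : Set (Hyp m)} (hK : IsCompact K) : hypVol m K < ⊤ := by
  have hc : IsCompact (ofSpatial ⁻¹' K) := (spatialHomeo m).symm.isCompact_preimage.2 hK
  have h1 := setLIntegral_hypVol (f := fun _ => 1) measurable_const hK.measurableSet
  rw [setLIntegral_one] at h1
  rw [h1]
  refine lt_of_le_of_lt (setLIntegral_mono measurable_const (g := fun _ => 1) fun x _ => ?_) ?_
  · rw [mul_one, volDensity, ENNReal.ofReal_le_one]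
    rw [div_le_one (Real.sqrt_pos.2 (by positivity)), Real.one_le_sqrt]
    linarith [sq_nonneg ‖x‖]
  · rw [setLIntegral_one]
    exact hc.measure_lt_top

lemma IsBoundedDomain.hypVol_lt_top {U S : Set (Hyp m)} (hU : IsBoundedDomain U S) :
    hypVol m U < ⊤ :=
  (measure_mono subset_closure).trans_lt (hypVol_lt_top_of_isCompact hU.bounded)

end FiniteVolume

namespace IsIMCF

variable (h : IsIMCF T X ν Ω)

include h

lemma continuousOn_pos :
    ContinuousOn (fun q : Sph m × ℝ => (X q.2 q.1).1) (univ ×ˢ timeInterval T) := by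
  have h1 : ContinuousOn (fun q : Sph m × ℝ => posLift X ((q.1 : Euc m), q.2))
      (univ ×ˢ timeInterval T) :=
    h.contDiffOn_pos.continuousOn.comp (by fun_prop) (fun q hq => ⟨q.1.coe_ne_zero, hq.2⟩)
  simpa [posLift, lift, nrm_coe, toMink] using h1

lemma continuousOn_nor :
    ContinuousOn (fun q : Sph m × ℝ => ν q.2 q.1) (univ ×ˢ timeInterval T) := by
  have h1 : ContinuousOn (fun q : Sph m × ℝ => lift ν ((q.1 : Euc m), q.2))
      (univ ×ˢ timeInterval T) :=
    h.contDiffOn_nor.continuousOn.comp (by fun_prop) (fun q hq => ⟨q.1.coe_ne_zero, hq.2⟩)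
  simpa [lift, nrm_coe] using h1

lemma continuousOn_speed_sph :
    ContinuousOn (fun q : Sph m × ℝ => speed T X ν ((q.1 : Euc m), q.2))
      (univ ×ˢ timeInterval T) :=
  h.contDiffOn_speed.continuousOn.comp (by fun_prop) (fun q hq => ⟨q.1.coe_ne_zero, hq.2⟩)

lemma continuousOn_areaDensity :
    ContinuousOn (fun q : Sph m × ℝ => areaDensity (X q.2) q.1) (univ ×ˢ timeInterval T) := by
  have hL : ContinuousOn (fun q : Sph m × ℝ => spaceDeriv T (posLift X) ((q.1 : Euc m), q.2))
      (univ ×ˢ timeInterval T) :=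
    (continuousOn_spaceDeriv h.contDiffOn_pos).comp (by fun_prop)
      (fun q hq => ⟨q.1.coe_ne_zero, hq.2⟩)
  have ht : ContinuousOn (fun q : Sph m × ℝ => tilt (spaceDeriv T (posLift X) ((q.1 : Euc m), q.2))
      q.1 (ν q.2 q.1).2) (univ ×ˢ timeInterval T) := by
    unfold tilt
    refine (continuousOn_const.clm_comp hL).add ?_
    have h1 : Continuous fun q : Sph m × ℝ =>
        ContinuousLinearMap.smulRightL ℝ (Euc m) (Euc m) (innerSL ℝ (q.1 : Euc m)) := by
      fun_prop
    exact h1.continuousOn.clm_apply h.continuousOn_nor.snd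
  have hd := ContinuousLinearMap.continuous_det.comp_continuousOn ht
  refine (hd.abs.div h.continuousOn_pos.fst fun q _ => (X q.2 q.1).2.2.ne').congr ?_
  intro q hq
  exact h.areaDensity_eq hq.2 q.1

lemma areaDensity_pos {t : ℝ} (ht : t ∈ timeInterval T) (θ : Sph m) : 0 < areaDensity (X t) θ := by
  rw [h.areaDensity_eq ht]
  exact div_pos (abs_pos.2 (h.isFrame ht θ).det_tilt_ne_zero) (X t θ).2.2

/-- A ray from the origin meets a radial graph exactly once. For a point of `Ω 0` before the
intersection, the segment back to the origin avoids the boundary; for a point after it, the rest of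
the ray would stay in the bounded set `Ω 0`. -/
lemma origin_mem_zero (hstar : IsStarShaped (range (X 0))) (h0 : (0 : ℝ) ∈ timeInterval T) :
    (0 : Euc m) ∈ ofSpatial ⁻¹' Ω 0 := by
  obtain ⟨ρ, -, hρ, hS⟩ := hstar
  set U : Set (Euc m) := ofSpatial ⁻¹' Ω 0
  have hUo : IsOpen U := (h.domain 0 h0).isOpen.preimage continuous_ofSpatial
  have hfr : frontier U = range fun θ => Real.sinh (ρ θ) • (θ : Euc m) := by
    rw [h.frontier_preimage h0]
    ext x
    constructor
    · rintro ⟨θ, rfl⟩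
      have : X 0 θ ∈ range (X 0) := ⟨θ, rfl⟩
      rw [hS] at this
      obtain ⟨ξ, hξ⟩ := this
      exact ⟨ξ, by simp only; rw [← hξ]; rfl⟩
    · rintro ⟨θ, rfl⟩
      have : polar (ρ θ) θ ∈ range (X 0) := by rw [hS]; exact ⟨θ, rfl⟩
      obtain ⟨ξ, hξ⟩ := this
      exact ⟨ξ, by simp only; rw [hξ]; rfl⟩
  have hray : ∀ (θ : Sph m) (s : ℝ), 0 ≤ s → s • (θ : Euc m) ∈ frontier U → s = Real.sinh (ρ θ) := by
    intro θ s hs hmem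
    rw [hfr] at hmem
    obtain ⟨ξ, hξ⟩ := hmem
    have hpos := Real.sinh_pos_iff.2 (hρ ξ)
    have h1 : s = Real.sinh (ρ ξ) := by
      have := congrArg norm hξ
      simp only [norm_smul, Sph.norm_coe, mul_one, Real.norm_eq_abs, abs_of_pos hpos,
        abs_of_nonneg hs] at this
      exact this.symm
    have h2 : θ = ξ := by
      rw [← nrm_smul (h1 ▸ hpos : 0 < s) θ, ← hξ, nrm_smul hpos]
    rw [h1, h2]
  obtain ⟨p, hp⟩ := (h.domain 0 h0).connected.nonempty
  set x : Euc m := p.1.2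
  have hx : x ∈ U := by rw [mem_preimage, ofSpatial_spatial]; exact hp
  set θ := nrm x
  have hxθ : ‖x‖ • (θ : Euc m) = x := norm_smul_nrm x
  have hseg : ∀ J : Set ℝ, IsPreconnected J → (∀ s ∈ J, 0 ≤ s ∧ s ≠ Real.sinh (ρ θ)) → ‖x‖ ∈ J →
      ∀ s ∈ J, s • (θ : Euc m) ∈ U := by
    intro J hJ hJ2 hxJ s hs
    have hpre : IsPreconnected ((fun s : ℝ => s • (θ : Euc m)) '' J) :=
      hJ.image _ (by fun_prop)
    rcases subset_or_subset_compl_closure hpre hUo (by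
      rw [disjoint_left]
      rintro _ ⟨s, hs, rfl⟩ hfs
      exact (hJ2 s hs).2 (hray θ s (hJ2 s hs).1 hfs)) with hsub | hsub
    · exact hsub ⟨s, hs, rfl⟩
    · exact absurd (subset_closure hx) (hsub ⟨‖x‖, hxJ, hxθ⟩)
  rcases lt_trichotomy ‖x‖ (Real.sinh (ρ θ)) with hlt | heq | hgt
  · have := hseg (Icc 0 ‖x‖) isPreconnected_Icc
      (fun s hs => ⟨hs.1, (hs.2.trans_lt hlt).ne⟩) ⟨norm_nonneg x, le_rfl⟩ 0 ⟨le_rfl, norm_nonneg x⟩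
    simpa using this
  · exfalso
    have : x ∈ frontier U := by rw [hfr]; exact ⟨θ, by simp only; rw [← heq, hxθ]⟩
    rw [hUo.frontier_eq] at this
    exact this.2 hx
  · exfalso
    have hb : Bornology.IsBounded U := by
      have hc : IsCompact (ofSpatial ⁻¹' closure (Ω 0)) :=
        (spatialHomeo m).symm.isCompact_preimage.2 (h.domain 0 h0).bounded
      exact hc.isBounded.subset (preimage_mono subset_closure)
    obtain ⟨C, hC⟩ := hb.exists_norm_le
    have h1 := hC _ (hseg (Ici ‖x‖) isPreconnected_Ici
      (fun s hs => ⟨(norm_nonneg x).trans hs, (hgt.trans_le hs).ne'⟩) (mem_Ici.2 le_rfl)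
      (max ‖x‖ (C + 1)) (mem_Ici.2 (le_max_left _ _)))
    rw [norm_smul, θ.norm_coe, mul_one, Real.norm_eq_abs] at h1
    have h2 := le_max_right ‖x‖ (C + 1)
    linarith [le_abs_self (max ‖x‖ (C + 1))]

/-- The domains increase near every time. At the infimum of the bad times, a good time slightly
before (or time `0`) would pass the origin on to a bad time slightly after. -/
lemma origin_mem (hm : 1 ≤ m) (hconvex : IsMeanConvex (X 0) (ν 0))
    (hstar : IsStarShaped (range (X 0))) {t : ℝ} (ht : t ∈ timeInterval T) :
    ofSpatial (0 : Euc m) ∈ Ω t := by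
  by_contra hcon
  have h0 := zero_mem_timeInterval ht
  set B : Set ℝ := {s | s ∈ Icc 0 t ∧ ofSpatial (0 : Euc m) ∉ Ω s}
  have hB : t ∈ B := ⟨⟨ht.1, le_rfl⟩, hcon⟩
  have hbdd : BddBelow B := ⟨0, fun s hs => hs.1.1⟩
  set τ := sInf B
  have hτ0 : 0 ≤ τ := le_csInf ⟨t, hB⟩ fun s hs => hs.1.1
  have hτt : τ ≤ t := csInf_le hbdd hB
  have hsub : Icc 0 t ⊆ timeInterval T := (convex_timeInterval T).ordConnected.out h0 ht
  have hτ : τ ∈ timeInterval T := hsub ⟨hτ0, hτt⟩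
  obtain ⟨a, b, ha, hb, hab⟩ := h.exists_lintegral_domain hm hconvex hτ
  obtain ⟨s₀, hs0, hs0a, hs0τ, hs0m⟩ : ∃ s₀, 0 ≤ s₀ ∧ a < s₀ ∧ s₀ ≤ τ ∧
      ofSpatial (0 : Euc m) ∈ Ω s₀ := by
    rcases hτ0.eq_or_lt with h1 | h1
    · exact ⟨0, le_rfl, by linarith, by linarith, h.origin_mem_zero hstar h0⟩
    · obtain ⟨s, hs1, hs2⟩ := exists_between (max_lt h1 ha)
      have hs3 := (le_max_left 0 a).trans hs1.le
      refine ⟨s, hs3, (le_max_right 0 a).trans_lt hs1, hs2.le, ?_⟩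
      by_contra hns
      exact absurd (csInf_le hbdd (show s ∈ B from ⟨⟨hs3, hs2.le.trans hτt⟩, hns⟩)) (not_le.2 hs2)
  obtain ⟨s₁, hs1B, hs1b⟩ := exists_lt_of_csInf_lt ⟨t, hB⟩ hb
  have hs1τ : τ ≤ s₁ := csInf_le hbdd hs1B
  apply hs1B.2
  rcases (hs0τ.trans hs1τ).eq_or_lt with heq | hlt
  · rw [← heq]; exact hs0m
  · exact (hab s₀ ⟨hsub ⟨hs0, hs0τ.trans hτt⟩, hs0a, by linarith⟩ s₁
      ⟨hsub hs1B.1, by linarith, hs1b⟩ hlt).1 (subset_closure hs0m)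

/-- Keeps the hypersurfaces in the region where the radius is differentiable along the flow and the
regularity of `g` and `weight` is available. -/
lemma radius_pos (hm : 1 ≤ m) (hconvex : IsMeanConvex (X 0) (ν 0))
    (hstar : IsStarShaped (range (X 0))) {t : ℝ} (ht : t ∈ timeInterval T) (θ : Sph m) :
    0 < radius (X t θ) := by
  rw [radius_pos_iff]
  intro h0
  have h1 := h.origin_mem hm hconvex hstar ht
  rw [← h0, ofSpatial_spatial] at h1
  have h2 : X t θ ∈ frontier (Ω t) := by rw [(h.domain t ht).boundary]; exact ⟨θ, rfl⟩
  rw [(h.domain t ht).isOpen.frontier_eq] at h2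
  exact h2.2 h1

end IsIMCF

end HypFlow

/-! ### First variation of volume, weighted volume, area and `∫ g dμ`. -/

namespace HypFlow

open Set MeasureTheory

variable {m : ℕ} {T : EReal} {X : ℝ → Sph m → Hyp m} {ν : ℝ → Sph m → Mink m}
  {Ω : ℝ → Set (Hyp m)}

instance (m : ℕ) : (sphMeasure m).IsOpenPosMeasure := by
  unfold sphMeasure; infer_instance

lemma integral_sph_pos {f : Sph m → ℝ} (hf : Continuous f) (h0 : ∀ θ, 0 ≤ f θ) (θ : Sph m)
    (hθ : 0 < f θ) : 0 < ∫ θ, f θ ∂(sphMeasure m) :=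
  hf.integral_pos_of_hasCompactSupport_nonneg_nonzero (HasCompactSupport.of_compactSpace f) h0
    hθ.ne'

namespace IsIMCF

variable (h : IsIMCF T X ν Ω)

include h

lemma continuousOn_radius :
    ContinuousOn (fun q : Sph m × ℝ => radius (X q.2 q.1)) (univ ×ˢ timeInterval T) :=
  Real.continuous_arsinh.comp_continuousOn h.continuousOn_pos.snd.norm

lemma continuousOn_comp_radius (hm : 1 ≤ m) (hconvex : IsMeanConvex (X 0) (ν 0))
    (hstar : IsStarShaped (range (X 0))) {f : ℝ → ℝ} (hf : ContinuousOn f (Ioi 0)) :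
    ContinuousOn (fun q : Sph m × ℝ => f (radius (X q.2 q.1))) (univ ×ˢ timeInterval T) :=
  hf.comp h.continuousOn_radius fun _ hq => h.radius_pos hm hconvex hstar hq.2 _

/-- Applied to the constant `1` and to `weight`. The bounds `0 ≤ f ≤ 1` are there to pass between
lower integrals and finite real ones. -/
lemma hasDerivWithinAt_integral_domain (hm : 1 ≤ m) (hconvex : IsMeanConvex (X 0) (ν 0))
    (hstar : IsStarShaped (range (X 0))) {f : ℝ → ℝ} (hf : Measurable f)
    (hfc : ContinuousOn f (Ioi 0)) (hf0 : ∀ r, 0 ≤ r → 0 ≤ f r) (hf1 : ∀ r, 0 ≤ r → f r ≤ 1)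
    {τ : ℝ} (hτ : τ ∈ timeInterval T) :
    HasDerivWithinAt (fun t => ∫ p in Ω t, f (radius p) ∂(hypVol m))
      (∫ θ, f (radius (X τ θ)) * (speed T X ν (θ, τ) * areaDensity (X τ) θ) ∂(sphMeasure m))
      (timeInterval T) τ := by
  obtain ⟨a, b, ha, hb, hab⟩ := h.exists_lintegral_domain hm hconvex hτ
  have hmeas : Measurable fun p : Hyp m => f (radius p) := hf.comp continuous_radius.measurable
  set q : Sph m × ℝ → ℝ := fun q => f (radius (X q.2 q.1)) *
    (speed T X ν ((q.1 : Euc m), q.2) * areaDensity (X q.2) q.1) with hq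
  have hqc : ContinuousOn q (univ ×ˢ timeInterval T) :=
    (h.continuousOn_comp_radius hm hconvex hstar hfc).mul
      (h.continuousOn_speed_sph.mul h.continuousOn_areaDensity)
  have hq0 : ∀ θ, ∀ s ∈ timeInterval T, 0 ≤ q (θ, s) := fun θ s hs =>
    mul_nonneg (hf0 _ (radius_nonneg _))
      (mul_nonneg (h.speed_pos hconvex hs θ).le (h.areaDensity_pos hs θ).le)
  refine hasDerivWithinAt_of_sub_eq_integral (v := fun t => ∫ θ, q (θ, t) ∂(sphMeasure m)) hτ
    (continuousOn_integral_sph hqc) ha hb ?_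
  intro t₀ h0 t₁ h1 h01
  have hsub : Icc t₀ t₁ ⊆ timeInterval T := (convex_timeInterval T).ordConnected.out h0.1 h1.1
  have key := (hab t₀ h0 t₁ h1 h01).2 (fun p => ENNReal.ofReal (f (radius p)))
    hmeas.ennreal_ofReal
  have hM : ∀ t, ∫ p in Ω t, f (radius p) ∂(hypVol m)
      = (∫⁻ p in Ω t, ENNReal.ofReal (f (radius p)) ∂(hypVol m)).toReal := fun t =>
    integral_eq_lintegral_of_nonneg_ae (.of_forall fun p => hf0 _ (radius_nonneg p))
      hmeas.aestronglyMeasurable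
  have hfin : ∀ t ∈ timeInterval T,
      ∫⁻ p in Ω t, ENNReal.ofReal (f (radius p)) ∂(hypVol m) ≠ ⊤ := by
    intro t ht
    refine ((lintegral_mono (g := fun _ => 1) fun p => ?_).trans_lt ?_).ne
    · exact ENNReal.ofReal_le_one.2 (hf1 _ (radius_nonneg p))
    · rw [setLIntegral_one]; exact (h.domain t ht).hypVol_lt_top
  have hint := integrable_slab hqc h0.1 h1.1
  have hD : ∫⁻ θ, ∫⁻ s in Ico t₀ t₁, ENNReal.ofReal (f (radius (X s θ))) *
      ENNReal.ofReal (speed T X ν (θ, s) * areaDensity (X s) θ) ∂volume ∂(sphMeasure m)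
      = ENNReal.ofReal (∫ θ, ∫ s in Icc t₀ t₁, q (θ, s) ∂volume ∂(sphMeasure m)) := by
    rw [ofReal_integral_eq_lintegral_ofReal hint.integral_prod_left
      (.of_forall fun θ => setIntegral_nonneg measurableSet_Icc fun s hs => hq0 θ s (hsub hs))]
    refine lintegral_congr fun θ => ?_
    have hcθ : ContinuousOn (fun s => q (θ, s)) (Icc t₀ t₁) :=
      hqc.comp (by fun_prop) (fun s hs => ⟨trivial, hsub hs⟩)
    rw [ofReal_integral_eq_lintegral_ofReal (hcθ.integrableOn_compact isCompact_Icc)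
      ((ae_restrict_iff' measurableSet_Icc).2 (.of_forall fun s hs => hq0 θ s (hsub hs))),
      setLIntegral_congr (Ico_ae_eq_Icc (a := t₀) (b := t₁))]
    refine lintegral_congr fun s => ?_
    rw [← ENNReal.ofReal_mul (hf0 _ (radius_nonneg _))]
  rw [hM, hM, key, hD, ENNReal.toReal_add (hfin t₀ h0.1) ENNReal.ofReal_ne_top,
    add_sub_cancel_left, ENNReal.toReal_ofReal (integral_nonneg fun θ =>
      setIntegral_nonneg measurableSet_Icc fun s hs => hq0 θ s (hsub hs)),
    intervalIntegral.integral_of_le h01.le, ← integral_Icc_eq_integral_Ioc]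
  exact integral_integral_swap (f := fun θ t => q (θ, t)) hint

lemma hasDerivWithinAt_volume (hm : 1 ≤ m) (hconvex : IsMeanConvex (X 0) (ν 0))
    (hstar : IsStarShaped (range (X 0))) {τ : ℝ} (hτ : τ ∈ timeInterval T) :
    HasDerivWithinAt (fun t => (hypVol m).real (Ω t))
      (∫ θ, speed T X ν (θ, τ) * areaDensity (X τ) θ ∂(sphMeasure m)) (timeInterval T) τ := by
  simpa using h.hasDerivWithinAt_integral_domain hm hconvex hstar (f := fun _ => 1)
    measurable_const continuousOn_const (fun _ _ => zero_le_one) (fun _ _ => le_rfl) hτ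

/-- The radius is `arcosh` of the time component, which is linear in the position. The quotient `ν.1
/ ‖X.2‖` is `⟨∂_r, ν⟩`. -/
lemma hasDerivWithinAt_radius (hm : 1 ≤ m) (hconvex : IsMeanConvex (X 0) (ν 0))
    (hstar : IsStarShaped (range (X 0))) (θ : Sph m) {t : ℝ} (ht : t ∈ timeInterval T) :
    HasDerivWithinAt (fun s => radius (X s θ))
      (speed T X ν (θ, t) * ((ν t θ).1 / ‖(X t θ).1.2‖)) (timeInterval T) t := by
  have h1 := (h.evolution t ht θ).hasFDerivWithinAt.fst.hasDerivWithinAt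
  have h2 : (fun s => radius (X s θ)) = Real.arcosh ∘ fun s => (X s θ).1.1 := by
    funext s
    rw [Function.comp_apply, ← cosh_radius, Real.arcosh_cosh (radius_nonneg _)]
  have hr := h.radius_pos hm hconvex hstar ht θ
  have h3 : (X t θ).1.1 ∈ Ioi (1 : ℝ) := by
    rw [← cosh_radius]; exact Real.one_lt_cosh.2 hr.ne'
  have h4 : √((X t θ).1.1 ^ 2 - 1) = ‖(X t θ).1.2‖ := by
    rw [(X t θ).time_sq, add_sub_cancel_left, Real.sqrt_sq (norm_nonneg _)]
  rw [h2]
  refine ((Real.hasDerivAt_arcosh h3).comp_hasDerivWithinAt t h1).congr_deriv ?_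
  rw [h4, h.speed_coe ht]
  simp
  ring

lemma area_pos {t : ℝ} (ht : t ∈ timeInterval T) : 0 < area (X t) := by
  simp only [area, surfaceIntegral, one_mul]
  exact integral_sph_pos (continuous_slice h.continuousOn_areaDensity ht)
    (fun θ => (h.areaDensity_pos ht θ).le) (Classical.arbitrary _) (h.areaDensity_pos ht _)

lemma hasDerivWithinAt_area {t : ℝ} (ht : t ∈ timeInterval T) :
    HasDerivWithinAt (fun s => area (X s)) (area (X t)) (timeInterval T) t := by
  have h1 : ∀ s ∈ timeInterval T, area (X s) = Real.exp s * area (X 0) := by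
    intro s hs
    simp only [area, surfaceIntegral, one_mul, h.areaDensity_eq_exp hs, integral_const_mul]
  rw [h1 t ht]
  exact ((Real.hasDerivAt_exp t).mul_const _).hasDerivWithinAt.congr h1 (h1 t ht)

lemma hasDerivWithinAt_surfaceIntegral_g (hm : 1 ≤ m) (hconvex : IsMeanConvex (X 0) (ν 0))
    (hstar : IsStarShaped (range (X 0))) {τ : ℝ} (hτ : τ ∈ timeInterval T) :
    HasDerivWithinAt (fun t => surfaceIntegral (X t) fun p => g m (radius p))
      ((surfaceIntegral (X τ) fun p => g m (radius p)) +
        ∫ θ, (1 - m * weight m (radius (X τ θ))) * ((ν τ θ).1 / ‖(X τ θ).1.2‖) *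
          (speed T X ν (θ, τ) * areaDensity (X τ) θ) ∂(sphMeasure m)) (timeInterval T) τ := by
  have hr : ∀ q ∈ (univ ×ˢ timeInterval T : Set (Sph m × ℝ)), ‖(X q.2 q.1).1.2‖ ≠ 0 :=
    fun q hq => norm_ne_zero_iff.2 (radius_pos_iff.1 (h.radius_pos hm hconvex hstar hq.2 q.1))
  have hg := (h.continuousOn_comp_radius hm hconvex hstar (continuousOn_g m)).mul
    h.continuousOn_areaDensity
  have hw := ((continuousOn_const (c := (1 : ℝ))).sub ((continuousOn_const (c := (m : ℝ))).mul
    (h.continuousOn_comp_radius hm hconvex hstar (continuousOn_weight m)))).mul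
    (h.continuousOn_nor.fst.div h.continuousOn_pos.snd.norm hr) |>.mul
      (h.continuousOn_speed_sph.mul h.continuousOn_areaDensity)
  have := hasDerivWithinAt_integral_sph hg (hg.add hw) (fun θ t ht => ?_) hτ
  · refine this.congr_deriv ?_
    exact integral_add (integrable_of_continuous_sph (continuous_slice hg hτ))
      (integrable_of_continuous_sph (continuous_slice hw hτ))
  · have h1 := (hasDerivAt_g m (h.radius_pos hm hconvex hstar ht θ)).comp_hasDerivWithinAt t
      (h.hasDerivWithinAt_radius hm hconvex hstar θ ht)
    have h2 : HasDerivWithinAt (fun s => areaDensity (X s) θ) (areaDensity (X t) θ)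
        (timeInterval T) t := by
      rw [h.areaDensity_eq_exp ht]
      exact ((Real.hasDerivAt_exp t).mul_const _).hasDerivWithinAt.congr
        (fun s hs => h.areaDensity_eq_exp hs θ) (h.areaDensity_eq_exp ht θ)
    refine (h1.mul h2).congr_deriv ?_
    simp only [Function.comp_apply, Pi.add_apply, Pi.mul_apply, Pi.sub_apply, Pi.div_apply]
    ring

end IsIMCF

end HypFlow

/-! ### The cone over a hypersurface and the cone inequality. -/

namespace HypFlow

open Set MeasureTheory

variable {m : ℕ}

section AreaInequality

/-- The weighted area inequality for images under differentiable maps. -/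
lemma setLIntegral_image_le {f : Euc m → Euc m} {f' : Euc m → Euc m →L[ℝ] Euc m}
    {s : Set (Euc m)} (hs : MeasurableSet s) (hf : Measurable f)
    (hf' : ∀ x ∈ s, HasFDerivWithinAt f (f' x) s x)
    (hdet : Measurable fun x => ENNReal.ofReal |(f' x).det|) {w : Euc m → ENNReal}
    (hw : Measurable w) :
    ∫⁻ y in f '' s, w y ≤ ∫⁻ x in s, ENNReal.ofReal |(f' x).det| * w (f x) := by
  -- The unweighted area inequality on all sets `s ∩ f ⁻¹' A` is an inequality of measures, against
  -- which any weight can be integrated.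
  have hle : (volume : Measure (Euc m)).restrict (f '' s) ≤
      Measure.map f ((volume.restrict s).withDensity fun x => ENNReal.ofReal |(f' x).det|) := by
    refine Measure.le_iff.2 fun A hA => ?_
    rw [Measure.restrict_apply hA, Measure.map_apply hf hA, withDensity_apply _ (hf hA),
      Measure.restrict_restrict (hf hA), inter_comm A, ← image_inter_preimage,
      inter_comm (f ⁻¹' A)]
    exact addHaar_image_le_lintegral_abs_det_fderiv volume (hs.inter (hf hA))
      fun x hx => (hf' x hx.1).mono inter_subset_left
  refine (lintegral_mono' hle le_rfl).trans_eq ?_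
  rw [lintegral_map hw hf]
  exact lintegral_withDensity_eq_lintegral_mul _ hdet (hw.comp hf)

end AreaInequality

section Cone

variable {F : Sph m → Hyp m} {N : Sph m → Mink m} {Ω : Set (Hyp m)}

/-- The radial extension of the spatial part of a parametrisation. -/
noncomputable def cone (F : Sph m → Hyp m) (x : Euc m) : Euc m := ‖x‖ • (F (nrm x)).1.2

lemma cone_smul (F : Sph m → Hyp m) {s : ℝ} (hs : 0 < s) (θ : Sph m) :
    cone F (s • (θ : Euc m)) = s • (F θ).1.2 := by
  rw [cone, nrm_smul hs, norm_smul, θ.norm_coe, mul_one, Real.norm_eq_abs, abs_of_pos hs]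

lemma hasFDerivAt_lift_scale {f : Sph m → Mink m} (hf : ContMDiff (𝓡 m) 𝓘(ℝ, Mink m) ∞ f)
    {x : Euc m} (hx : x ≠ 0) :
    HasFDerivAt (f ∘ nrm) (‖x‖⁻¹ • fderiv ℝ (f ∘ nrm) (nrm x : Euc m)) x := by
  have hc : 0 < ‖x‖⁻¹ := inv_pos.2 (norm_pos_iff.2 hx)
  have h1 := hasFDerivAt_lift hf (nrm x).coe_ne_zero
  have h2 : (f ∘ nrm) ∘ (‖x‖⁻¹ • ContinuousLinearMap.id ℝ (Euc m)) = f ∘ nrm := by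
    funext y; simp [nrm_smul' hc]
  have hx' : (‖x‖⁻¹ • ContinuousLinearMap.id ℝ (Euc m)) x = nrm x := by simp [coe_nrm hx]
  rw [← hx'] at h1 ⊢
  have h3 := h1.comp x (‖x‖⁻¹ • ContinuousLinearMap.id ℝ (Euc m)).hasFDerivAt
  rw [h2] at h3
  refine h3.congr_fderiv ?_
  ext1 v
  simp

/-- By homogeneity of degree one, the derivative depends only on the direction of `x`. -/
lemma hasFDerivAt_cone (hF : ContMDiff (𝓡 m) 𝓘(ℝ, Mink m) ∞ (toMink F)) {x : Euc m} (hx : x ≠ 0) :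
    HasFDerivAt (cone F)
      (tilt (fderiv ℝ (toMink F ∘ nrm) (nrm x : Euc m)) (nrm x : Euc m) (F (nrm x)).1.2) x := by
  have h1 := ((hasStrictFDerivAt_norm hx).hasFDerivAt).smul (hasFDerivAt_lift_scale hF hx).snd
  refine h1.congr_fderiv ?_
  ext1 v
  rw [tilt_apply]
  simp [toMink, norm_ne_zero_iff.2 hx]

lemma measurable_cone (hF : ContMDiff (𝓡 m) 𝓘(ℝ, Mink m) ∞ (toMink F)) : Measurable (cone F) :=
  measurable_of_continuousOn_compl_singleton 0 fun _ hx =>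
    (hasFDerivAt_cone hF hx).continuousAt.continuousWithinAt

lemma abs_det_cone (hF : IsEmbedding F) (hN : IsOutwardUnitNormal F Ω N) (θ : Sph m) :
    |(tilt (fderiv ℝ (toMink F ∘ nrm) (θ : Euc m)) θ (F θ).1.2).det| =
      |(N θ).1| * areaDensity F θ := by
  have hfr := hF.isFrame hN θ
  rw [hfr.det_tilt_self, areaDensity_eq hF.smooth hfr, abs_mul, abs_div,
    abs_of_pos (F θ).2.2]
  field_simp

lemma integral_cone_density {r : ℝ} (hr : 0 < r) :
    ∫⁻ s in Ioo (0 : ℝ) 1, ENNReal.ofReal (s ^ m * (1 / √(1 + (s * Real.sinh r) ^ 2))) =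
      ENNReal.ofReal (g m r / Real.sinh r) := by
  have hs := Real.sinh_pos_iff.2 hr
  have hc : Continuous fun s : ℝ => s ^ m * (1 / √(1 + (s * Real.sinh r) ^ 2)) :=
    (by fun_prop : Continuous fun s : ℝ => s ^ m).mul (continuous_const.div (by fun_prop)
      fun s => (Real.sqrt_pos.2 (by positivity)).ne')
  rw [← ofReal_integral_eq_lintegral_ofReal
    ((hc.integrableOn_Icc (a := 0) (b := 1)).mono_set Ioo_subset_Icc_self)
    ((ae_restrict_iff' measurableSet_Ioo).2 (.of_forall fun s hs => by
      have := hs.1; simp only [Pi.zero_apply]; positivity)),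
    ← integral_Ioc_eq_integral_Ioo, ← intervalIntegral.integral_of_le zero_le_one]
  congr 1
  -- The antiderivative comes from the substitution `sinh u = s * sinh r`.
  have hd : ∀ s : ℝ, HasDerivAt
      (fun s => ballProfile m (Real.arsinh (s * Real.sinh r)) / Real.sinh r ^ (m + 1))
      (s ^ m * (1 / √(1 + (s * Real.sinh r) ^ 2))) s := by
    intro s
    have h1 := (hasDerivAt_ballProfile m (Real.arsinh (s * Real.sinh r))).comp s
      (((hasDerivAt_id s).mul_const (Real.sinh r)).arsinh)
    refine (h1.div_const _).congr_deriv ?_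
    simp only [id, Real.sinh_arsinh, smul_eq_mul]
    have : √(1 + (s * Real.sinh r) ^ 2) ≠ 0 := (Real.sqrt_pos.2 (by positivity)).ne'
    field_simp
    ring
  rw [intervalIntegral.integral_eq_sub_of_hasDerivAt (fun s _ => hd s)
    (hc.intervalIntegrable _ _)]
  simp only [one_mul, Real.arsinh_sinh, zero_mul, Real.arsinh_zero, ballProfile_zero, zero_div,
    sub_zero, g_eq]
  field_simp
  ring

/-- The integral of the volume density over the cone, in polar coordinates. -/
lemma lintegral_cone (hF : IsEmbedding F) (hN : IsOutwardUnitNormal F Ω N)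
    (hr : ∀ θ, 0 < radius (F θ)) :
    ∫⁻ x in {x : Euc m | 0 < ‖x‖ ∧ ‖x‖ < 1},
        ENNReal.ofReal |(fderiv ℝ (cone F) x).det| * volDensity (cone F x) =
      ∫⁻ θ, ENNReal.ofReal (g m (radius (F θ)) * (|(N θ).1| / ‖(F θ).1.2‖) * areaDensity F θ)
        ∂(sphMeasure m) := by
  set D : Set (Euc m) := {x : Euc m | 0 < ‖x‖ ∧ ‖x‖ < 1}
  have hD : MeasurableSet D := by
    exact (isOpen_lt continuous_const continuous_norm).measurableSet.inter
      (isOpen_lt continuous_norm continuous_const).measurableSet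
  have hmeas : Measurable fun x =>
      ENNReal.ofReal |(fderiv ℝ (cone F) x).det| * volDensity (cone F x) :=
    ((ContinuousLinearMap.continuous_det.measurable.comp
      (measurable_fderiv ℝ (cone F))).abs.ennreal_ofReal).mul
      (measurable_volDensity.comp (measurable_cone hF.smooth))
  rw [← lintegral_indicator hD, lintegral_polar (hmeas.indicator hD)]
  refine lintegral_congr fun θ => ?_
  have hY := norm_pos_iff.2 (radius_pos_iff.1 (hr θ))
  have hpt : ∀ s ∈ Ioi (0 : ℝ), ENNReal.ofReal (s ^ m) * D.indicator (fun x =>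
      ENNReal.ofReal |(fderiv ℝ (cone F) x).det| * volDensity (cone F x)) (s • (θ : Euc m)) =
      (Ioo (0 : ℝ) 1).indicator (fun s => ENNReal.ofReal (|(N θ).1| * areaDensity F θ) *
        ENNReal.ofReal (s ^ m * (1 / √(1 + (s * Real.sinh (radius (F θ))) ^ 2)))) s := by
    intro s hs
    have hs' : 0 < s := hs
    have hn : ‖s • (θ : Euc m)‖ = s := by
      rw [norm_smul, θ.norm_coe, mul_one, Real.norm_eq_abs, abs_of_pos hs']
    by_cases h1 : s < 1
    · rw [indicator_of_mem (show s • (θ : Euc m) ∈ D from ⟨by rw [hn]; exact hs, by rwa [hn]⟩),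
        indicator_of_mem (show s ∈ Ioo (0 : ℝ) 1 from ⟨hs, h1⟩),
        (hasFDerivAt_cone hF.smooth (smul_ne_zero hs'.ne' θ.coe_ne_zero)).fderiv, nrm_smul hs',
        abs_det_cone hF hN, cone_smul F hs', volDensity, norm_smul, Real.norm_eq_abs,
        abs_of_pos hs', sinh_radius, ENNReal.ofReal_mul (by positivity : 0 ≤ s ^ m)]
      ring
    · rw [indicator_of_notMem (fun h => h1 (by have := h.2; rwa [hn] at this)),
        indicator_of_notMem (fun h => h1 h.2), mul_zero]
  rw [setLIntegral_congr_fun measurableSet_Ioi hpt, lintegral_indicator measurableSet_Ioo,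
    Measure.restrict_restrict measurableSet_Ioo,
    inter_eq_left.2 (Ioo_subset_Ioi_self : Ioo (0 : ℝ) 1 ⊆ Ioi 0),
    lintegral_const_mul' _ _ ENNReal.ofReal_ne_top, integral_cone_density (hr θ), sinh_radius,
    ← ENNReal.ofReal_mul (by
      rw [← abs_det_cone hF hN]; exact abs_nonneg _)]
  congr 1
  ring

/-- Every ray issuing from a point of a bounded domain meets the boundary. -/
lemma IsBoundedDomain.exists_ray (hΩ : IsBoundedDomain Ω (range F)) {y e : Euc m}
    (hy : ofSpatial y ∈ Ω) (he : e ≠ 0) : ∃ s : ℝ, 0 < s ∧ ∃ θ, (F θ).1.2 = y + s • e := by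
  set U : Set (Euc m) := ofSpatial ⁻¹' Ω
  have hUo : IsOpen U := hΩ.isOpen.preimage continuous_ofSpatial
  have hfr : frontier U = ofSpatial ⁻¹' range F := by
    rw [← hΩ.boundary]; exact ((spatialHomeo m).symm.preimage_frontier Ω).symm
  by_contra! hcon
  have hpre : IsPreconnected ((fun s : ℝ => y + s • e) '' Ici 0) :=
    isPreconnected_Ici.image _ (by fun_prop)
  have hb : Bornology.IsBounded U := by
    have hc : IsCompact (ofSpatial ⁻¹' closure Ω) :=
      (spatialHomeo m).symm.isCompact_preimage.2 hΩ.bounded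
    exact hc.isBounded.subset (preimage_mono subset_closure)
  have hy0 : y ∈ (fun s : ℝ => y + s • e) '' Ici 0 := ⟨0, mem_Ici.2 le_rfl, by simp⟩
  rcases subset_or_subset_compl_closure hpre hUo (by
    rw [disjoint_left]
    rintro _ ⟨s, hs, rfl⟩ hfs
    rcases (mem_Ici.1 hs).eq_or_lt with h0 | h0
    · rw [hUo.frontier_eq, ← h0] at hfs
      refine hfs.2 ?_
      simpa [U] using hy
    · rw [hfr] at hfs
      obtain ⟨θ, hθ⟩ := hfs
      exact hcon s h0 θ (by rw [hθ]; rfl)) with hsub | hsub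
  · obtain ⟨C, hC⟩ := hb.exists_norm_le
    have hne := norm_pos_iff.2 he
    have hCy := hC y hy
    have hC0 : 0 ≤ C := (norm_nonneg y).trans hCy
    -- This parameter displaces `y` by `2 C + 1`, more than the diameter of a set whose points have
    -- norm at most `C`.
    have hs0 : 0 ≤ (2 * C + 1) / ‖e‖ := by positivity
    have h1 := hC _ (hsub ⟨(2 * C + 1) / ‖e‖, hs0, rfl⟩)
    have h2 : ‖((2 * C + 1) / ‖e‖) • e‖ = 2 * C + 1 := by
      rw [norm_smul, Real.norm_eq_abs, abs_of_nonneg hs0]; field_simp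
    have h3 := norm_sub_le (y + ((2 * C + 1) / ‖e‖) • e) y
    rw [add_sub_cancel_left, h2] at h3
    simp only at h1
    linarith
  · exact absurd (subset_closure (show y ∈ U from hy)) (hsub hy0)

/-- Continuing from `y` away from the origin, one reaches the boundary at some `(1 + s) • y`, so `y`
lies on the segment to that point. Only covering is claimed; the cone may overlap itself or leave
the domain. -/
lemma IsBoundedDomain.subset_cone (hΩ : IsBoundedDomain Ω (range F)) :
    (ofSpatial ⁻¹' Ω) \ {0} ⊆ cone F '' {x : Euc m | 0 < ‖x‖ ∧ ‖x‖ < 1} := by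
  rintro y ⟨hy, hy0⟩
  obtain ⟨s, hs, θ, hθ⟩ := hΩ.exists_ray hy hy0
  have h1 : 0 < (1 + s)⁻¹ := by positivity
  have hn : ‖(1 + s)⁻¹ • (θ : Euc m)‖ = (1 + s)⁻¹ := by
    rw [norm_smul, θ.norm_coe, mul_one, Real.norm_eq_abs, abs_of_pos h1]
  refine ⟨(1 + s)⁻¹ • (θ : Euc m), ⟨by rwa [hn], by rw [hn]; exact inv_lt_one_of_one_lt₀ (by linarith)⟩, ?_⟩
  rw [cone_smul F h1, hθ, show y + s • y = (1 + s) • y by rw [add_smul, one_smul], smul_smul,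
    inv_mul_cancel₀ (by positivity), one_smul]

lemma IsBoundedDomain.hypVol_eq (hΩ : IsBoundedDomain Ω (range F)) :
    hypVol m Ω = ∫⁻ x in (ofSpatial ⁻¹' Ω) \ {0}, volDensity x := by
  have h1 := setLIntegral_hypVol (f := fun _ => 1) measurable_const hΩ.isOpen.measurableSet
  rw [setLIntegral_one] at h1
  rw [h1]
  simp only [mul_one]
  exact (setLIntegral_congr (sdiff_null_ae_eq_self (measure_singleton 0))).symm

/-- The cone inequality: the volume of a domain is at most the sum of the volumes of the cones over
the pieces of its boundary. -/
lemma hypVol_le_cone (hF : IsEmbedding F) (hN : IsOutwardUnitNormal F Ω N)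
    (hΩ : IsBoundedDomain Ω (range F)) (hr : ∀ θ, 0 < radius (F θ)) :
    hypVol m Ω ≤ ∫⁻ θ, ENNReal.ofReal
      (g m (radius (F θ)) * (|(N θ).1| / ‖(F θ).1.2‖) * areaDensity F θ) ∂(sphMeasure m) := by
  rw [hΩ.hypVol_eq, ← lintegral_cone hF hN hr]
  refine (lintegral_mono_set hΩ.subset_cone).trans ?_
  refine setLIntegral_image_le ?_ (measurable_cone hF.smooth) (fun x hx => ?_) ?_
    measurable_volDensity
  · exact (isOpen_lt continuous_const continuous_norm).measurableSet.inter
      (isOpen_lt continuous_norm continuous_const).measurableSet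
  · exact (hasFDerivAt_cone hF.smooth
      (norm_pos_iff.1 hx.1)).differentiableAt.hasFDerivAt.hasFDerivWithinAt
  · exact (ContinuousLinearMap.continuous_det.measurable.comp
      (measurable_fderiv ℝ (cone F))).abs.ennreal_ofReal

/-- The converse inequality when the cone is embedded in the domain; it is needed for geodesic
spheres. -/
lemma cone_le_hypVol (hF : IsEmbedding F) (hN : IsOutwardUnitNormal F Ω N)
    (hΩ : IsBoundedDomain Ω (range F)) (hr : ∀ θ, 0 < radius (F θ))
    (hinj : InjOn (cone F) {x : Euc m | 0 < ‖x‖ ∧ ‖x‖ < 1})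
    (hsub : cone F '' {x : Euc m | 0 < ‖x‖ ∧ ‖x‖ < 1} ⊆ ofSpatial ⁻¹' Ω) :
    ∫⁻ θ, ENNReal.ofReal
      (g m (radius (F θ)) * (|(N θ).1| / ‖(F θ).1.2‖) * areaDensity F θ) ∂(sphMeasure m) ≤
      hypVol m Ω := by
  have h1 := setLIntegral_hypVol (f := fun _ => 1) measurable_const hΩ.isOpen.measurableSet
  rw [setLIntegral_one] at h1
  simp only [mul_one] at h1
  rw [h1, ← lintegral_cone hF hN hr]
  refine le_trans (le_of_eq ?_) (lintegral_mono_set hsub)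
  refine (lintegral_image_eq_lintegral_abs_det_fderiv_mul volume ?_ (fun x hx => ?_) hinj _).symm
  · exact (isOpen_lt continuous_const continuous_norm).measurableSet.inter
      (isOpen_lt continuous_norm continuous_const).measurableSet
  · exact (hasFDerivAt_cone hF.smooth
      (norm_pos_iff.1 hx.1)).differentiableAt.hasFDerivAt.hasFDerivWithinAt

end Cone

end HypFlow

/-! ### Radial normals and the characterisation of geodesic spheres. -/

namespace HypFlow

open Set MeasureTheory

variable {m : ℕ}

namespace IsFrame

variable {X N : Mink m} {L : Euc m →L[ℝ] Mink m} {θ : Euc m}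

lemma inner_normal (h : IsFrame X N L θ) : inner ℝ N.2 X.2 = N.1 * X.1 := by
  have := h.normal_tangent; rw [lorentz] at this; linarith

lemma norm_sq_normal (h : IsFrame X N L θ) : ‖N.2‖ ^ 2 = 1 + N.1 ^ 2 := by
  have := h.normal_unit
  rw [lorentz, real_inner_self_eq_norm_sq] at this; linarith [sq N.1]

lemma norm_sq_pos (h : IsFrame X N L θ) : ‖X.2‖ ^ 2 = X.1 ^ 2 - 1 := by
  have := h.hyp
  rw [lorentz, real_inner_self_eq_norm_sq] at this; linarith [sq X.1]

/-- Cauchy–Schwarz for the spatial parts of `N` and `X`; geometrically, `|⟨∂_r, ν⟩| ≤ 1`. -/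
lemma abs_normal_time_le (h : IsFrame X N L θ) : |N.1| ≤ ‖X.2‖ := by
  refine abs_le_of_sq_le_sq ?_ (norm_nonneg _)
  have h1 := real_inner_mul_inner_self_le N.2 X.2
  rw [h.inner_normal, real_inner_self_eq_norm_sq, real_inner_self_eq_norm_sq, h.norm_sq_normal,
    h.norm_sq_pos] at h1
  rw [h.norm_sq_pos]
  linear_combination h1

/-- If the normal is radial, then the differential of the time component vanishes. -/
lemma time_eq_zero (h : IsFrame X N L θ) (hX : 0 < ‖X.2‖) (heq : |N.1| = ‖X.2‖) (v : Euc m) :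
    (L v).1 = 0 := by
  have hN2 : N.1 ^ 2 = ‖X.2‖ ^ 2 := by rw [← heq, sq_abs]
  have hN0 : N.1 ≠ 0 := by rw [← abs_pos, heq]; exact hX
  have hX2 := h.norm_sq_pos
  -- The equality case of Cauchy–Schwarz: the spatial parts of `N` and `X` are parallel.
  have hu : ‖X.2‖ ^ 2 • N.2 - (N.1 * X.1) • X.2 = 0 := by
    rw [← norm_eq_zero, ← sq_eq_zero_iff, norm_sub_sq_real, real_inner_smul_left,
      real_inner_smul_right, h.inner_normal, norm_smul, norm_smul, mul_pow, mul_pow,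
      h.norm_sq_normal, Real.norm_eq_abs, Real.norm_eq_abs, sq_abs, sq_abs]
    rw [hX2] at hN2
    rw [hX2]
    linear_combination (X.1 ^ 2 - 1) * (X.1 ^ 2 - 1 - X.1 ^ 2) * hN2
  have h1 := h.tangent v
  have h2 := h.normal v
  rw [lorentz] at h1 h2
  have h3 : inner ℝ (‖X.2‖ ^ 2 • N.2 - (N.1 * X.1) • X.2) (L v).2 = 0 := by
    rw [hu, inner_zero_left]
  rw [inner_sub_left, real_inner_smul_left, real_inner_smul_left, real_inner_comm (L v).2 X.2] at h3
  have h4 : N.1 * (L v).1 = 0 := by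
    rw [hX2] at h3
    linear_combination (X.1 ^ 2 - 1) * h2 - N.1 * X.1 * h1 - h3
  exact (mul_eq_zero.1 h4).resolve_left hN0

/-- If the differential of the time component vanishes, then the normal is radial. -/
lemma abs_normal_time_eq (h : IsFrame X N L θ) (hX : 0 < ‖X.2‖) (hL : ∀ v, (L v).1 = 0)
    (b : Fin m → Euc m) (hb : ∀ i, inner ℝ θ (b i) = 0)
    (hb0 : (Matrix.of fun i j => inner ℝ (b i) (b j)).det ≠ 0) : |N.1| = ‖X.2‖ := by
  have hX2 := h.norm_sq_pos
  have hLX : ∀ v, inner ℝ (L v).2 X.2 = 0 := fun v => by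
    have := h.tangent v
    rw [lorentz, hL v] at this; linarith
  -- The explicit radial vector is also a unit normal here. Both normals give the same squared tilt
  -- determinant, and both relate it to the tilt by `X.2`, so their time components agree up to
  -- sign.
  have h' : IsFrame X (‖X.2‖, (X.1 / ‖X.2‖) • X.2) L θ :=
    { h with
      normal_tangent := by
        rw [lorentz, real_inner_smul_left, real_inner_self_eq_norm_sq]; field_simp; ring
      normal_unit := by
        rw [lorentz, real_inner_smul_left, real_inner_smul_right, real_inner_self_eq_norm_sq]
        field_simp
        rw [hX2]; ring
      normal := fun v => by
        rw [lorentz, hL v, real_inner_smul_left, real_inner_comm, hLX v]; simp }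
  have e1 := det_tilt_normal_sq h.unit h.hyp h.time_pos h.radial h.tangent h.normal_tangent
    h.normal_unit h.normal b hb
  have e2 := det_tilt_normal_sq h'.unit h'.hyp h'.time_pos h'.radial h'.tangent h'.normal_tangent
    h'.normal_unit h'.normal b hb
  have e3 := mul_right_cancel₀ hb0 (e1.trans e2.symm)
  have e4 := h.det_tilt_self
  rw [h'.det_tilt_self] at e4
  have hd := h.det_tilt_ne_zero
  have hX1 := h.time_pos
  have e5 : N.1 ^ 2 * (tilt L θ N.2).det ^ 2 = ‖X.2‖ ^ 2 * (tilt L θ N.2).det ^ 2 := by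
    rw [e3] at ⊢
    field_simp at e4
    rw [← e3, ← mul_pow, ← e4, mul_pow, e3]
  have e6 := mul_right_cancel₀ (pow_ne_zero 2 hd) e5
  rw [← abs_of_pos hX]
  exact (sq_eq_sq_iff_abs_eq_abs _ _).1 e6

end IsFrame

section GeodesicSphere

variable {F : Sph m → Hyp m} {N : Sph m → Mink m} {Ω : Set (Hyp m)}

lemma exists_time_eq (hm : 1 ≤ m) (hF : ContMDiff (𝓡 m) 𝓘(ℝ, Mink m) ∞ (toMink F))
    (h0 : ∀ (θ : Sph m) (v : Euc m), (fderiv ℝ (toMink F ∘ nrm) (θ : Euc m) v).1 = 0) :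
    ∃ c, ∀ θ, (F θ).1.1 = c := by
  have hpre : IsPreconnected ({0}ᶜ : Set (Euc m)) := by
    refine (isConnected_compl_singleton_of_one_lt_rank ?_ 0).isPreconnected
    rw [← Module.finrank_eq_rank, finrank_euclideanSpace_fin]
    exact_mod_cast Nat.lt_add_of_pos_left hm
  have hd : ∀ x : Euc m, x ≠ 0 → HasFDerivAt (fun x => (F (nrm x)).1.1) (0 : Euc m →L[ℝ] ℝ) x := by
    intro x hx
    refine (hasFDerivAt_lift_scale hF hx).fst.congr_fderiv ?_
    ext1 v
    simp [h0]
  obtain ⟨c, hc⟩ := isOpen_compl_singleton.exists_is_const_of_fderiv_eq_zero hpre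
    (fun x hx => (hd x hx).differentiableAt.differentiableWithinAt)
    (fun x hx => (hd x hx).fderiv)
  exact ⟨c, fun θ => by simpa [nrm_coe] using hc θ θ.coe_ne_zero⟩

/-- Surjectivity: the ray from the origin through a point of the sphere must meet the hypersurface,
and can do so only at radius `R`. -/
lemma IsBoundedDomain.range_eq_geodesicSphere (hΩ : IsBoundedDomain Ω (range F))
    (hO : ofSpatial (0 : Euc m) ∈ Ω) {R : ℝ} (hR : 0 < R) (hF : ∀ θ, radius (F θ) = R) :
    range F = geodesicSphere m R := by
  ext p
  constructor
  · rintro ⟨θ, rfl⟩; exact hF θ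
  · intro hp
    have hp' : radius p = R := hp
    have hp0 : p.1.2 ≠ 0 := radius_pos_iff.1 (hp' ▸ hR)
    obtain ⟨s, hs, θ, hθ⟩ := hΩ.exists_ray hO hp0
    rw [zero_add] at hθ
    have h1 : ‖(F θ).1.2‖ = ‖p.1.2‖ := by rw [← sinh_radius, ← sinh_radius, hF, hp']
    rw [hθ, norm_smul, Real.norm_eq_abs, abs_of_pos hs] at h1
    have h2 : s = 1 := by
      have := norm_ne_zero_iff.2 hp0
      exact mul_right_cancel₀ this (by rw [h1, one_mul])
    refine ⟨θ, ?_⟩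
    rw [← ofSpatial_spatial (F θ), hθ, h2, one_smul, ofSpatial_spatial]

/-- From a domain point beyond radius `R`, the outward ray would never meet the boundary. A point of
smaller radius is joined to the origin by a segment avoiding the boundary. -/
lemma IsBoundedDomain.eq_of_range (hΩ : IsBoundedDomain Ω (range F))
    (hO : ofSpatial (0 : Euc m) ∈ Ω) {R : ℝ} (hR : 0 < R)
    (hF : range F = geodesicSphere m R) : Ω = {p | radius p < R} := by
  have hnot : ∀ p ∈ Ω, radius p ≠ R := by
    intro p hp hpR
    have : p ∈ frontier Ω := by rw [hΩ.boundary, hF]; exact hpR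
    rw [hΩ.isOpen.frontier_eq] at this
    exact this.2 hp
  have hrad : ∀ θ, radius (F θ) = R := fun θ => by
    have : F θ ∈ geodesicSphere m R := by rw [← hF]; exact ⟨θ, rfl⟩
    exact this
  ext p
  constructor
  · intro hp
    by_contra hcon
    have h1 : R < radius p := lt_of_le_of_ne (not_lt.1 hcon) (hnot p hp).symm
    have hp0 : p.1.2 ≠ 0 := radius_pos_iff.1 (hR.trans h1)
    obtain ⟨s, hs, θ, hθ⟩ := hΩ.exists_ray (y := p.1.2) (by rwa [ofSpatial_spatial]) hp0
    have h2 : ‖(F θ).1.2‖ < ‖p.1.2‖ := by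
      rw [← sinh_radius, ← sinh_radius, hrad]; exact Real.sinh_lt_sinh.2 h1
    rw [hθ, show p.1.2 + s • p.1.2 = (1 + s) • p.1.2 by rw [add_smul, one_smul], norm_smul,
      Real.norm_eq_abs, abs_of_pos (by linarith)] at h2
    nlinarith [norm_nonneg p.1.2]
  · intro hp
    have hpre : IsPreconnected ((fun s : ℝ => ofSpatial (s • p.1.2)) '' Icc 0 1) :=
      isPreconnected_Icc.image _ (continuous_ofSpatial.comp (by fun_prop)).continuousOn
    rcases subset_or_subset_compl_closure hpre hΩ.isOpen (by
      rw [disjoint_left]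
      rintro _ ⟨s, hs, rfl⟩ hfs
      rw [hΩ.boundary, hF] at hfs
      have h1 : radius (ofSpatial (s • p.1.2)) ≤ radius p := by
        rw [radius_ofSpatial, radius, Real.arsinh_le_arsinh, norm_smul, Real.norm_eq_abs,
          abs_of_nonneg hs.1]
        exact mul_le_of_le_one_left (norm_nonneg _) hs.2
      exact absurd hfs (h1.trans_lt hp).ne) with hsub | hsub
    · have := hsub ⟨1, ⟨zero_le_one, le_rfl⟩, rfl⟩
      simpa [ofSpatial_spatial] using this
    · exact absurd (subset_closure hO) (hsub ⟨0, ⟨le_rfl, zero_le_one⟩, by simp⟩)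

/-- The normal is radial up to sign since the time component is constant on the hypersurface. An
inward normal would send its geodesic into the ball, against the outward condition. -/
lemma normal_time_eq (hF : IsEmbedding F) (hN : IsOutwardUnitNormal F Ω N) {R : ℝ} (hR : 0 < R)
    (hrad : ∀ θ, radius (F θ) = R) (hΩ : Ω = {p | radius p < R}) (θ : Sph m) :
    (N θ).1 = ‖(F θ).1.2‖ := by
  have hfr := hF.isFrame hN θ
  have hpos : 0 < ‖(F θ).1.2‖ := norm_pos_iff.2 (radius_pos_iff.1 ((hrad θ).symm ▸ hR))
  have hL : ∀ v, (fderiv ℝ (toMink F ∘ nrm) (θ : Euc m) v).1 = 0 := by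
    intro v
    have h1 := (hasFDerivAt_lift hF.smooth θ.coe_ne_zero).fst
    have h2 : (fun x => ((toMink F ∘ nrm) x).1) = fun _ : Euc m => Real.cosh R := by
      funext x
      rw [← hrad (nrm x), cosh_radius]; rfl
    rw [h2] at h1
    exact congrArg (fun A : Euc m →L[ℝ] ℝ => A v) (h1.unique (hasFDerivAt_const _ _))
  have habs := hfr.abs_normal_time_eq hpos hL (fun i => dincl θ (EuclideanSpace.single i 1))
    (fun i => inner_dincl θ _) (det_roundGram_pos θ).ne'
  rcases abs_eq hpos.le |>.1 habs with h1 | h1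
  · exact h1
  exfalso
  have hd : HasDerivAt (fun s => -(geodesicPoint (F θ) (N θ) s).1) (-(N θ).1) 0 :=
    (hasDerivAt_geodesicPoint (F θ).1 (N θ)).hasFDerivAt.fst.hasDerivAt.neg.congr_deriv (by simp)
  have hpos0 : ∀ᶠ s in 𝓝[>] (0 : ℝ), 0 < (geodesicPoint (F θ) (N θ) s).1 := by
    refine nhdsWithin_le_nhds ?_
    refine (hasDerivAt_geodesicPoint (F θ).1 (N θ)).continuousAt.fst.eventually
      (lt_mem_nhds ?_)
    simp only [geodesicPoint_zero]; exact (F θ).2.2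
  obtain ⟨s, hs, hs0, hout⟩ := ((eventually_lt_of_hasDerivAt_pos hd (by rw [h1]; simpa using hpos)).and
    (hpos0.and (hN.outward θ))).exists
  rw [geodesicPoint_zero] at hs
  refine hout ⟨⟨geodesicPoint (F θ) (N θ) s, lorentz_geodesicPoint hfr.hyp hfr.normal_unit
    hfr.normal_tangent s, hs0⟩, subset_closure ?_, rfl⟩
  rw [hΩ]
  change radius _ < R
  rw [← abs_of_nonneg (radius_nonneg _), ← abs_of_pos hR, ← Real.cosh_lt_cosh, cosh_radius,
    ← hrad θ, cosh_radius]
  linarith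

end GeodesicSphere

end HypFlow

/-! ### Geodesic balls, the function `h`, and volume comparison at fixed weight. -/

namespace HypFlow

open Set MeasureTheory

variable {m : ℕ}

section Balls

/-- The area of the unit sphere. -/
noncomputable def sphConst (m : ℕ) : ℝ := (sphMeasure m).real univ

lemma sphConst_pos (m : ℕ) : 0 < sphConst m :=
  ENNReal.toReal_pos (isOpen_univ.measure_pos _ univ_nonempty).ne' (measure_ne_top _ _)

lemma intervalIntegrable_mul_sinh_pow {f : ℝ → ℝ} (hf : Measurable f)
    (hf0 : ∀ r, 0 ≤ r → 0 ≤ f r) (hf1 : ∀ r, 0 ≤ r → f r ≤ 1) {a b : ℝ} (ha : 0 ≤ a) (hb : 0 ≤ b) :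
    IntervalIntegrable (fun r => f r * Real.sinh r ^ m) volume a b := by
  have h1 : IntervalIntegrable (fun r => Real.sinh r ^ m) volume a b :=
    (by fun_prop : Continuous fun r => Real.sinh r ^ m).intervalIntegrable _ _
  refine h1.mono_fun' (hf.mul (by fun_prop)).aestronglyMeasurable ?_
  refine (ae_restrict_iff' measurableSet_uIoc).2 (.of_forall fun r hr => ?_)
  have hr0 : 0 ≤ r := (le_min ha hb).trans hr.1.le
  have hs : 0 ≤ Real.sinh r ^ m := pow_nonneg (Real.sinh_nonneg_iff.2 hr0) m
  simp only [Real.norm_eq_abs]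
  rw [abs_of_nonneg (mul_nonneg (hf0 r hr0) hs)]
  exact mul_le_of_le_one_left hs (hf1 r hr0)

lemma measurableSet_ball (m : ℕ) (R : ℝ) : MeasurableSet (ball m R) :=
  (isClosed_le continuous_radius continuous_const).measurableSet

/-- The integral of a radial function over a geodesic ball. -/
lemma integral_ball {f : ℝ → ℝ} (hf : Measurable f) (hf0 : ∀ r, 0 ≤ r → 0 ≤ f r)
    (hf1 : ∀ r, 0 ≤ r → f r ≤ 1) {R : ℝ} (hR : 0 ≤ R) :
    ∫ p in ball m R, f (radius p) ∂(hypVol m) =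
      sphConst m * ∫ r in (0 : ℝ)..R, f r * Real.sinh r ^ m := by
  have hmeas : Measurable fun p : Hyp m => f (radius p) := hf.comp continuous_radius.measurable
  have hind : Measurable ((ball m R).indicator fun p => ENNReal.ofReal (f (radius p))) :=
    hmeas.ennreal_ofReal.indicator (measurableSet_ball m R)
  have hI := intervalIntegrable_mul_sinh_pow (m := m) hf hf0 hf1 le_rfl hR
  have hnn : ∀ r ∈ Ioc 0 R, 0 ≤ f r * Real.sinh r ^ m := fun r hr =>
    mul_nonneg (hf0 r hr.1.le) (pow_nonneg (Real.sinh_nonneg_iff.2 hr.1.le) m)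
  have key : ∫⁻ p in ball m R, ENNReal.ofReal (f (radius p)) ∂(hypVol m) =
      ENNReal.ofReal (∫ r in (0 : ℝ)..R, f r * Real.sinh r ^ m) * sphMeasure m univ := by
    rw [← lintegral_indicator (measurableSet_ball m R), lintegral_hypVol_polar hind,
      ← lintegral_const]
    refine lintegral_congr fun θ => ?_
    rw [intervalIntegral.integral_of_le hR, ofReal_integral_eq_lintegral_ofReal
        ((intervalIntegrable_iff_integrableOn_Ioc_of_le hR).1 hI)
        ((ae_restrict_iff' measurableSet_Ioc).2 (.of_forall hnn)),
      ← inter_eq_left.2 (Ioc_subset_Ioi_self : Ioc 0 R ⊆ Ioi 0),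
      ← Measure.restrict_restrict measurableSet_Ioc, ← lintegral_indicator measurableSet_Ioc]
    refine setLIntegral_congr_fun measurableSet_Ioi fun r hr => ?_
    have hr' : 0 < r := hr
    by_cases hrR : r ≤ R
    · rw [indicator_of_mem (show polar r θ ∈ ball m R by
        change radius _ ≤ R; rwa [radius_polar hr'.le]), indicator_of_mem (show r ∈ Ioc 0 R from ⟨hr, hrR⟩),
        radius_polar hr'.le, ← ENNReal.ofReal_mul (pow_nonneg (Real.sinh_nonneg_iff.2 hr'.le) m),
        mul_comm]
    · rw [indicator_of_notMem (show polar r θ ∉ ball m R by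
        change ¬ radius _ ≤ R; rwa [radius_polar hr'.le]),
        indicator_of_notMem (fun h => hrR h.2), mul_zero]
  rw [integral_eq_lintegral_of_nonneg_ae (.of_forall fun p => hf0 _ (radius_nonneg p))
      hmeas.aestronglyMeasurable, key, ENNReal.toReal_mul, ENNReal.toReal_ofReal
      (intervalIntegral.integral_nonneg_of_ae_restrict hR
        ((ae_restrict_iff' measurableSet_Icc).2 (.of_forall fun r hr =>
          mul_nonneg (hf0 r hr.1) (pow_nonneg (Real.sinh_nonneg_iff.2 hr.1) m)))), mul_comm]
  rfl

lemma ballWeight_eq (hm : 1 ≤ m) {R : ℝ} (hR : 0 ≤ R) :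
    ballWeight m R = sphConst m * ∫ r in (0 : ℝ)..R, weight m r * Real.sinh r ^ m :=
  integral_ball (measurable_weight m) (fun _ => weight_nonneg m) (fun _ => weight_le_one' m hm) hR

lemma hypVol_ball {R : ℝ} (hR : 0 ≤ R) : (hypVol m).real (ball m R) = sphConst m * ballProfile m R := by
  simpa [ballProfile] using integral_ball (m := m) (f := fun _ => 1) measurable_const
    (fun _ _ => zero_le_one) (fun _ _ => le_rfl) hR

lemma isCompact_ball (m : ℕ) (R : ℝ) : IsCompact (ball m R) := by
  have h1 : ball m R = ofSpatial '' Metric.closedBall 0 (Real.sinh R) := by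
    ext p
    constructor
    · intro hp
      refine ⟨p.1.2, ?_, ofSpatial_spatial p⟩
      rw [mem_closedBall_zero_iff, ← sinh_radius]
      exact Real.sinh_le_sinh.2 hp
    · rintro ⟨x, hx, rfl⟩
      rw [mem_closedBall_zero_iff] at hx
      change radius _ ≤ R
      rw [radius_ofSpatial, ← Real.arsinh_sinh R, Real.arsinh_le_arsinh]
      exact hx
  rw [h1]
  exact (isCompact_closedBall _ _).image continuous_ofSpatial

/-- The derivative of `ballWeight`. -/
lemma hasDerivAt_ballWeight (hm : 1 ≤ m) {R : ℝ} (hR : 0 < R) :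
    HasDerivAt (ballWeight m) (sphConst m * (weight m R * Real.sinh R ^ m)) R := by
  have hI := intervalIntegrable_mul_sinh_pow (m := m) (measurable_weight m)
    (fun _ => weight_nonneg m) (fun _ => weight_le_one' m hm) le_rfl hR.le
  have hmeas : Measurable fun r => weight m r * Real.sinh r ^ m :=
    (measurable_weight m).mul (by fun_prop)
  have h1 : HasDerivAt (fun R => ∫ r in (0 : ℝ)..R, weight m r * Real.sinh r ^ m)
      (weight m R * Real.sinh R ^ m) R :=
    intervalIntegral.integral_hasDerivAt_right hI
      hmeas.stronglyMeasurable.stronglyMeasurableAtFilter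
      ((hasDerivAt_weight m hR).continuousAt.mul (by fun_prop))
  refine (h1.const_mul (sphConst m)).congr_of_eventuallyEq ?_
  filter_upwards [lt_mem_nhds hR] with r hr using ballWeight_eq hm (le_of_lt hr)

lemma deriv_ballWeight_pos {R : ℝ} (hR : 0 < R) :
    0 < sphConst m * (weight m R * Real.sinh R ^ m) :=
  mul_pos (sphConst_pos m) (mul_pos (weight_pos m hR) (pow_pos (Real.sinh_pos_iff.2 hR) m))

lemma strictMonoOn_ballWeight (hm : 1 ≤ m) : StrictMonoOn (ballWeight m) (Ioi 0) := by
  apply strictMonoOn_of_deriv_pos (convex_Ioi 0)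
  · exact fun r hr => (hasDerivAt_ballWeight hm hr).continuousAt.continuousWithinAt
  · intro r hr
    rw [interior_Ioi] at hr
    rw [(hasDerivAt_ballWeight hm hr).deriv]
    exact deriv_ballWeight_pos hr

lemma sphereArea_pos {R : ℝ} (hR : 0 < R) : 0 < sphereArea m R :=
  mul_pos (sphConst_pos m) (pow_pos (Real.sinh_pos_iff.2 hR) m)

lemma invFunOn_ballWeight (hm : 1 ≤ m) {R : ℝ} (hR : 0 < R) :
    Function.invFunOn (ballWeight m) (Ioi 0) (ballWeight m R) = R :=
  (strictMonoOn_ballWeight hm).injOn.leftInvOn_invFunOn hR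

lemma h_ballWeight (hm : 1 ≤ m) {R : ℝ} (hR : 0 < R) :
    h m (ballWeight m R) = 1 / sphereArea m R := by
  rw [h, invFunOn_ballWeight hm hR]

/-- The logarithmic derivative of the sphere area is `m cosh / sinh`, while that integral grows at
rate `|S| w = |S| g cosh / sinh`. The factor `cosh / sinh` cancels and `|S| g` is the volume of the
ball: the weight is chosen for this. -/
lemma hasDerivAt_h (hm : 1 ≤ m) {R : ℝ} (hR : 0 < R) :
    HasDerivAt (h m) (-(m / (sphConst m * ballProfile m R)) * h m (ballWeight m R))
      (ballWeight m R) := by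
  have hs := Real.sinh_pos_iff.2 hR
  have hcont : ContinuousAt (fun R => sphConst m * (weight m R * Real.sinh R ^ m)) R :=
    continuousAt_const.mul ((hasDerivAt_weight m hR).continuousAt.mul (by fun_prop))
  have hstrict : HasStrictDerivAt (ballWeight m) (sphConst m * (weight m R * Real.sinh R ^ m)) R :=
    hasStrictDerivAt_of_hasDerivAt_of_continuousAt
      (by filter_upwards [lt_mem_nhds hR] with r hr using hasDerivAt_ballWeight hm hr) hcont
  have hne := (deriv_ballWeight_pos (m := m) hR).ne'
  have hinv := hstrict.to_localInverse hne
  set φ := hstrict.localInverse _ _ _ hne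
  have hφR : φ (ballWeight m R) = R := HasStrictFDerivAt.localInverse_apply_image _
  -- `h` is built from an unspecified inverse on `(0, ∞)`; near this value it agrees with the
  -- differentiable local inverse, which takes positive values there.
  have hev : (fun s => 1 / sphereArea m (φ s)) =ᶠ[𝓝 (ballWeight m R)] h m := by
    have h1 : ∀ᶠ s in 𝓝 (ballWeight m R), ballWeight m (φ s) = s :=
      HasStrictFDerivAt.eventually_right_inverse _
    have h2 : ∀ᶠ s in 𝓝 (ballWeight m R), 0 < φ s :=
      hinv.hasDerivAt.continuousAt.eventually (lt_mem_nhds (by rwa [hφR]))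
    filter_upwards [h1, h2] with s hs1 hs2
    rw [← h_ballWeight hm hs2, hs1]
  have hd : HasDerivAt (fun s => 1 / sphereArea m (φ s))
      (-(sphConst m * (m * Real.sinh R ^ (m - 1) * Real.cosh R *
        (sphConst m * (weight m R * Real.sinh R ^ m))⁻¹)) / sphereArea m R ^ 2)
      (ballWeight m R) := by
    have h3 := ((Real.hasDerivAt_sinh R).pow m).const_mul (sphConst m)
    have h4 : HasDerivAt (sphereArea m) (sphConst m * (m * Real.sinh R ^ (m - 1) * Real.cosh R))
      R := h3
    rw [← hφR] at h4
    have h5 := (h4.comp (ballWeight m R) hinv.hasDerivAt).inv (by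
      rw [Function.comp_apply, hφR]; exact (sphereArea_pos hR).ne')
    simp only [one_div]
    refine h5.congr_deriv ?_
    simp only [Function.comp_apply, hφR]
    ring
  refine (hd.congr_of_eventuallyEq hev.symm).congr_deriv ?_
  rw [h_ballWeight hm hR, sphereArea, ← sphConst, weight_eq]
  obtain ⟨k, rfl⟩ : ∃ k, m = k + 1 := ⟨m - 1, by omega⟩
  have h6 := (sphConst_pos (k + 1)).ne'
  have h7 := (ballProfile_pos (k + 1) hR).ne'
  have h8 := (Real.cosh_pos R).ne'
  have h9 := hs.ne'
  simp only [Nat.add_sub_cancel]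
  field_simp
  ring

lemma integrableOn_radial {f : ℝ → ℝ} (hf : Measurable f) (hf0 : ∀ r, 0 ≤ r → 0 ≤ f r)
    (hf1 : ∀ r, 0 ≤ r → f r ≤ 1) {A : Set (Hyp m)} (hA : hypVol m A < ⊤) :
    IntegrableOn (fun p => f (radius p)) A (hypVol m) := by
  refine Measure.integrableOn_of_bounded (M := 1) hA.ne
    (hf.comp continuous_radius.measurable).aestronglyMeasurable (.of_forall fun p => ?_)
  rw [Real.norm_eq_abs, abs_of_nonneg (hf0 _ (radius_nonneg p))]
  exact hf1 _ (radius_nonneg p)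

variable {Ω S : Set (Hyp m)}

/-- A geodesic ball with the same weight as a domain exists. -/
lemma IsBoundedDomain.exists_ballWeight_eq (hm : 1 ≤ m) (hΩ : IsBoundedDomain Ω S)
    (hO : ofSpatial (0 : Euc m) ∈ Ω) :
    ∃ R, 0 < R ∧ ballWeight m R = ∫ p in Ω, weight m (radius p) ∂(hypVol m) := by
  have hw : ∀ A : Set (Hyp m), hypVol m A < ⊤ → IntegrableOn (fun p => weight m (radius p)) A
      (hypVol m) := fun A hA => integrableOn_radial (measurable_weight m)
    (fun _ => weight_nonneg m) (fun _ => weight_le_one' m hm) hA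
  have hnn : ∀ A : Set (Hyp m), 0 ≤ᵐ[(hypVol m).restrict A] fun p => weight m (radius p) :=
    fun A => .of_forall fun p => weight_nonneg m (radius_nonneg p)
  obtain ⟨r₁, hr1, hsub1⟩ : ∃ r, 0 < r ∧ ball m r ⊆ Ω := by
    have hU : ofSpatial ⁻¹' Ω ∈ 𝓝 (0 : Euc m) := (hΩ.isOpen.preimage continuous_ofSpatial).mem_nhds hO
    obtain ⟨ε, hε, hball⟩ := Metric.nhds_basis_closedBall.mem_iff.1 hU
    refine ⟨Real.arsinh ε, Real.arsinh_pos_iff.2 hε, fun p hp => ?_⟩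
    rw [← ofSpatial_spatial p]
    apply hball
    rw [mem_closedBall_zero_iff]
    exact Real.arsinh_le_arsinh.1 hp
  obtain ⟨r₂, hr12, hsub2⟩ : ∃ r, r₁ ≤ r ∧ Ω ⊆ ball m r := by
    obtain ⟨C, hC⟩ := hΩ.bounded.exists_bound_of_continuousOn continuous_radius.continuousOn
    refine ⟨max r₁ C, le_max_left _ _, fun p hp => ?_⟩
    have := hC p (subset_closure hp)
    rw [Real.norm_eq_abs, abs_of_nonneg (radius_nonneg p)] at this
    exact this.trans (le_max_right _ _)
  have h1 : ballWeight m r₁ ≤ ∫ p in Ω, weight m (radius p) ∂(hypVol m) :=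
    setIntegral_mono_set (hw _ hΩ.hypVol_lt_top) (hnn _) hsub1.eventuallyLE
  have h2 : ∫ p in Ω, weight m (radius p) ∂(hypVol m) ≤ ballWeight m r₂ :=
    setIntegral_mono_set (hw _ (hypVol_lt_top_of_isCompact (isCompact_ball m r₂))) (hnn _)
      hsub2.eventuallyLE
  -- The domain lies between two centred balls, so its weight is attained by an intermediate one.
  obtain ⟨R, hR, hRW⟩ := intermediate_value_Icc hr12 (fun r hr =>
    (hasDerivAt_ballWeight hm (hr1.trans_le hr.1)).continuousAt.continuousWithinAt) ⟨h1, h2⟩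
  exact ⟨R, hr1.trans_le hR.1, hRW⟩

/-- Among the domains of given weight, the geodesic ball has the largest volume. -/
lemma IsBoundedDomain.hypVol_le_ball (hm : 1 ≤ m) (hΩ : IsBoundedDomain Ω S) {R : ℝ} (hR : 0 < R)
    (hW : ballWeight m R = ∫ p in Ω, weight m (radius p) ∂(hypVol m)) :
    (hypVol m).real Ω ≤ (hypVol m).real (ball m R) := by
  have hB := hypVol_lt_top_of_isCompact (isCompact_ball m R)
  have hw : ∀ A : Set (Hyp m), hypVol m A < ⊤ → IntegrableOn (fun p => weight m (radius p)) A
      (hypVol m) := fun A hA => integrableOn_radial (measurable_weight m)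
    (fun _ => weight_nonneg m) (fun _ => weight_le_one' m hm) hA
  have hint : ∀ A : Set (Hyp m), hypVol m A < ⊤ →
      IntegrableOn (fun p => weight m (radius p) - weight m R) A (hypVol m) := fun A hA =>
    (hw A hA).sub (integrableOn_const hA.ne)
  have hval : ∀ A : Set (Hyp m), hypVol m A < ⊤ →
      ∫ p in A, (weight m (radius p) - weight m R) ∂(hypVol m) =
        (∫ p in A, weight m (radius p) ∂(hypVol m)) - (hypVol m).real A * weight m R := by
    intro A hA
    rw [integral_sub (hw A hA) (integrableOn_const hA.ne), setIntegral_const, smul_eq_mul]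
  -- Bathtub principle: `w - w(R)` is nonpositive on the ball and nonnegative off it, so its
  -- integral is least over the ball.
  have hmono : ∀ p : Hyp m,
      (ball m R).indicator (fun p => weight m (radius p) - weight m R) p ≤
        Ω.indicator (fun p => weight m (radius p) - weight m R) p := by
    intro p
    have hin : p ∈ ball m R → weight m (radius p) - weight m R ≤ 0 := by
      intro hp
      -- At the origin the formula for the weight takes the default value `0`, still below `w(R)`.
      rcases (radius_nonneg p).eq_or_lt with h0 | h0
      · rw [← h0, weight_zero, zero_sub]; linarith [weight_pos m hR]
      · exact sub_nonpos.2 (monotoneOn_weight m h0 hR hp)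
    have hout : p ∉ ball m R → 0 ≤ weight m (radius p) - weight m R := by
      intro hp
      have hp' : R < radius p := not_le.1 hp
      exact sub_nonneg.2 (monotoneOn_weight m hR (hR.trans hp') hp'.le)
    by_cases h1 : p ∈ ball m R <;> by_cases h2 : p ∈ Ω <;> simp [h1, h2]
    · linarith [hin h1]
    · linarith [hout h1]
  have hle := integral_mono ((integrable_indicator_iff (measurableSet_ball m R)).2 (hint _ hB))
    ((integrable_indicator_iff hΩ.isOpen.measurableSet).2 (hint _ hΩ.hypVol_lt_top)) hmono
  rw [integral_indicator (measurableSet_ball m R), integral_indicator hΩ.isOpen.measurableSet,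
    hval _ hB, hval _ hΩ.hypVol_lt_top, ← hW, ballWeight] at hle
  have := weight_pos m hR
  exact le_of_mul_le_mul_right (by linarith) this

end Balls

end HypFlow

/-! ### Sign of the derivative and the equality case. -/

namespace HypFlow

open Set MeasureTheory

variable {m : ℕ} {T : EReal} {X : ℝ → Sph m → Hyp m} {ν : ℝ → Sph m → Mink m}
  {Ω : ℝ → Set (Hyp m)}

lemma hypVol_geodesicSphere {R : ℝ} (hR : 0 < R) : hypVol m (geodesicSphere m R) = 0 := by
  have hcl : MeasurableSet (geodesicSphere m R) :=
    (isClosed_eq continuous_radius continuous_const).measurableSet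
  have h1 := setLIntegral_hypVol (f := fun _ => 1) measurable_const hcl
  rw [setLIntegral_one] at h1
  rw [h1]
  refine setLIntegral_measure_zero _ _ (measure_mono_null (fun x hx => ?_)
    (Measure.addHaar_sphere_of_ne_zero volume (0 : Euc m) (Real.sinh_pos_iff.2 hR).ne'))
  have hx' : radius (ofSpatial x) = R := hx
  rw [mem_sphere_zero_iff_norm, ← hx', sinh_radius]
  rfl

lemma openBall_ae_eq_ball {R : ℝ} (hR : 0 < R) :
    ({p | radius p < R} : Set (Hyp m)) =ᵐ[hypVol m] ball m R := by
  have h1 : ({p | radius p < R} : Set (Hyp m)) = ball m R \ geodesicSphere m R := by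
    ext p
    exact lt_iff_le_and_ne (a := radius p)
  rw [h1]
  exact sdiff_null_ae_eq_self (hypVol_geodesicSphere hR)

namespace IsIMCF

variable (h : IsIMCF T X ν Ω) (hm : 1 ≤ m) (hconvex : IsMeanConvex (X 0) (ν 0))
  (hstar : IsStarShaped (range (X 0))) {t : ℝ} (ht : t ∈ timeInterval T)

include h ht in
lemma abs_normal_div_le (θ : Sph m) : |(ν t θ).1| / ‖(X t θ).1.2‖ ≤ 1 :=
  div_le_one_of_le₀ (h.isFrame ht θ).abs_normal_time_le (norm_nonneg _)

include h hm hconvex hstar ht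

lemma norm_pos (θ : Sph m) : 0 < ‖(X t θ).1.2‖ :=
  norm_pos_iff.2 (radius_pos_iff.1 (h.radius_pos hm hconvex hstar ht θ))

lemma continuous_comp_radius {f : ℝ → ℝ} (hf : ContinuousOn f (Ioi 0)) :
    Continuous fun θ => f (radius (X t θ)) :=
  continuous_slice (h.continuousOn_comp_radius hm hconvex hstar hf) ht

lemma continuous_normal_div : Continuous fun θ => (ν t θ).1 / ‖(X t θ).1.2‖ :=
  (continuous_slice h.continuousOn_nor.fst ht).div
    (continuous_slice h.continuousOn_pos.snd.norm ht)
    fun θ => (h.norm_pos hm hconvex hstar ht θ).ne'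

lemma continuous_cone_density : Continuous fun θ =>
    g m (radius (X t θ)) * (|(ν t θ).1| / ‖(X t θ).1.2‖) * areaDensity (X t) θ :=
  ((h.continuous_comp_radius hm hconvex hstar ht (continuousOn_g m)).mul
    ((continuous_slice h.continuousOn_nor.fst.abs ht).div
      (continuous_slice h.continuousOn_pos.snd.norm ht)
      fun θ => (h.norm_pos hm hconvex hstar ht θ).ne')).mul
    (continuous_slice h.continuousOn_areaDensity ht)

lemma lintegral_cone_density : ∫⁻ θ, ENNReal.ofReal
    (g m (radius (X t θ)) * (|(ν t θ).1| / ‖(X t θ).1.2‖) * areaDensity (X t) θ) ∂(sphMeasure m) =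
    ENNReal.ofReal (∫ θ, g m (radius (X t θ)) * (|(ν t θ).1| / ‖(X t θ).1.2‖) *
      areaDensity (X t) θ ∂(sphMeasure m)) := by
  refine (ofReal_integral_eq_lintegral_ofReal (integrable_of_continuous_sph
    (h.continuous_cone_density hm hconvex hstar ht)) (.of_forall fun θ => ?_)).symm
  have h1 := g_pos m (h.radius_pos hm hconvex hstar ht θ)
  have h2 := h.areaDensity_pos ht θ
  simp only [Pi.zero_apply]
  positivity

lemma continuous_g_density :
    Continuous fun θ => g m (radius (X t θ)) * areaDensity (X t) θ :=
  (h.continuous_comp_radius hm hconvex hstar ht (continuousOn_g m)).mul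
    (continuous_slice h.continuousOn_areaDensity ht)

lemma volume_le_cone : (hypVol m).real (Ω t) ≤
    ∫ θ, g m (radius (X t θ)) * (|(ν t θ).1| / ‖(X t θ).1.2‖) * areaDensity (X t) θ
      ∂(sphMeasure m) := by
  have h1 := hypVol_le_cone (h.embedding t ht) (h.normal t ht) (h.domain t ht)
    (h.radius_pos hm hconvex hstar ht)
  rw [h.lintegral_cone_density hm hconvex hstar ht] at h1
  refine ENNReal.toReal_le_of_le_ofReal (integral_nonneg fun θ => ?_) h1
  have h1 := g_pos m (h.radius_pos hm hconvex hstar ht θ)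
  have h2 := h.areaDensity_pos ht θ
  simp only [Pi.zero_apply]
  positivity

lemma cone_density_le (θ : Sph m) :
    g m (radius (X t θ)) * (|(ν t θ).1| / ‖(X t θ).1.2‖) * areaDensity (X t) θ ≤
      g m (radius (X t θ)) * areaDensity (X t) θ :=
  mul_le_mul_of_nonneg_right (mul_le_of_le_one_right
    (g_pos m (h.radius_pos hm hconvex hstar ht θ)).le (h.abs_normal_div_le ht θ))
    (h.areaDensity_pos ht θ).le

lemma volume_le_surfaceIntegral :
    (hypVol m).real (Ω t) ≤ surfaceIntegral (X t) fun p => g m (radius p) :=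
  (h.volume_le_cone hm hconvex hstar ht).trans (integral_mono
    (integrable_of_continuous_sph (h.continuous_cone_density hm hconvex hstar ht))
    (integrable_of_continuous_sph (h.continuous_g_density hm hconvex hstar ht))
    (h.cone_density_le hm hconvex hstar ht))

lemma volume_pos : 0 < (hypVol m).real (Ω t) := by
  obtain ⟨R, hR, hW⟩ := (h.domain t ht).exists_ballWeight_eq hm (h.origin_mem hm hconvex hstar ht)
  refine measureReal_nonneg.lt_of_ne fun h0 => ?_
  have h1 : hypVol m (Ω t) = 0 :=
    (ENNReal.toReal_eq_zero_iff _).1 h0.symm |>.resolve_right (h.domain t ht).hypVol_lt_top.ne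
  rw [setIntegral_measure_zero _ h1] at hW
  have h2 := strictMonoOn_ballWeight hm (half_pos hR) hR (half_lt_self hR)
  have h3 : 0 ≤ ballWeight m (R / 2) := integral_nonneg fun p => weight_nonneg m (radius_nonneg p)
  linarith

/-- Equality in the cone inequality characterises geodesic spheres. -/
lemma exists_eq_geodesicSphere
    (heq : surfaceIntegral (X t) (fun p => g m (radius p)) = (hypVol m).real (Ω t)) :
    ∃ R : ℝ, 0 < R ∧ range (X t) = geodesicSphere m R := by
  have hc1 := h.continuous_cone_density hm hconvex hstar ht
  have hc2 := h.continuous_g_density hm hconvex hstar ht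
  have hle := h.cone_density_le hm hconvex hstar ht
  have hnorm : ∀ θ, |(ν t θ).1| = ‖(X t θ).1.2‖ := by
    intro θ
    by_contra hne
    have hpos := h.norm_pos hm hconvex hstar ht θ
    have hlt : |(ν t θ).1| / ‖(X t θ).1.2‖ < 1 :=
      (div_lt_one hpos).2 (lt_of_le_of_ne (h.isFrame ht θ).abs_normal_time_le hne)
    -- A single non-radial normal makes the continuous nonnegative gap integrand positive somewhere,
    -- hence `V < G`.
    have h1 := integral_sph_pos (hc2.sub hc1) (fun θ => sub_nonneg.2 (hle θ)) θ
      (sub_pos.2 (mul_lt_mul_of_pos_right (mul_lt_of_lt_one_right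
        (g_pos m (h.radius_pos hm hconvex hstar ht θ)) hlt) (h.areaDensity_pos ht θ)))
    have h2 : ∫ θ, (g m (radius (X t θ)) * areaDensity (X t) θ -
        g m (radius (X t θ)) * (|(ν t θ).1| / ‖(X t θ).1.2‖) * areaDensity (X t) θ)
          ∂(sphMeasure m) = _ :=
      integral_sub (integrable_of_continuous_sph hc2) (integrable_of_continuous_sph hc1)
    have h3 := h.volume_le_cone hm hconvex hstar ht
    rw [surfaceIntegral] at heq
    have h4 := h1.trans_eq h2
    linarith
  have hF := h.embedding t ht
  obtain ⟨c, hc⟩ := exists_time_eq hm hF.smooth fun θ v =>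
    (hF.isFrame (h.normal t ht) θ).time_eq_zero (h.norm_pos hm hconvex hstar ht θ) (hnorm θ) v
  obtain ⟨θ₀⟩ : Nonempty (Sph m) := inferInstance
  refine ⟨radius (X t θ₀), h.radius_pos hm hconvex hstar ht θ₀,
    (h.domain t ht).range_eq_geodesicSphere (h.origin_mem hm hconvex hstar ht)
      (h.radius_pos hm hconvex hstar ht θ₀) fun θ => ?_⟩
  rw [← Real.arcosh_cosh (radius_nonneg (X t θ)), ← Real.arcosh_cosh (radius_nonneg (X t θ₀)),
    cosh_radius, cosh_radius, hc, hc]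

/-- Over a centred sphere the cone map is injective with image in the ball, and the normal is
radial, so the reverse cone inequality applies with integrand exactly `g`. -/
lemma surfaceIntegral_le_volume {R : ℝ} (hR : 0 < R) (hX : range (X t) = geodesicSphere m R) :
    surfaceIntegral (X t) (fun p => g m (radius p)) ≤ (hypVol m).real (Ω t) := by
  have hF := h.embedding t ht
  have hrad : ∀ θ, radius (X t θ) = R := fun θ => by
    have : X t θ ∈ geodesicSphere m R := by rw [← hX]; exact ⟨θ, rfl⟩
    exact this
  have hY : ∀ θ, ‖(X t θ).1.2‖ = Real.sinh R := fun θ => by rw [← sinh_radius, hrad]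
  have hsR := Real.sinh_pos_iff.2 hR
  have hΩ := (h.domain t ht).eq_of_range (h.origin_mem hm hconvex hstar ht) hR hX
  have hcone : ∀ x : Euc m, ‖cone (X t) x‖ = ‖x‖ * Real.sinh R := fun x => by
    rw [cone, norm_smul, norm_norm, hY]
  have h1 := cone_le_hypVol hF (h.normal t ht) (h.domain t ht)
    (h.radius_pos hm hconvex hstar ht) (fun x hx y hy hxy => ?_) ?_
  · rw [h.lintegral_cone_density hm hconvex hstar ht] at h1
    have h2 := (ENNReal.ofReal_le_iff_le_toReal (h.domain t ht).hypVol_lt_top.ne).1 h1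
    refine le_trans (le_of_eq ?_) h2
    refine integral_congr_ae (.of_forall fun θ => ?_)
    simp only
    rw [normal_time_eq hF (h.normal t ht) hR hrad hΩ, hY, abs_of_pos hsR, div_self hsR.ne', mul_one]
  · have h2 : ‖x‖ = ‖y‖ := by
      have := hcone x
      rw [hxy, hcone y] at this
      exact (mul_right_cancel₀ hsR.ne' this).symm
    have h3 : (X t (nrm x)).1.2 = (X t (nrm y)).1.2 := by
      rw [cone, cone, h2] at hxy
      exact smul_right_injective _ hy.1.ne' hxy
    have h4 : nrm x = nrm y := hF.injective (by
      rw [← ofSpatial_spatial (X t (nrm x)), h3, ofSpatial_spatial])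
    rw [← norm_smul_nrm x, h2, h4, norm_smul_nrm]
  · rintro _ ⟨x, hx, rfl⟩
    rw [mem_preimage, hΩ, mem_ofPred_eq, ← Real.sinh_lt_sinh, sinh_radius]
    change ‖cone (X t) x‖ < _
    rw [hcone]
    exact mul_lt_of_lt_one_left hsR hx.2

/-- The derivative of `quantityA`, in terms of the radius of the geodesic ball of equal weight. -/
lemma hasDerivWithinAt_quantityA {R : ℝ} (hR : 0 < R)
    (hW : ballWeight m R = ∫ p in Ω t, weight m (radius p) ∂(hypVol m)) :
    HasDerivWithinAt (fun s => quantityA (X s) (Ω s))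
      ((area (X t))⁻¹ / ((hypVol m).real (Ω t) * HypFlow.h m (ballWeight m R)) *
        ((∫ θ, (1 - m * weight m (radius (X t θ))) * ((ν t θ).1 / ‖(X t θ).1.2‖) *
          (speed T X ν (θ, t) * areaDensity (X t) θ) ∂(sphMeasure m)) -
        (surfaceIntegral (X t) fun p => g m (radius p)) / (hypVol m).real (Ω t) *
          (∫ θ, speed T X ν (θ, t) * areaDensity (X t) θ ∂(sphMeasure m)) +
        (surfaceIntegral (X t) fun p => g m (radius p)) / (hypVol m).real (ball m R) *
          (m * ∫ θ, weight m (radius (X t θ)) * (speed T X ν (θ, t) * areaDensity (X t) θ)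
            ∂(sphMeasure m))))
      (timeInterval T) t := by
  have hA := h.hasDerivWithinAt_area ht
  have hG := h.hasDerivWithinAt_surfaceIntegral_g hm hconvex hstar ht
  have hV := h.hasDerivWithinAt_volume hm hconvex hstar ht
  have hw := h.hasDerivWithinAt_integral_domain hm hconvex hstar (measurable_weight m)
    (continuousOn_weight m) (fun _ => weight_nonneg m) (fun _ => weight_le_one' m hm) ht
  have hh := hasDerivAt_h hm hR
  have hhpos : 0 < HypFlow.h m (ballWeight m R) := by
    rw [h_ballWeight hm hR]; exact one_div_pos.2 (sphereArea_pos hR)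
  rw [hW] at hh
  have hhW := hh.comp_hasDerivWithinAt t hw
  rw [← hW] at hhW
  have hVne := (h.volume_pos hm hconvex hstar ht).ne'
  have hAne := (h.area_pos ht).ne'
  have hBpos : 0 < (hypVol m).real (ball m R) := by
    rw [hypVol_ball hR.le]; exact mul_pos (sphConst_pos m) (ballProfile_pos m hR)
  rw [← hypVol_ball hR.le] at hhW
  have hden : (hypVol m).real (Ω t) *
      HypFlow.h m (∫ p in Ω t, weight m (radius p) ∂(hypVol m)) ≠ 0 := by
    rw [← hW]; exact mul_ne_zero hVne hhpos.ne'
  -- The unit logarithmic growth of the area cancels the term `G` in the derivative of `∫ g dμ`.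
  refine ((hA.inv hAne).mul (hG.div (hV.mul hhW) hden)).congr_deriv ?_
  simp only [Function.comp_apply, Pi.mul_apply, Pi.inv_apply, Pi.div_apply, ← hW]
  have h1 := hhpos.ne'
  have h2 := hBpos.ne'
  field_simp
  ring

/-- The right-hand side of the derivative of `quantityA` is controlled by the cone inequality. -/
lemma exists_hasDerivWithinAt_quantityA : ∃ a : ℝ,
    HasDerivWithinAt (fun s => quantityA (X s) (Ω s)) a (timeInterval T) t ∧ a ≤ 0 ∧
      (a = 0 ↔ ∃ R : ℝ, 0 < R ∧ range (X t) = geodesicSphere m R) := by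
  have hO := h.origin_mem hm hconvex hstar ht
  have hΩ := h.domain t ht
  obtain ⟨R, hR, hW⟩ := hΩ.exists_ballWeight_eq hm hO
  have hder := h.hasDerivWithinAt_quantityA hm hconvex hstar ht hR hW
  have hhpos : 0 < HypFlow.h m (ballWeight m R) := by
    rw [h_ballWeight hm hR]; exact one_div_pos.2 (sphereArea_pos hR)
  have hVpos := h.volume_pos hm hconvex hstar ht
  have hVG := h.volume_le_surfaceIntegral hm hconvex hstar ht
  have hVB := hΩ.hypVol_le_ball hm hR hW
  have hsd : Continuous fun θ : Sph m => speed T X ν (θ, t) * areaDensity (X t) θ :=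
    (continuous_slice h.continuousOn_speed_sph ht).mul
      (continuous_slice h.continuousOn_areaDensity ht)
  have hsd0 : ∀ θ : Sph m, 0 < speed T X ν (θ, t) * areaDensity (X t) θ := fun θ =>
    mul_pos (h.speed_pos hconvex ht θ) (h.areaDensity_pos ht θ)
  have hwc := h.continuous_comp_radius hm hconvex hstar ht (continuousOn_weight m)
  have hw1 : ∀ θ, 0 < 1 - m * weight m (radius (X t θ)) := fun θ =>
    sub_pos.2 (mul_weight_lt_one m hm (h.radius_pos hm hconvex hstar ht θ))
  have hnc := h.continuous_normal_div hm hconvex hstar ht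
  have hwc' : Continuous fun θ => 1 - m * weight m (radius (X t θ)) :=
    continuous_const.sub (continuous_const.mul hwc)
  have hgap : Continuous fun θ : Sph m => (1 - m * weight m (radius (X t θ))) *
      (speed T X ν (θ, t) * areaDensity (X t) θ) := hwc'.mul hsd
  -- In the notation below this integral of `g' / H` is `a - b`.
  have hgap_eq : ∫ θ, (1 - m * weight m (radius (X t θ))) *
      (speed T X ν (θ, t) * areaDensity (X t) θ) ∂(sphMeasure m) =
      (∫ θ, speed T X ν (θ, t) * areaDensity (X t) θ ∂(sphMeasure m)) -
        m * ∫ θ, weight m (radius (X t θ)) * (speed T X ν (θ, t) * areaDensity (X t) θ)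
          ∂(sphMeasure m) := by
    have hmw : Continuous fun θ : Sph m => m * (weight m (radius (X t θ)) *
        (speed T X ν (θ, t) * areaDensity (X t) θ)) := continuous_const.mul (hwc.mul hsd)
    rw [← integral_const_mul, ← integral_sub (integrable_of_continuous_sph hsd)
      (integrable_of_continuous_sph hmw)]
    exact integral_congr_ae (.of_forall fun θ => by simp only; ring)
  have hgap_pos := integral_sph_pos hgap (fun θ => (mul_pos (hw1 θ) (hsd0 θ)).le)
    (Classical.arbitrary _) (mul_pos (hw1 _) (hsd0 _))
  have hK : ∫ θ, (1 - m * weight m (radius (X t θ))) * ((ν t θ).1 / ‖(X t θ).1.2‖) *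
      (speed T X ν (θ, t) * areaDensity (X t) θ) ∂(sphMeasure m) ≤
      ∫ θ, (1 - m * weight m (radius (X t θ))) *
        (speed T X ν (θ, t) * areaDensity (X t) θ) ∂(sphMeasure m) := by
    refine integral_mono (integrable_of_continuous_sph ((hwc'.mul hnc).mul hsd))
      (integrable_of_continuous_sph hgap) fun θ => ?_
    refine mul_le_mul_of_nonneg_right (mul_le_of_le_one_right (hw1 θ).le ?_) (hsd0 θ).le
    exact (div_le_div_of_nonneg_right (le_abs_self _) (norm_nonneg _)).trans
      (h.abs_normal_div_le ht θ)
  have hb0 : 0 ≤ m * ∫ θ, weight m (radius (X t θ)) *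
      (speed T X ν (θ, t) * areaDensity (X t) θ) ∂(sphMeasure m) :=
    mul_nonneg (Nat.cast_nonneg m) (integral_nonneg fun θ =>
      mul_nonneg (weight_nonneg m (radius_nonneg _)) (hsd0 θ).le)
  rw [hgap_eq] at hgap_pos hK
  set K := ∫ θ, (1 - m * weight m (radius (X t θ))) * ((ν t θ).1 / ‖(X t θ).1.2‖) *
      (speed T X ν (θ, t) * areaDensity (X t) θ) ∂(sphMeasure m) with hKdef
  set a := ∫ θ, speed T X ν (θ, t) * areaDensity (X t) θ ∂(sphMeasure m)
  set b := m * ∫ θ, weight m (radius (X t θ)) * (speed T X ν (θ, t) * areaDensity (X t) θ)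
    ∂(sphMeasure m)
  set G := surfaceIntegral (X t) fun p => g m (radius p) with hG
  set V := (hypVol m).real (Ω t) with hV
  set B := (hypVol m).real (ball m R) with hB
  have hC : 0 < (area (X t))⁻¹ / (V * HypFlow.h m (ballWeight m R)) :=
    div_pos (inv_pos.2 (h.area_pos ht)) (mul_pos hVpos hhpos)
  -- Uses `K ≤ a - b`, and `G / B ≤ G / V` multiplied by `b ≥ 0`.
  have hE : K - G / V * a + G / B * b ≤ (a - b) * (1 - G / V) := by
    have h1 : G / B ≤ G / V := div_le_div_of_nonneg_left (hVpos.le.trans hVG) hVpos hVB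
    have h2 := mul_le_mul_of_nonneg_right h1 hb0
    linarith
  have hGV : 1 ≤ G / V := (one_le_div hVpos).2 hVG
  have hE2 : (a - b) * (1 - G / V) ≤ 0 :=
    mul_nonpos_of_nonneg_of_nonpos hgap_pos.le (by linarith)
  refine ⟨_, hder, mul_nonpos_of_nonneg_of_nonpos hC.le (hE.trans hE2), ?_, ?_⟩
  · intro h0
    have h1 := (mul_eq_zero.1 h0).resolve_left hC.ne'
    -- The upper bound is squeezed to zero, and `a - b > 0` leaves only `G = V`.
    have h2 : (a - b) * (1 - G / V) = 0 := le_antisymm hE2 (h1 ▸ hE)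
    have h3 := (mul_eq_zero.1 h2).resolve_left hgap_pos.ne'
    refine h.exists_eq_geodesicSphere hm hconvex hstar ht ?_
    have h4 : G / V = 1 := by linarith
    exact (div_eq_one_iff_eq hVpos.ne').1 h4
  -- For a centred sphere every inequality used is an equality: `R = R₀`, `V = B`, `G = V` and `K =
  -- a - b`.
  · rintro ⟨R₀, hR0, hX⟩
    have hΩ0 := hΩ.eq_of_range hO hR0 hX
    have hae : Ω t =ᵐ[hypVol m] ball m R₀ := by rw [hΩ0]; exact openBall_ae_eq_ball hR0
    have hRR : R = R₀ := by
      refine (strictMonoOn_ballWeight hm).injOn hR hR0 ?_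
      rw [hW]
      exact setIntegral_congr_set hae
    have hVB' : V = B := by
      rw [hV, hB, hRR]; exact measureReal_congr hae
    have hGV' : G = V := le_antisymm (h.surfaceIntegral_le_volume hm hconvex hstar ht hR0 hX) hVG
    have hrad : ∀ θ, radius (X t θ) = R₀ := fun θ => by
      have : X t θ ∈ geodesicSphere m R₀ := by rw [← hX]; exact ⟨θ, rfl⟩
      exact this
    have hKab : K = a - b := by
      rw [hKdef, ← hgap_eq]
      refine integral_congr_ae (.of_forall fun θ => ?_)
      simp only
      rw [normal_time_eq (h.embedding t ht) (h.normal t ht) hR0 hrad hΩ0,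
        div_self (h.norm_pos hm hconvex hstar ht θ).ne', mul_one]
    rw [hKab, ← hVB', hGV', div_self hVpos.ne']
    ring

end IsIMCF

end HypFlow

theorem proposition4p2 (m : ℕ) (hm : 1 ≤ m) (T : EReal)
    (X : ℝ → HypFlow.Sph m → HypFlow.Hyp m) (ν : ℝ → HypFlow.Sph m → HypFlow.Mink m)
    (Ω : ℝ → Set (HypFlow.Hyp m))
    (hflow : HypFlow.IsIMCF T X ν Ω)
    (hstar : HypFlow.IsStarShaped (Set.range (X 0)))
    (hconvex : HypFlow.IsMeanConvex (X 0) (ν 0)) :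
    AntitoneOn (fun t => HypFlow.quantityA (X t) (Ω t)) (HypFlow.timeInterval T) ∧
    ∀ t ∈ HypFlow.timeInterval T, ∃ a : ℝ,
      HasDerivWithinAt (fun s => HypFlow.quantityA (X s) (Ω s)) a (HypFlow.timeInterval T) t ∧
      a ≤ 0 ∧
      (a = 0 ↔ ∃ R : ℝ, 0 < R ∧ Set.range (X t) = HypFlow.geodesicSphere m R) := by
  have key : ∀ t ∈ HypFlow.timeInterval T, ∃ a : ℝ,
      HasDerivWithinAt (fun s => HypFlow.quantityA (X s) (Ω s)) a (HypFlow.timeInterval T) t ∧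
      a ≤ 0 ∧ (a = 0 ↔ ∃ R : ℝ, 0 < R ∧ Set.range (X t) = HypFlow.geodesicSphere m R) :=
    fun t ht => hflow.exists_hasDerivWithinAt_quantityA hm hconvex hstar ht
  refine ⟨?_, key⟩
  choose! a ha hneg _ using key
  exact antitoneOn_of_hasDerivWithinAt_nonpos (HypFlow.convex_timeInterval T)
    (fun t ht => (ha t ht).continuousWithinAt)
    (fun t ht => (ha t (interior_subset ht)).mono interior_subset)
    (fun t ht => hneg t (interior_subset ht))
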